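/- **Setting.** Let $\mu(z)=(1+e^{-z})^{-1}$. There are $K$ servers with unknown parameters $\theta^*_1,\dots,\theta^*_K\in\mathbb R^d$ and one queue, empty at the beginning of round $1$. In round $t=1,2,\dots$ a job arrives with probability $\lambda\in(0,1)$ ($A(t)=1$); its context $x^{(t)}$ has law $\mathcal D$, and arrivals and contexts are independent of each other and over rounds. If the set $\mathcal X_t$ of waiting jobs is nonempty, the scheduler picks, on the basis of the past, a waiting job with context $x_t$ and a server $k_t$; given the past, the job leaves ($r_t=1$) with probability $\mu(x_t^{\mathsf T}\theta^*_{k_t})$ and otherwise stays ($r_t=0$). The job arriving in round $t$ joins the queue for round $t+1$. If the queue is empty, nothing is served and nothing is learned. $Q(t)$ is the queue length at the beginning of round $t$. $Q^*(t)$ is the queue length under the policy that knows the parameters and always picks a job-server pair with the greatest $\mu(x^{\mathsf T}\theta^*_k)$ (the earliest job in case of a tie). **Assumptions.** There are a set $\mathcal X\subset\mathbb R^d$ with $\mathcal D(\mathcal X)=1$ and numbers $S$, $\kappa,R,\sigma_0,\epsilon>0$ such that: $\|x\|_2\le1$ for $x\in\mathcal X$ and $\|\theta^*_k\|_2\le S$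 for all $k$; $1/\kappa\le\mu'(x^{\mathsf T}\theta)\le R$ for all $x\in\mathcal X$, $\|\theta\|_2\le S$; $\mathbb E_{x\sim\mathcal D}[xx^{\mathsf T}]\succeq\Sigma$ for some positive definite $\Sigma$ with $\lambda_{\min}(\Sigma)=\sigma_0^2$; for each $x\in\mathcal X$ there is $k$ with $\mu(x^{\mathsf T}\theta^*_k)-\lambda\ge\epsilon$. **Algorithm (CQB-$\varepsilon$).** Let $T\in\mathbb N$, $\varepsilon=T^{-1/2}$, $\lambda_0>0$, $\delta\in(0,1)$. Let $n_{t,k}$ be the number of rounds $i\le t$ in which a job was sent to server $k$, let $V_{t,k}=\kappa\lambda_0 I+\sum x_ix_i^{\mathsf T}$, the sum being over these rounds, and let $$b(n)=\tfrac{\kappa}{2}\sqrt{2d\log\Big(1+\tfrac{n}{\kappa\lambda_0d}\Big)+\log(K/\delta)}+\tfrac{\kappa S\sqrt{\lambda_0}}{2},\qquad \beta_{t,k}=b(n_{t,k}),\qquad \beta_T=b(T).$$ Let $\hat\theta^{(1)}_{t,k}$ maximize $\sum[r_i\log\mu(x_i^{\mathsf T}\theta)+(1-r_i)\log(1-\mu(x_i^{\mathsf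 T}\theta))]-\frac{\lambda_0}{2}\|\theta\|_2^2$ (sum over the same rounds), and let $\hat\theta_{t,k}$ minimize $\big\|\sum[\mu(x_i^{\mathsf T}\theta)-\mu(x_i^{\mathsf T}\hat\theta^{(1)}_{t,k})]x_i\big\|_{V_{t,k}^{-1}}$ over $\|\theta\|_2\le S$; it is left unchanged in rounds without new data for server $k$. For a constant $C_3>0$ put $$\tau=\frac{2C_3K}{\lambda}\Big(\frac{d+\log(K/\delta)}{\sigma_0^4}+\frac{16\beta_T^2}{\sigma_0^2(\epsilon-2\varepsilon)^2}\Big)+\frac{\log(1/\delta)}{2\lambda^2}.$$ In round $t$: (i) if $t\le\tau$ and a job arrived in round $t-1$, that job is chosen, and the server in round-robin order; (ii) if $t>\tau$, a job arrived in round $t-1$, and an independent bit of mean $\varepsilon$ drawn at the end of round $t-1$ equals $1$, that job is chosen with a uniformly random server; (iii) otherwise a maximizer of $\mu(x^{\mathsf T}\hat\theta_{t-1,k})+\beta_{t-1,k}\|x\|_{V_{t-1,k}^{-1}}$ over waiting jobs and servers is chosen. Ties among maximizers or minimizers are broken in any measurable way that does not look into the future. **Theorem.** There is an absolute constant $C_3>0$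 such that for all $K,\lambda,\kappa,S,\lambda_0$ and every $a$ there is a constant $C>0$, depending only on these, such that the following holds for all $d,\sigma_0,\epsilon,R,T,\delta$ and all environments satisfying the assumptions. If $T^{-a}\le\delta\le T^{-2}$, $T>4/\epsilon^2$ and $T\ge\tau$, then the queue length regret of the algorithm satisfies $$\mathbb E[Q(T)-Q^*(T)]\le C\Big(\frac{d^2T^{-1}\log^2T}{\sigma_0^8\epsilon^5}+\frac{dT^{-1/4}\log T}{\sigma_0^4\epsilon^3}+\frac{d^{3/2}T^{-1/4}\log^{3/2}T}{\sigma_0^5\epsilon^3}+\frac{d^2T^{-1/2}\log^{3/2}T}{\sigma_0^6\epsilon^3}\Big),$$ and in particular $\mathbb E[Q(T)-Q^*(T)]\le C\,\frac{d^2}{\sigma_0^8\epsilon^5}\,T^{-1/4}\log^2T=\tilde O(T^{-1/4})$. -/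

import Mathlib

open MeasureTheory ProbabilityTheory
open scoped Matrix

noncomputable section

namespace CQB

/-- Contexts and server parameters are vectors of `ℝ^d` with the Euclidean norm. -/
abbrev Vec (d : ℕ) := EuclideanSpace ℝ (Fin d)

/-- An environment: the set of possible contexts, the unknown parameters of the `K` servers, and
the distribution of the context of an arriving job. -/
structure Model (d K : ℕ) where
  contexts : Set (Vec d)
  theta : Fin K → Vec d
  dist : Measure (Vec d)

/-- The second moment matrix `E[x xᵀ]` of a distribution on `ℝ^d`. -/
def secondMoment {d : ℕ} (ν : Measure (Vec d)) : Matrix (Fin d) (Fin d) ℝ :=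
  Matrix.of fun i j => ∫ x, x i * x j ∂ν

/-- The assumptions on the environment: bounded contexts and parameters, bounds on the derivative of
the logistic function, a context distribution carried by the context set whose second moment
dominates a positive definite matrix with least eigenvalue `σ₀²`, and traffic slack `ε`. -/
structure Assumptions {d K : ℕ} (M : Model d K) (lam kap R S sig0 eps : ℝ) : Prop where
  context_norm : ∀ x ∈ M.contexts, ‖x‖ ≤ 1
  theta_norm : ∀ k, ‖M.theta k‖ ≤ S
  kap_pos : 0 < kap
  R_pos : 0 < R
  deriv_bounds : ∀ x ∈ M.contexts, ∀ θ : Vec d, ‖θ‖ ≤ S →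
    1 / kap ≤ deriv Real.sigmoid (inner ℝ x θ) ∧ deriv Real.sigmoid (inner ℝ x θ) ≤ R
  dist_prob : IsProbabilityMeasure M.dist
  dist_contexts : ∀ᵐ x ∂M.dist, x ∈ M.contexts
  sig0_pos : 0 < sig0
  second_moment : ∃ (Sg : Matrix (Fin d) (Fin d) ℝ) (h : Sg.PosDef),
    (secondMoment M.dist - Sg).PosSemidef ∧
      IsLeast (Set.range h.isHermitian.eigenvalues) (sig0 ^ 2)
  eps_pos : 0 < eps
  slack : ∀ x ∈ M.contexts, ∃ k, Real.sigmoid (inner ℝ x (M.theta k)) - lam ≥ eps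

/-! ### Randomness -/

/-- The law of a random bit that is `true` with probability `p`. -/
def bern (p : ℝ) : Measure Bool :=
  ENNReal.ofReal p • Measure.dirac true + ENNReal.ofReal (1 - p) • Measure.dirac false

/-- The exogenous random variables of the rounds `t = 1, 2, …`. -/
structure Noise (Ω : Type*) (d K : ℕ) where
  /-- whether a job arrives in round `t` -/
  arrive : ℕ → Ω → Bool
  /-- the context of the job arriving in round `t` (irrelevant if none arrives) -/
  feature : ℕ → Ω → Vec d
  /-- the exploration bit sampled at the end of round `t`, for use in round `t + 1` -/
  coin : ℕ → Ω → Bool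
  /-- the server to be used in round `t + 1` in case that round is an `ε`-exploration round -/
  pick : ℕ → Ω → Fin K
  /-- the uniform variable deciding the service in round `t` -/
  unif : ℕ → Ω → ℝ

/-- All exogenous variables of one round. -/
def Noise.round {Ω : Type*} {d K : ℕ} (N : Noise Ω d K) (t : ℕ) (ω : Ω) :
    Bool × Vec d × Bool × Fin K × ℝ :=
  (N.arrive t ω, N.feature t ω, N.coin t ω, N.pick t ω, N.unif t ω)

/-- The joint law of the exogenous variables of one round: an arrival with probability `lam`, a
context with law `ν`, an exploration bit with probability `p`, a uniform server and a uniform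
number in `[0, 1]`, all independent. -/
def roundLaw {d : ℕ} (K : ℕ) (ν : Measure (Vec d)) (lam p : ℝ) :
    Measure (Bool × Vec d × Bool × Fin K × ℝ) :=
  (bern lam).prod (ν.prod ((bern p).prod
    ((uniformOn (Set.univ : Set (Fin K))).prod (volume.restrict (Set.Icc (0 : ℝ) 1)))))

/-- The exogenous variables of the rounds are i.i.d. with the law above: the variables of round
`t + 1` are independent of the history `ℱ t` up to the end of round `t`. The history may contain
further randomness, such as the one used for breaking ties. -/
structure IsNoise {Ω : Type*} [m : MeasurableSpace Ω] {d K : ℕ} (P : Measure Ω)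
    (ℱ : Filtration ℕ m) (ν : Measure (Vec d)) (lam p : ℝ) (N : Noise Ω d K) : Prop where
  adapted : ∀ t, Measurable[ℱ (t + 1)] (N.round (t + 1))
  law : ∀ t, P.map (N.round (t + 1)) = roundLaw K ν lam p
  indep : ∀ t, Indep (ℱ t) (MeasurableSpace.comap (N.round (t + 1)) inferInstance) P

/-! ### The queue -/

/-- The decisions of a scheduler: the job selected in round `t` (a job is identified with the round
of its arrival, at most one job arriving per round) and the server it is sent to. If the queue is
empty, the decision is void. -/
structure Schedule (Ω : Type*) (K : ℕ) where
  job : ℕ → Ω → ℕ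
  server : ℕ → Ω → Fin K

/-- The decisions of round `t + 1` are taken on the basis of the history up to round `t`. -/
structure Schedule.Adapted {Ω : Type*} [m : MeasurableSpace Ω] {K : ℕ} (ℱ : Filtration ℕ m)
    (π : Schedule Ω K) : Prop where
  job : ∀ t, Measurable[ℱ t] (π.job (t + 1))
  server : ∀ t, Measurable[ℱ t] (π.server (t + 1))

section Dynamics

variable {Ω : Type*} {d K : ℕ} (M : Model d K) (N : Noise Ω d K) (π : Schedule Ω K)

/-- The departure rate `μ(xᵀ θ*_k)` of job `j` at server `k`. -/
def serviceRate (ω : Ω) (j : ℕ) (k : Fin K) : ℝ :=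
  Real.sigmoid (inner ℝ (N.feature j ω) (M.theta k))

/-- The set of waiting jobs at the beginning of round `t`. The queue is empty at the beginning of
round `1`. In round `t` the selected job leaves if it is served successfully, and the job arriving
in round `t`, if any, joins the queue. -/
def queue : ℕ → Ω → Finset ℕ
  | 0, _ => ∅
  | t + 1, ω =>
    if t = 0 then ∅
    else
      (if N.unif t ω ≤ serviceRate M N ω (π.job t ω) (π.server t ω)
        then (queue t ω).erase (π.job t ω) else queue t ω) ∪
      (if N.arrive t ω = true then {t} else ∅)

/-- The queue length at the beginning of round `t`. -/
def queueLength (t : ℕ) (ω : Ω) : ℝ := ((queue M N π t ω).card : ℝ)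

/-- The binary feedback of round `t`: whether the server completes the selected job. -/
def reward (t : ℕ) (ω : Ω) : ℝ :=
  open Classical in
  if N.unif t ω ≤ serviceRate M N ω (π.job t ω) (π.server t ω) then 1 else 0

/-- The context `x_t` of the job selected in round `t`. -/
def chosen (t : ℕ) (ω : Ω) : Vec d := N.feature (π.job t ω) ω

/-- Some job arrived in the round before round `t`. -/
def Arrived (t : ℕ) (ω : Ω) : Prop := 2 ≤ t ∧ N.arrive (t - 1) ω = true

/-- The optimal policy, which knows the parameters: it selects a job-server pair with the greatest
departure rate, and the earliest job among those attaining it. -/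
structure IsOptimal [m : MeasurableSpace Ω] (ℱ : Filtration ℕ m) : Prop where
  adapted : π.Adapted ℱ
  mem : ∀ t, 1 ≤ t → ∀ ω, (queue M N π t ω).Nonempty → π.job t ω ∈ queue M N π t ω
  max : ∀ t, 1 ≤ t → ∀ ω, ∀ j ∈ queue M N π t ω, ∀ k,
    serviceRate M N ω j k ≤ serviceRate M N ω (π.job t ω) (π.server t ω)
  first : ∀ t, 1 ≤ t → ∀ ω, ∀ j ∈ queue M N π t ω, ∀ k,
    serviceRate M N ω (π.job t ω) (π.server t ω) ≤ serviceRate M N ω j k → π.job t ω ≤ j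

/-! ### Estimators and confidence radii -/

/-- The rounds up to `t` in which a job was sent to server `k`; rounds with an empty queue give no
feedback. -/
def rounds (t : ℕ) (k : Fin K) (ω : Ω) : Finset ℕ :=
  (Finset.Icc 1 t).filter fun i => (queue M N π i ω).Nonempty ∧ π.server i ω = k

/-- The design matrix `V_{t,k} = κ λ₀ I + ∑ x_i x_iᵀ`. -/
def design (kap lam0 : ℝ) (t : ℕ) (k : Fin K) (ω : Ω) : Matrix (Fin d) (Fin d) ℝ :=
  (kap * lam0) • (1 : Matrix (Fin d) (Fin d) ℝ) +
    ∑ i ∈ rounds M N π t k ω,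
      Matrix.vecMulVec (fun a => chosen N π i ω a) (fun a => chosen N π i ω a)

/-- The norm `‖x‖_A = (xᵀ A x)^{1/2}`. -/
def wnorm (A : Matrix (Fin d) (Fin d) ℝ) (x : Vec d) : ℝ :=
  Real.sqrt ((fun a => x a) ⬝ᵥ (A *ᵥ fun a => x a))

/-- The `ℓ²`-regularized log-likelihood of the logistic model on the data of server `k`. -/
def logLik (lam0 : ℝ) (t : ℕ) (k : Fin K) (ω : Ω) (θ : Vec d) : ℝ :=
  ∑ i ∈ rounds M N π t k ω,
      (reward M N π i ω * Real.log (Real.sigmoid (inner ℝ (chosen N π i ω) θ)) +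
        (1 - reward M N π i ω) * Real.log (1 - Real.sigmoid (inner ℝ (chosen N π i ω) θ)))
    - lam0 / 2 * ‖θ‖ ^ 2

/-- `θhat` is an estimate `θ̂_{t,k}`: a projection of the maximizer `θ1` of the regularized
log-likelihood onto the ball of radius `S`. -/
def IsEstimate (kap S lam0 : ℝ) (t : ℕ) (k : Fin K) (ω : Ω) (θhat : Vec d) : Prop :=
  ‖θhat‖ ≤ S ∧ ∃ θ1 : Vec d,
    (∀ θ, logLik M N π lam0 t k ω θ ≤ logLik M N π lam0 t k ω θ1) ∧
    ∀ θ : Vec d, ‖θ‖ ≤ S →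
      wnorm (design M N π kap lam0 t k ω)⁻¹
        (∑ i ∈ rounds M N π t k ω,
          (Real.sigmoid (inner ℝ (chosen N π i ω) θhat)
            - Real.sigmoid (inner ℝ (chosen N π i ω) θ1)) • chosen N π i ω) ≤
      wnorm (design M N π kap lam0 t k ω)⁻¹
        (∑ i ∈ rounds M N π t k ω,
          (Real.sigmoid (inner ℝ (chosen N π i ω) θ)
            - Real.sigmoid (inner ℝ (chosen N π i ω) θ1)) • chosen N π i ω)

end Dynamics

/-- The confidence radius after `n` observations. Thus `β_{t,k}` is its value at the number of
observations of server `k` up to round `t`, and `β_T` is its value at `T`. -/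
def radius (d K : ℕ) (kap S lam0 delta : ℝ) (n : ℕ) : ℝ :=
  kap / 2 * Real.sqrt (2 * d * Real.log (1 + 1 / (kap * lam0 * d) * n) + Real.log (K / delta))
    + kap * S * Real.sqrt lam0 / 2

/-- The length `τ` of the pure-exploration phase; `1 / √T` is the exploration probability. -/
def explorationLength (C3 : ℝ) (d K T : ℕ) (lam kap S lam0 sig0 eps delta : ℝ) : ℝ :=
  2 * C3 * K / lam *
      ((d + Real.log (K / delta)) / sig0 ^ 4 +
        16 * radius d K kap S lam0 delta T ^ 2 /
          (sig0 ^ 2 * (eps - 2 * (1 / Real.sqrt T)) ^ 2))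
    + Real.log (1 / delta) / (2 * lam ^ 2)

/-! ### The algorithm -/

section Algorithm

variable {Ω : Type*} {d K : ℕ} (M : Model d K) (N : Noise Ω d K) (π : Schedule Ω K)

/-- The upper confidence bound of job `j` at server `k` in round `t`, from the estimates
`est (t - 1) k`. -/
def ucb (kap S lam0 delta : ℝ) (est : ℕ → Fin K → Ω → Vec d) (t : ℕ) (ω : Ω) (j : ℕ)
    (k : Fin K) : ℝ :=
  Real.sigmoid (inner ℝ (N.feature j ω) (est (t - 1) k ω)) +
    radius d K kap S lam0 delta (rounds M N π (t - 1) k ω).card *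
      wnorm (design M N π kap lam0 (t - 1) k ω)⁻¹ (N.feature j ω)

/-- Round `t` is a pure-exploration round. -/
def PureExploration (tau : ℝ) (t : ℕ) (ω : Ω) : Prop := (t : ℝ) ≤ tau ∧ Arrived N t ω

/-- Round `t` is an `ε`-exploration round. -/
def EpsExploration (tau : ℝ) (t : ℕ) (ω : Ω) : Prop :=
  tau < (t : ℝ) ∧ N.coin (t - 1) ω = true ∧ Arrived N t ω

/-- The round-robin pointer at the beginning of round `t`. -/
def pointer (tau : ℝ) : ℕ → Ω → ℕ
  | 0, _ => 0
  | t + 1, ω =>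
    open Classical in
    if PureExploration N tau t ω then (pointer tau t ω + 1) % K else pointer tau t ω

/-- The schedule `π` is produced by the algorithm with pure-exploration length `tau`, where
`est t k` is the estimate for server `k` at the end of round `t`. -/
structure IsCQB [m : MeasurableSpace Ω] (ℱ : Filtration ℕ m) (kap S lam0 delta tau : ℝ)
    (est : ℕ → Fin K → Ω → Vec d) : Prop where
  adapted : π.Adapted ℱ
  est_adapted : ∀ t k, Measurable[ℱ t] (est t k)
  est_spec : ∀ t k ω, IsEstimate M N π kap S lam0 t k ω (est t k ω)
  est_keep : ∀ t, 1 ≤ t → ∀ k ω, t ∉ rounds M N π t k ω → est t k ω = est (t - 1) k ω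
  mem : ∀ t, 1 ≤ t → ∀ ω, (queue M N π t ω).Nonempty → π.job t ω ∈ queue M N π t ω
  pure : ∀ t, 1 ≤ t → ∀ ω, PureExploration N tau t ω →
    π.job t ω = t - 1 ∧ (π.server t ω : ℕ) = pointer (K := K) N tau t ω
  explore : ∀ t, 1 ≤ t → ∀ ω, EpsExploration N tau t ω →
    π.job t ω = t - 1 ∧ π.server t ω = N.pick (t - 1) ω
  exploit : ∀ t, 1 ≤ t → ∀ ω, ¬ PureExploration N tau t ω → ¬ EpsExploration N tau t ω →
    ∀ j ∈ queue M N π t ω, ∀ k,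
      ucb M N π kap S lam0 delta est t ω j k ≤
        ucb M N π kap S lam0 delta est t ω (π.job t ω) (π.server t ω)

end Algorithm

end CQB

end

/-!
# Queue length regret of contextual queueing bandits with `ε`-exploration

The proof compares the queue of the algorithm with the optimal queue pathwise, and controls the
difference by three probabilistic facts.

*Coupling.* Both systems see the same arrivals, contexts and uniform variables. Call round `t` a
loss if the service chosen by the algorithm fails although some waiting job and server would have
succeeded with the same uniform variable. Counting for every threshold `v` the waiting jobs whose
rates at all servers are below `v`, one sees that the algorithm's count exceeds the optimal one by at
most the number of losses since the algorithm's queue was last empty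
(`card_queue_le_add_losses`). So the regret at `T` is at most the number of losses in a short window
before `T`, unless the queue was never empty in that window.

*Confidence.* The noise of the observations obeys a self-normalized bound, from Ville's inequality
for an explicit supermartingale (`measure_exists_scoreForm_ge_le`). The regularized maximum
likelihood estimate is then analysed deterministically: if the design matrices dominate `m` times the
identity and `4 β_T < √m`, the pair chosen in an exploitation round is optimal up to
`8 β_T / √m` (`serviceRate_le_servedRate_add`). The bound on `m` comes from the exploration data, which
are i.i.d. samples of the context; the matrices `x xᵀ` are regarded as vectors of a Euclidean
space, where `E cosh (s ‖Y‖)` grows by at most a factor `exp (2 s²)` per sample whatever the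
dimension (`lintegral_cosh_norm_add_le`, `measure_explorationSum_gt_le`). A loss in an exploitation
round forces the uniform variable into an interval of length `8 β_T / √m` (`measure_loss_le`).

*Drift.* Once pure exploration is over, `8 β_T / √m ≤ ε / 2` for the slack `ε`, so that the queue has
negative drift except in `ε`-exploration rounds. These are paid for by an additional factor of an
exponential Lyapunov function (`lyapunov`); its expectation contracts
(`setLIntegral_lyapunov_le`), and over a window in which the queue stays nonempty it contracts
without any additive term (`setLIntegral_lyapunov_nonempty_le`).

The bound results from three regimes of the horizon `T`, with `τ` the length of pure exploration. If
`T < 64 τ / ε`, the expected queue length itself is `O(τ)`, hence at most of the order of the first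
term (`integral_queueLength_le_of_short`). If `T` is larger, but `√T` is small compared with
`log T / σ₀⁴`, the queue is stationary with mean `O(log T / ε)`, which is at most of the order of the
second term (`integral_queueLength_le_of_medium`). Otherwise the order of `√T` data per server that
`ε`-exploration has gathered by half of the horizon make the losses in a window of `O(log T / ε²)`
rounds rare, and give the second and third terms (`integral_regret_le_of_long`).
-/

namespace CQB

/-! ### Elementary inequalities -/

lemma sigmoid_add_sub_ge_of_nonneg (z : ℝ) {u : ℝ} (hu : 0 ≤ u) :
    Real.sigmoid z * (1 - Real.sigmoid z) * (u / (2 * max 1 u)) ≤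
      Real.sigmoid (z + u) - Real.sigmoid z := by
  have ha : 0 < Real.exp (-z) := Real.exp_pos _
  have hb : 0 < Real.exp (-u) := Real.exp_pos _
  have hb1 : Real.exp (-u) ≤ 1 := Real.exp_le_one_iff.2 (by linarith)
  have hsum : Real.exp (-(z + u)) = Real.exp (-z) * Real.exp (-u) := by
    rw [← Real.exp_add]; ring_nf
  have hu1 : u / (2 * max 1 u) ≤ 1 - Real.exp (-u) := by
    have h1 : Real.exp (-u) ≤ 1 / (1 + u) := by
      rw [Real.exp_neg, ← one_div]
      exact one_div_le_one_div_of_le (by linarith) (by linarith [Real.add_one_le_exp u])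
    have h2 : u / (2 * max 1 u) ≤ u / (1 + u) := by
      apply div_le_div_of_nonneg_left hu (by linarith)
      linarith [le_max_left 1 u, le_max_right 1 u]
    have h3 : u / (1 + u) = 1 - 1 / (1 + u) := by field_simp; ring
    linarith
  have key : Real.sigmoid z * (1 - Real.sigmoid z) * (1 - Real.exp (-u)) ≤
      Real.sigmoid (z + u) - Real.sigmoid z := by
    rw [Real.sigmoid_def, Real.sigmoid_def, hsum]
    set a := Real.exp (-z)
    set b := Real.exp (-u)
    have e1 : (1 + a)⁻¹ * (1 - (1 + a)⁻¹) * (1 - b) = a * (1 - b) / ((1 + a) * (1 + a)) := by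
      field_simp; ring
    have e2 : (1 + a * b)⁻¹ - (1 + a)⁻¹ = a * (1 - b) / ((1 + a * b) * (1 + a)) := by
      field_simp; ring
    rw [e1, e2]
    apply div_le_div_of_nonneg_left (mul_nonneg ha.le (by linarith)) (by positivity)
    gcongr
    nlinarith
  refine le_trans (mul_le_mul_of_nonneg_left hu1 ?_) key
  exact mul_nonneg (Real.sigmoid_nonneg _) (by linarith [Real.sigmoid_le_one z])

/-- A quantitative form of the strict monotonicity of the logistic function. The slope at `z` alone
controls the increment, which is what allows a maximizer outside the ball of radius `S`. -/
lemma sigmoid_sub_mul_sub_ge (z w : ℝ) :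
    Real.sigmoid z * (1 - Real.sigmoid z) * ((w - z) ^ 2 / (2 * max 1 |w - z|)) ≤
      (Real.sigmoid w - Real.sigmoid z) * (w - z) := by
  rcases le_total z w with h | h
  · have := sigmoid_add_sub_ge_of_nonneg z (sub_nonneg.2 h)
    rw [abs_of_nonneg (sub_nonneg.2 h)]
    have h2 := mul_le_mul_of_nonneg_right this (sub_nonneg.2 h)
    rw [add_sub_cancel] at h2
    refine le_trans (le_of_eq ?_) h2
    ring
  · have := sigmoid_add_sub_ge_of_nonneg (-z) (sub_nonneg.2 h)
    rw [abs_sub_comm, abs_of_nonneg (sub_nonneg.2 h)]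
    have h2 := mul_le_mul_of_nonneg_right this (sub_nonneg.2 h)
    rw [show -z + (z - w) = -w by ring, Real.sigmoid_neg, Real.sigmoid_neg] at h2
    have e1 : (Real.sigmoid w - Real.sigmoid z) * (w - z) =
      (1 - Real.sigmoid w - (1 - Real.sigmoid z)) * (z - w) := by ring
    rw [e1]
    refine le_trans (le_of_eq ?_) h2
    ring

lemma deriv_sigmoid_apply (z : ℝ) :
    deriv Real.sigmoid z = Real.sigmoid z * (1 - Real.sigmoid z) := by
  rw [Real.deriv_sigmoid]

lemma deriv_sigmoid_le (z : ℝ) : deriv Real.sigmoid z ≤ 1 / 4 := by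
  rw [deriv_sigmoid_apply]
  nlinarith [sq_nonneg (Real.sigmoid z - 1 / 2)]

lemma abs_sigmoid_sub_le (z w : ℝ) : |Real.sigmoid w - Real.sigmoid z| ≤ 1 / 4 * |w - z| := by
  have := Convex.norm_image_sub_le_of_norm_deriv_le (f := Real.sigmoid) (C := 1 / 4)
    (s := Set.univ) (x := z) (y := w) (fun x _ => differentiable_sigmoid x)
    (fun x _ => by
      rw [Real.norm_eq_abs, abs_of_nonneg]
      · exact deriv_sigmoid_le x
      · rw [deriv_sigmoid_apply]
        exact mul_nonneg (Real.sigmoid_nonneg _) (by linarith [Real.sigmoid_le_one x]))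
    convex_univ (Set.mem_univ _) (Set.mem_univ _)
  simpa using this

/-- If the slope of the logistic function is at least `c` between `z` and `w`, so is the difference
quotient. -/
lemma sigmoid_sub_mul_sub_ge_of_deriv_ge {c : ℝ} (z w : ℝ)
    (h : ∀ s ∈ Set.Icc (0 : ℝ) 1, c ≤ deriv Real.sigmoid (z + s * (w - z))) :
    c * (w - z) ^ 2 ≤ (Real.sigmoid w - Real.sigmoid z) * (w - z) := by
  have hd : ∀ s : ℝ, HasDerivAt (fun s => Real.sigmoid (z + s * (w - z)) * (w - z))
      (deriv Real.sigmoid (z + s * (w - z)) * (w - z) * (w - z)) s := by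
    intro s
    have h1 : HasDerivAt (fun s : ℝ => z + s * (w - z)) (w - z) s := by
      simpa using ((hasDerivAt_id s).mul_const (w - z)).const_add z
    exact (((differentiable_sigmoid _).hasDerivAt).comp s h1).mul_const (w - z)
  obtain ⟨s, hs, hs2⟩ := exists_hasDerivAt_eq_slope
    (fun s => Real.sigmoid (z + s * (w - z)) * (w - z)) _ one_pos
    (fun s _ => (hd s).continuousAt.continuousWithinAt) (fun s _ => hd s)
  have h1 := h s ⟨hs.1.le, hs.2.le⟩
  simp only [one_mul, zero_mul, add_zero, sub_zero, div_one] at hs2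
  rw [show z + (w - z) = w by ring] at hs2
  nlinarith [sq_nonneg (w - z)]

/-- The convexity of `y ↦ cosh √y`, in the form needed for sums of bounded vectors in a Hilbert
space. -/
lemma cosh_sqrt_le (a b c : ℝ) (hc : c ∈ Set.Icc (-1 : ℝ) 1) :
    Real.cosh (Real.sqrt (a ^ 2 + 2 * a * b * c + b ^ 2)) ≤
      Real.cosh a * Real.cosh b + c * (Real.sinh a * Real.sinh b) := by
  obtain ⟨hc1, hc2⟩ := hc
  set y := a ^ 2 + 2 * a * b * c + b ^ 2 with hy
  have hy' : y = (1 + c) / 2 * (a + b) ^ 2 + (1 - c) / 2 * (a - b) ^ 2 := by rw [hy]; ring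
  have hy0 : 0 ≤ y := by
    rw [hy']
    have h1 : 0 ≤ (1 + c) / 2 := by linarith
    have h2 : 0 ≤ (1 - c) / 2 := by linarith
    positivity
  have e : Real.cosh a * Real.cosh b + c * (Real.sinh a * Real.sinh b) =
      (1 + c) / 2 * Real.cosh (a + b) + (1 - c) / 2 * Real.cosh (a - b) := by
    rw [Real.cosh_add, Real.cosh_sub]; ring
  rw [e]
  have s1 := Real.hasSum_cosh (Real.sqrt y)
  have s2 := ((Real.hasSum_cosh (a + b)).mul_left ((1 + c) / 2)).add
    ((Real.hasSum_cosh (a - b)).mul_left ((1 - c) / 2))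
  refine hasSum_le (fun n => ?_) s1 s2
  rw [pow_mul, Real.sq_sqrt hy0, hy', pow_mul, pow_mul, ← mul_div_assoc, ← mul_div_assoc,
    ← add_div]
  gcongr
  have hconv : ConvexOn ℝ (Set.Ici 0) fun x : ℝ => x ^ n := convexOn_pow n
  have := hconv.2 (Set.mem_Ici.2 (sq_nonneg (a + b))) (Set.mem_Ici.2 (sq_nonneg (a - b)))
    (show 0 ≤ (1 + c) / 2 by linarith) (show 0 ≤ (1 - c) / 2 by linarith) (by ring)
  simpa using this

lemma exp_two_mul_div_le {w : ℝ} (hw : 0 ≤ w) : Real.exp (2 * w / (1 + w)) ≤ (1 + w) ^ 2 := by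
  have h := Real.one_sub_inv_le_log_of_pos (x := 1 + w) (by linarith)
  have h2 : 2 * w / (1 + w) ≤ Real.log ((1 + w) ^ 2) := by
    rw [Real.log_pow]
    have : 2 * w / (1 + w) = 2 * (1 - (1 + w)⁻¹) := by field_simp; ring
    rw [this]; push_cast; linarith
  rw [← Real.exp_log (show 0 < (1 + w) ^ 2 by positivity)]
  exact Real.exp_le_exp.2 h2

lemma isProbabilityMeasure_bern {p : ℝ} (h0 : 0 ≤ p) (h1 : p ≤ 1) :
    IsProbabilityMeasure (bern p) := ⟨by
  simp only [bern, Measure.coe_add, Measure.coe_smul, Pi.add_apply, Pi.smul_apply, smul_eq_mul,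
    measure_univ, mul_one]
  rw [← ENNReal.ofReal_add h0 (by linarith)]; simp⟩

lemma lintegral_bern (p : ℝ) (f : Bool → ENNReal) :
    ∫⁻ b, f b ∂(bern p) = ENNReal.ofReal p * f true + ENNReal.ofReal (1 - p) * f false := by
  rw [bern, lintegral_add_measure, lintegral_smul_measure, lintegral_smul_measure]
  simp

/-- Hoeffding's lemma for a centred Bernoulli variable. -/
lemma bernoulli_mgf_le {p : ℝ} (h0 : 0 ≤ p) (h1 : p ≤ 1) (s : ℝ) :
    p * Real.exp (s * (1 - p)) + (1 - p) * Real.exp (s * (-p)) ≤ Real.exp (s ^ 2 / 8) := by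
  have := isProbabilityMeasure_bern h0 h1
  have hint : ∀ f : Bool → ℝ, ∫ b, f b ∂(bern p) = p * f true + (1 - p) * f false := by
    intro f
    rw [bern, integral_add_measure, integral_smul_measure, integral_smul_measure]
    · simp [ENNReal.toReal_ofReal, h0, h1]
    · exact (integrable_dirac (by simp)).smul_measure (by simp)
    · exact (integrable_dirac (by simp)).smul_measure (by simp)
  let X : Bool → ℝ := fun b => if b then 1 - p else -p
  have hX : HasSubgaussianMGF X _ (bern p) := hasSubgaussianMGF_of_mem_Icc_of_integral_eq_zero
    (X := X) (a := -p) (b := 1 - p) (measurable_of_finite _).aemeasurable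
    (Filter.Eventually.of_forall fun b => by cases b <;> simp [X])
    (by rw [hint]; simp [X]; ring)
  have := hX.mgf_le s
  rw [mgf, hint] at this
  simp only [X, if_true, Bool.false_eq_true, if_false] at this
  refine this.trans (le_of_eq ?_)
  congr 1
  rw [show (1 - p - -p) = 1 by ring]
  norm_num
  ring

/-! ### The regularized maximum likelihood estimator and its projection -/

lemma sqrt_mul_le_sqrt {m a q : ℝ} (hm : 0 ≤ m) (ha : 0 ≤ a) (h : m * a ^ 2 ≤ q) :
    Real.sqrt m * a ≤ Real.sqrt q := by
  rw [← Real.sqrt_sq ha, ← Real.sqrt_mul hm]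
  exact Real.sqrt_le_sqrt h

section Estimator

variable {E ι : Type*} [NormedAddCommGroup E] [InnerProductSpace ℝ E]

/-- The quadratic form `v ‖u‖² + ∑ ⟨xᵢ, u⟩²` of a regularized design, on an arbitrary inner product
space. Its dual norm is used through the inequality `⟨g, u⟩ ≤ c √(designForm u)` for all `u`. -/
def designForm (v : ℝ) (I : Finset ι) (x : ι → E) (u : E) : ℝ :=
  v * ‖u‖ ^ 2 + ∑ i ∈ I, (inner ℝ (x i) u) ^ 2

lemma designForm_nonneg {v : ℝ} (hv : 0 ≤ v) (I : Finset ι) (x : ι → E) (u : E) :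
    0 ≤ designForm v I x u :=
  add_nonneg (by positivity) (Finset.sum_nonneg fun _ _ => sq_nonneg _)

lemma designForm_neg (v : ℝ) (I : Finset ι) (x : ι → E) (u : E) :
    designForm v I x (-u) = designForm v I x u := by
  simp [designForm, inner_neg_right]

lemma mul_norm_sq_le_designForm (v : ℝ) (I : Finset ι) (x : ι → E) (u : E) :
    v * ‖u‖ ^ 2 ≤ designForm v I x u :=
  le_add_of_nonneg_right (Finset.sum_nonneg fun _ _ => sq_nonneg _)

lemma le_of_sq_le_mul_self {a c : ℝ} (ha : 0 ≤ a) (hc : 0 ≤ c) (h : a ^ 2 ≤ c * a) : a ≤ c := by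
  rcases ha.eq_or_lt with h0 | h0
  · rw [← h0]; exact hc
  · exact le_of_mul_le_mul_right (by rw [← sq]; exact h) h0

/-- The regularized maximum likelihood estimator lies near the parameter once the design form
dominates `m ‖u‖²` with `m` large. No a priori bound on the estimator is needed: the likelihood
equation bounds the error in terms of `max 1` of itself. -/
lemma designForm_mle_sub_le {I : Finset ι} {x : ι → E} {r : ι → ℝ} {kap lam0 m W : ℝ}
    {θs θ1 : E} (hkap : 0 < kap) (hlam0 : 0 < lam0) (hx : ∀ i ∈ I, ‖x i‖ ≤ 1)
    (hslope : ∀ i ∈ I, 1 / kap ≤ deriv Real.sigmoid (inner ℝ (x i) θs))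
    (hfoc : ∀ u, ∑ i ∈ I, (r i - Real.sigmoid (inner ℝ (x i) θ1)) * inner ℝ (x i) u
      = lam0 * inner ℝ θ1 u)
    (hW : ∀ u, ∑ i ∈ I, (r i - Real.sigmoid (inner ℝ (x i) θs)) * inner ℝ (x i) u
      - lam0 * inner ℝ θs u ≤ W * Real.sqrt (designForm (kap * lam0) I x u))
    (hW0 : 0 ≤ W) (hm : 0 < m) (hmq : ∀ u, m * ‖u‖ ^ 2 ≤ designForm (kap * lam0) I x u)
    (hsmall : 2 * kap * W < Real.sqrt m) :
    Real.sqrt (designForm (kap * lam0) I x (θ1 - θs)) ≤ 2 * kap * W := by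
  set Δ := θ1 - θs with hΔ
  set q := designForm (kap * lam0) I x Δ with hq
  set R := max 1 ‖Δ‖ with hR
  have hR1 : 1 ≤ R := le_max_left _ _
  have hq0 : 0 ≤ q := designForm_nonneg (by positivity) _ _ _
  have hkR : 0 < 2 * kap * R := by positivity
  have hup : ∑ i ∈ I, (Real.sigmoid (inner ℝ (x i) θ1) - Real.sigmoid (inner ℝ (x i) θs)) *
      inner ℝ (x i) Δ + lam0 * ‖Δ‖ ^ 2 ≤ W * Real.sqrt q := by
    refine le_trans (le_of_eq ?_) (hW Δ)
    have h1 := hfoc Δ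
    have h2 : inner ℝ θ1 Δ = inner ℝ θs Δ + ‖Δ‖ ^ 2 := by
      rw [← real_inner_self_eq_norm_sq, ← inner_add_left, hΔ]; simp
    rw [h2] at h1
    simp only [sub_mul, Finset.sum_sub_distrib] at h1 ⊢
    linarith
  have hlow : q / (2 * kap * R) ≤
      ∑ i ∈ I, (Real.sigmoid (inner ℝ (x i) θ1) - Real.sigmoid (inner ℝ (x i) θs)) *
      inner ℝ (x i) Δ + lam0 * ‖Δ‖ ^ 2 := by
    rw [hq, designForm, add_div, add_comm, Finset.sum_div]
    apply add_le_add
    · apply Finset.sum_le_sum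
      intro i hi
      have hin : inner ℝ (x i) Δ = inner ℝ (x i) θ1 - inner ℝ (x i) θs := by
        rw [hΔ, inner_sub_right]
      have h1 := sigmoid_sub_mul_sub_ge (inner ℝ (x i) θs) (inner ℝ (x i) θ1)
      rw [← hin, ← deriv_sigmoid_apply] at h1
      refine le_trans ?_ h1
      have habs : |inner ℝ (x i) Δ| ≤ ‖Δ‖ := (abs_real_inner_le_norm _ _).trans
        (mul_le_of_le_one_left (norm_nonneg _) (hx i hi))
      have hmax : max 1 |inner ℝ (x i) Δ| ≤ R := max_le_max le_rfl habs
      calc (inner ℝ (x i) Δ) ^ 2 / (2 * kap * R)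
          = 1 / kap * ((inner ℝ (x i) Δ) ^ 2 / (2 * R)) := by field_simp
        _ ≤ _ := by
          apply mul_le_mul (hslope i hi) _ (by positivity)
            (le_trans (by positivity) (hslope i hi))
          apply div_le_div_of_nonneg_left (sq_nonneg _) (by positivity)
          linarith
    · have : kap * lam0 * ‖Δ‖ ^ 2 / (2 * kap * R) = lam0 * ‖Δ‖ ^ 2 / (2 * R) := by field_simp
      rw [this]
      exact div_le_self (by positivity) (by linarith)
  have hs : Real.sqrt q ≤ 2 * kap * R * W := by
    apply le_of_sq_le_mul_self (Real.sqrt_nonneg _) (by positivity)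
    rw [Real.sq_sqrt hq0]
    have := hlow.trans hup
    rw [div_le_iff₀ hkR] at this
    linarith
  have hΔs : Real.sqrt m * ‖Δ‖ ≤ Real.sqrt q := sqrt_mul_le_sqrt hm.le (norm_nonneg _) (hmq Δ)
  have hΔ1 : ‖Δ‖ ≤ 1 := by
    by_contra hcon
    push Not at hcon
    have hRe : R = ‖Δ‖ := max_eq_right hcon.le
    rw [hRe] at hs
    nlinarith
  have hRe : R = 1 := max_eq_left hΔ1
  rw [hRe] at hs
  linarith

/-- The error of the projected estimator, in the norm of the design. -/
lemma designForm_projection_sub_le {I : Finset ι} {x : ι → E} {r : ι → ℝ} {kap lam0 m W S : ℝ}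
    {θs θ1 θh : E} (hkap : 0 < kap) (hlam0 : 0 < lam0) (hx : ∀ i ∈ I, ‖x i‖ ≤ 1)
    (hslope : ∀ i ∈ I, ∀ θ : E, ‖θ‖ ≤ S → 1 / kap ≤ deriv Real.sigmoid (inner ℝ (x i) θ))
    (hθs : ‖θs‖ ≤ S) (hθh : ‖θh‖ ≤ S)
    (hfoc : ∀ u, ∑ i ∈ I, (r i - Real.sigmoid (inner ℝ (x i) θ1)) * inner ℝ (x i) u
      = lam0 * inner ℝ θ1 u)
    (hproj : ∀ c : ℝ, 0 ≤ c → (∀ u, ∑ i ∈ I, (Real.sigmoid (inner ℝ (x i) θs)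
        - Real.sigmoid (inner ℝ (x i) θ1)) * inner ℝ (x i) u
        ≤ c * Real.sqrt (designForm (kap * lam0) I x u)) →
      ∀ u, ∑ i ∈ I, (Real.sigmoid (inner ℝ (x i) θh)
        - Real.sigmoid (inner ℝ (x i) θ1)) * inner ℝ (x i) u
        ≤ c * Real.sqrt (designForm (kap * lam0) I x u))
    (hW : ∀ u, ∑ i ∈ I, (r i - Real.sigmoid (inner ℝ (x i) θs)) * inner ℝ (x i) u
      - lam0 * inner ℝ θs u ≤ W * Real.sqrt (designForm (kap * lam0) I x u))
    (hW0 : 0 ≤ W) (hm : 0 < m) (hmq : ∀ u, m * ‖u‖ ^ 2 ≤ designForm (kap * lam0) I x u)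
    (hsmall : 2 * kap * W < Real.sqrt m) :
    Real.sqrt (designForm (kap * lam0) I x (θh - θs)) ≤
      6 * kap * W + 2 * S * Real.sqrt (kap * lam0) := by
  have hS : 0 ≤ S := (norm_nonneg _).trans hθs
  have hmle := designForm_mle_sub_le hkap hlam0 hx (fun i hi => hslope i hi θs hθs) hfoc hW hW0 hm
    hmq hsmall
  have hkl : 0 < kap * lam0 := by positivity
  have hsq : ∀ u, Real.sqrt (kap * lam0) * ‖u‖ ≤ Real.sqrt (designForm (kap * lam0) I x u) :=
    fun u => sqrt_mul_le_sqrt hkl.le (norm_nonneg _) (mul_norm_sq_le_designForm _ _ _ _)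
  have hstar : ∀ u, ∑ i ∈ I, (Real.sigmoid (inner ℝ (x i) θs)
        - Real.sigmoid (inner ℝ (x i) θ1)) * inner ℝ (x i) u
        ≤ 3 * W * Real.sqrt (designForm (kap * lam0) I x u) := by
    intro u
    have h1 := hW (-u)
    have h2 := hfoc u
    rw [designForm_neg] at h1
    have h3 : lam0 * inner ℝ (θ1 - θs) u ≤
        2 * W * Real.sqrt (designForm (kap * lam0) I x u) := by
      have h4 : inner ℝ (θ1 - θs) u ≤ ‖θ1 - θs‖ * ‖u‖ := real_inner_le_norm _ _
      have h5 := mul_le_mul (hsq (θ1 - θs)) (hsq u) (by positivity) (Real.sqrt_nonneg _)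
      have h6 : kap * lam0 * (‖θ1 - θs‖ * ‖u‖) ≤
          2 * kap * W * Real.sqrt (designForm (kap * lam0) I x u) := by
        calc kap * lam0 * (‖θ1 - θs‖ * ‖u‖) = Real.sqrt (kap * lam0) * Real.sqrt (kap * lam0) *
              (‖θ1 - θs‖ * ‖u‖) := by rw [Real.mul_self_sqrt hkl.le]
          _ = Real.sqrt (kap * lam0) * ‖θ1 - θs‖ * (Real.sqrt (kap * lam0) * ‖u‖) := by ring
          _ ≤ _ := h5
          _ ≤ _ := by gcongr
      have h7 : lam0 * (‖θ1 - θs‖ * ‖u‖) ≤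
          2 * W * Real.sqrt (designForm (kap * lam0) I x u) := by
        apply le_of_mul_le_mul_left _ hkap
        linarith
      exact (mul_le_mul_of_nonneg_left h4 hlam0.le).trans h7
    simp only [inner_neg_right, mul_neg, Finset.sum_neg_distrib] at h1
    rw [inner_sub_left] at h3
    simp only [sub_mul, Finset.sum_sub_distrib] at h1 h2 ⊢
    linarith
  have hhat := hproj (3 * W) (by positivity) hstar
  set Δ := θh - θs with hΔ
  set q := designForm (kap * lam0) I x Δ with hq
  have hq0 : 0 ≤ q := designForm_nonneg (by positivity) _ _ _
  have hup : ∑ i ∈ I, (Real.sigmoid (inner ℝ (x i) θh) - Real.sigmoid (inner ℝ (x i) θs)) *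
      inner ℝ (x i) Δ ≤ 6 * W * Real.sqrt q := by
    have h1 := hhat Δ
    have h2 := hstar (-Δ)
    rw [designForm_neg] at h2
    simp only [inner_neg_right, mul_neg, Finset.sum_neg_distrib] at h2
    simp only [sub_mul, Finset.sum_sub_distrib] at h1 h2 ⊢
    linarith
  have hlow : 1 / kap * (q - kap * lam0 * ‖Δ‖ ^ 2) ≤
      ∑ i ∈ I, (Real.sigmoid (inner ℝ (x i) θh) - Real.sigmoid (inner ℝ (x i) θs)) *
      inner ℝ (x i) Δ := by
    rw [hq, designForm, add_sub_cancel_left, Finset.mul_sum]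
    apply Finset.sum_le_sum
    intro i hi
    have hin : inner ℝ (x i) Δ = inner ℝ (x i) θh - inner ℝ (x i) θs := by
      rw [hΔ, inner_sub_right]
    rw [hin]
    apply sigmoid_sub_mul_sub_ge_of_deriv_ge
    intro s hs
    have : inner ℝ (x i) θs + s * (inner ℝ (x i) θh - inner ℝ (x i) θs) =
        inner ℝ (x i) ((1 - s) • θs + s • θh) := by
      rw [inner_add_right, inner_smul_right, inner_smul_right]; ring
    rw [this]
    apply hslope i hi
    calc ‖(1 - s) • θs + s • θh‖ ≤ ‖(1 - s) • θs‖ + ‖s • θh‖ := norm_add_le _ _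
      _ = (1 - s) * ‖θs‖ + s * ‖θh‖ := by
        rw [norm_smul, norm_smul, Real.norm_of_nonneg (by linarith [hs.2]),
          Real.norm_of_nonneg hs.1]
      _ ≤ (1 - s) * S + s * S := add_le_add
        (mul_le_mul_of_nonneg_left hθs (by linarith [hs.2])) (mul_le_mul_of_nonneg_left hθh hs.1)
      _ = S := by ring
  have hΔS : ‖Δ‖ ≤ 2 * S := (norm_sub_le _ _).trans (by linarith)
  have h1 : q - kap * lam0 * ‖Δ‖ ^ 2 ≤ 6 * kap * W * Real.sqrt q := by
    have := hlow.trans hup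
    rw [one_div, inv_mul_le_iff₀ hkap] at this
    linarith
  have h2 : kap * lam0 * ‖Δ‖ ^ 2 ≤ 2 * S * Real.sqrt (kap * lam0) * Real.sqrt q := by
    calc kap * lam0 * ‖Δ‖ ^ 2 = Real.sqrt (kap * lam0) * Real.sqrt (kap * lam0) * ‖Δ‖ ^ 2 := by
          rw [Real.mul_self_sqrt hkl.le]
      _ = (‖Δ‖ * Real.sqrt (kap * lam0)) * (Real.sqrt (kap * lam0) * ‖Δ‖) := by ring
      _ ≤ (2 * S * Real.sqrt (kap * lam0)) * Real.sqrt q := by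
        apply mul_le_mul _ (hsq Δ) (by positivity) (by positivity)
        exact mul_le_mul_of_nonneg_right hΔS (Real.sqrt_nonneg _)
  apply le_of_sq_le_mul_self (Real.sqrt_nonneg _) (by positivity)
  rw [Real.sq_sqrt hq0]
  linarith

lemma hasDerivAt_logistic_loss (r z : ℝ) :
    HasDerivAt (fun z => r * Real.log (Real.sigmoid z) + (1 - r) * Real.log (1 - Real.sigmoid z))
      (r - Real.sigmoid z) z := by
  have hd : HasDerivAt Real.sigmoid (Real.sigmoid z * (1 - Real.sigmoid z)) z := by
    rw [← deriv_sigmoid_apply]; exact (differentiable_sigmoid z).hasDerivAt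
  have h0 := Real.sigmoid_pos z
  have h1 := Real.sigmoid_lt_one z
  have ha := (hd.log h0.ne').const_mul r
  have hb := ((hd.const_sub 1).log (by linarith)).const_mul (1 - r)
  refine (ha.add hb).congr_deriv ?_
  have : 1 - Real.sigmoid z ≠ 0 := by linarith
  field_simp
  ring

/-- The likelihood equation: the gradient of the regularized log-likelihood vanishes at a
maximizer. -/
lemma likelihood_equation {I : Finset ι} {x : ι → E} {r : ι → ℝ} {lam0 : ℝ} {θ1 : E}
    (hmax : ∀ θ, ∑ i ∈ I, (r i * Real.log (Real.sigmoid (inner ℝ (x i) θ)) +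
        (1 - r i) * Real.log (1 - Real.sigmoid (inner ℝ (x i) θ))) - lam0 / 2 * ‖θ‖ ^ 2 ≤
      ∑ i ∈ I, (r i * Real.log (Real.sigmoid (inner ℝ (x i) θ1)) +
        (1 - r i) * Real.log (1 - Real.sigmoid (inner ℝ (x i) θ1))) - lam0 / 2 * ‖θ1‖ ^ 2)
    (u : E) :
    ∑ i ∈ I, (r i - Real.sigmoid (inner ℝ (x i) θ1)) * inner ℝ (x i) u = lam0 * inner ℝ θ1 u := by
  have hsum : HasDerivAt (fun s : ℝ => ∑ i ∈ I,
      (r i * Real.log (Real.sigmoid (inner ℝ (x i) θ1 + s * inner ℝ (x i) u)) +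
        (1 - r i) * Real.log (1 - Real.sigmoid (inner ℝ (x i) θ1 + s * inner ℝ (x i) u))))
      (∑ i ∈ I, (r i - Real.sigmoid (inner ℝ (x i) θ1)) * inner ℝ (x i) u) 0 := by
    apply HasDerivAt.fun_sum
    intro i _
    have hl : HasDerivAt (fun s : ℝ => inner ℝ (x i) θ1 + s * inner ℝ (x i) u)
        (inner ℝ (x i) u) 0 := by
      simpa using ((hasDerivAt_id (0 : ℝ)).mul_const (inner ℝ (x i) u)).const_add (inner ℝ (x i) θ1)
    have := hasDerivAt_logistic_loss (r i) (inner ℝ (x i) θ1 + 0 * inner ℝ (x i) u)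
    have h3 := HasDerivAt.comp (0 : ℝ) this hl
    simp only [zero_mul, add_zero] at h3
    exact h3
  have hreg : HasDerivAt (fun s : ℝ => lam0 / 2 * (‖θ1‖ ^ 2 + 2 * (s * inner ℝ θ1 u) +
      s ^ 2 * ‖u‖ ^ 2)) (lam0 * inner ℝ θ1 u) 0 := by
    have h1 : HasDerivAt (fun s : ℝ => s * inner ℝ θ1 u) (inner ℝ θ1 u) 0 := by
      simpa using (hasDerivAt_id (0 : ℝ)).mul_const (inner ℝ θ1 u)
    have h2 : HasDerivAt (fun s : ℝ => s ^ 2 * ‖u‖ ^ 2) 0 0 := by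
      simpa using (hasDerivAt_pow 2 (0 : ℝ)).mul_const (‖u‖ ^ 2)
    have h3 := (((h1.const_mul 2).const_add (‖θ1‖ ^ 2)).add h2).const_mul (lam0 / 2)
    exact h3.congr_deriv (by ring)
  have hloc : IsLocalMax (fun s : ℝ => ∑ i ∈ I,
      (r i * Real.log (Real.sigmoid (inner ℝ (x i) θ1 + s * inner ℝ (x i) u)) +
        (1 - r i) * Real.log (1 - Real.sigmoid (inner ℝ (x i) θ1 + s * inner ℝ (x i) u))) -
      lam0 / 2 * (‖θ1‖ ^ 2 + 2 * (s * inner ℝ θ1 u) + s ^ 2 * ‖u‖ ^ 2)) 0 := by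
    refine Filter.Eventually.of_forall fun s => ?_
    have h := hmax (θ1 + s • u)
    simp only [inner_add_right, inner_smul_right, norm_add_sq_real, norm_smul, mul_pow,
      Real.norm_eq_abs, sq_abs] at h
    simpa using h
  have := hloc.hasDerivAt_eq_zero (hsum.sub hreg)
  linarith

end Estimator

/-! ### Quadratic forms of matrices and rank-one updates -/

section Matrices

variable {n : Type*} [Fintype n]

lemma dotProduct_mulVec_comm {A : Matrix n n ℝ} (hA : A.IsHermitian) (x y : n → ℝ) :
    x ⬝ᵥ (A *ᵥ y) = y ⬝ᵥ (A *ᵥ x) := by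
  have hT : Aᵀ = A := by simpa using hA.eq
  rw [Matrix.dotProduct_mulVec, ← Matrix.mulVec_transpose, hT, dotProduct_comm]

lemma quadForm_nonneg {A : Matrix n n ℝ} (hA : A.PosSemidef) (x : n → ℝ) :
    0 ≤ x ⬝ᵥ (A *ᵥ x) := by
  simpa using hA.dotProduct_mulVec_nonneg x

lemma sq_dotProduct_mulVec_le {A : Matrix n n ℝ} (hA : A.PosSemidef) (x y : n → ℝ) :
    (x ⬝ᵥ (A *ᵥ y)) ^ 2 ≤ (x ⬝ᵥ (A *ᵥ x)) * (y ⬝ᵥ (A *ᵥ y)) := by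
  have h : ∀ t : ℝ, 0 ≤ (y ⬝ᵥ (A *ᵥ y)) * (t * t) + (2 * (x ⬝ᵥ (A *ᵥ y))) * t
      + x ⬝ᵥ (A *ᵥ x) := by
    intro t
    have := quadForm_nonneg hA (x + t • y)
    simp only [Matrix.mulVec_add, Matrix.mulVec_smul, dotProduct_add, add_dotProduct,
      smul_dotProduct, dotProduct_smul, smul_eq_mul] at this
    rw [dotProduct_mulVec_comm hA.isHermitian y x] at this
    linarith
  have := discrim_le_zero h
  rw [discrim] at this
  nlinarith

lemma vecMulVec_self_posSemidef (x : n → ℝ) : (Matrix.vecMulVec x x).PosSemidef := by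
  simpa using Matrix.posSemidef_vecMulVec_self_star x

lemma vecMulVec_self_mulVec (x y : n → ℝ) : Matrix.vecMulVec x x *ᵥ y = (x ⬝ᵥ y) • x := by
  ext i
  simp only [Matrix.mulVec, Matrix.vecMulVec, dotProduct, Matrix.of_apply, Pi.smul_apply,
    smul_eq_mul, Finset.sum_mul]
  exact Finset.sum_congr rfl fun j _ => by ring

variable [DecidableEq n]

lemma dotProduct_le_of_posDef {V : Matrix n n ℝ} (hV : V.PosDef) (g u : n → ℝ) :
    g ⬝ᵥ u ≤ Real.sqrt (g ⬝ᵥ (V⁻¹ *ᵥ g)) * Real.sqrt (u ⬝ᵥ (V *ᵥ u)) := by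
  have hdet : IsUnit V.det := (Matrix.isUnit_iff_isUnit_det V).1 hV.isUnit
  have e : V⁻¹ *ᵥ (V *ᵥ u) = u := by
    rw [Matrix.mulVec_mulVec, Matrix.nonsing_inv_mul V hdet, Matrix.one_mulVec]
  have h := sq_dotProduct_mulVec_le hV.inv.posSemidef g (V *ᵥ u)
  rw [e, dotProduct_comm (V *ᵥ u) u] at h
  rw [← Real.sqrt_mul (quadForm_nonneg hV.inv.posSemidef g)]
  exact Real.le_sqrt_of_sq_le h

lemma sqrt_quadForm_inv_le {V : Matrix n n ℝ} (hV : V.PosDef) {g : n → ℝ} {c : ℝ} (hc : 0 ≤ c)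
    (h : ∀ u : n → ℝ, g ⬝ᵥ u ≤ c * Real.sqrt (u ⬝ᵥ (V *ᵥ u))) :
    Real.sqrt (g ⬝ᵥ (V⁻¹ *ᵥ g)) ≤ c := by
  have hdet : IsUnit V.det := (Matrix.isUnit_iff_isUnit_det V).1 hV.isUnit
  have e : V *ᵥ (V⁻¹ *ᵥ g) = g := by
    rw [Matrix.mulVec_mulVec, Matrix.mul_nonsing_inv V hdet, Matrix.one_mulVec]
  have h1 := h (V⁻¹ *ᵥ g)
  rw [e, dotProduct_comm (V⁻¹ *ᵥ g) g] at h1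
  apply le_of_sq_le_mul_self (Real.sqrt_nonneg _) hc
  rwa [Real.sq_sqrt (quadForm_nonneg hV.inv.posSemidef g)]

/-- The Sherman–Morrison formula, for the quadratic form of the inverse of a rank-one update at
an updated vector. -/
lemma quadForm_inv_add_vecMulVec {V : Matrix n n ℝ} (hV : V.PosDef) (x s : n → ℝ) (η : ℝ) :
    (s + η • x) ⬝ᵥ ((V + Matrix.vecMulVec x x)⁻¹ *ᵥ (s + η • x)) =
      s ⬝ᵥ (V⁻¹ *ᵥ s) + (2 * η * (x ⬝ᵥ (V⁻¹ *ᵥ s)) + η ^ 2 * (x ⬝ᵥ (V⁻¹ *ᵥ x))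
        - (x ⬝ᵥ (V⁻¹ *ᵥ s)) ^ 2) / (1 + x ⬝ᵥ (V⁻¹ *ᵥ x)) := by
  have hdet : IsUnit V.det := (Matrix.isUnit_iff_isUnit_det V).1 hV.isUnit
  have hV' : (V + Matrix.vecMulVec x x).PosDef := hV.add_posSemidef (vecMulVec_self_posSemidef x)
  have hdet' : IsUnit (V + Matrix.vecMulVec x x).det :=
    (Matrix.isUnit_iff_isUnit_det _).1 hV'.isUnit
  have hw : 0 ≤ x ⬝ᵥ (V⁻¹ *ᵥ x) := quadForm_nonneg hV.inv.posSemidef x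
  set w := x ⬝ᵥ (V⁻¹ *ᵥ x) with hwdef
  set z := s + η • x with hz
  set c := (x ⬝ᵥ (V⁻¹ *ᵥ z)) / (1 + w) with hc
  have hcw : x ⬝ᵥ (V⁻¹ *ᵥ z) = c * (1 + w) := by rw [hc]; field_simp
  have hcan : ∀ y, V *ᵥ (V⁻¹ *ᵥ y) = y := fun y => by
    rw [Matrix.mulVec_mulVec, Matrix.mul_nonsing_inv V hdet, Matrix.one_mulVec]
  have hy : (V + Matrix.vecMulVec x x) *ᵥ (V⁻¹ *ᵥ z - c • (V⁻¹ *ᵥ x)) = z := by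
    rw [Matrix.add_mulVec, Matrix.mulVec_sub, Matrix.mulVec_smul, hcan, hcan,
      vecMulVec_self_mulVec, dotProduct_sub, dotProduct_smul, hcw, ← hwdef, smul_eq_mul]
    rw [show c * (1 + w) - c * w = c by ring]
    abel
  have hinv : (V + Matrix.vecMulVec x x)⁻¹ *ᵥ z = V⁻¹ *ᵥ z - c • (V⁻¹ *ᵥ x) := by
    conv_lhs => rw [← hy]
    rw [Matrix.mulVec_mulVec, Matrix.nonsing_inv_mul _ hdet', Matrix.one_mulVec]
  rw [hinv, dotProduct_sub, dotProduct_smul,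
    dotProduct_mulVec_comm hV.inv.isHermitian z x, smul_eq_mul]
  have e1 : x ⬝ᵥ (V⁻¹ *ᵥ z) = x ⬝ᵥ (V⁻¹ *ᵥ s) + η * w := by
    rw [hz, Matrix.mulVec_add, Matrix.mulVec_smul, dotProduct_add, dotProduct_smul, smul_eq_mul]
  have e2 : z ⬝ᵥ (V⁻¹ *ᵥ z) = s ⬝ᵥ (V⁻¹ *ᵥ s) + 2 * η * (x ⬝ᵥ (V⁻¹ *ᵥ s)) + η ^ 2 * w := by
    rw [hz]
    simp only [Matrix.mulVec_add, Matrix.mulVec_smul, dotProduct_add, add_dotProduct,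
      smul_dotProduct, dotProduct_smul, smul_eq_mul]
    rw [dotProduct_mulVec_comm hV.inv.isHermitian s x, ← hwdef]
    ring
  rw [hc, e2, e1]
  field_simp
  ring

lemma det_add_vecMulVec {V : Matrix n n ℝ} (hV : V.PosDef) (x : n → ℝ) :
    (V + Matrix.vecMulVec x x).det = V.det * (1 + x ⬝ᵥ (V⁻¹ *ᵥ x)) := by
  have hdet : IsUnit V.det := (Matrix.isUnit_iff_isUnit_det V).1 hV.isUnit
  have := Matrix.det_add_replicateCol_mul_replicateRow (ι := Unit) hdet x x
  rw [← Matrix.vecMulVec_eq] at this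
  rw [this, Matrix.det_unique (1 + _), Matrix.add_apply, Matrix.one_apply_eq, Matrix.mul_assoc,
    ← Matrix.replicateCol_mulVec, Matrix.replicateRow_mul_replicateCol_apply]

lemma det_le_trace_div_card_pow [Nonempty n] {A : Matrix n n ℝ} (hA : A.PosSemidef) :
    A.det ≤ (A.trace / Fintype.card n) ^ Fintype.card n := by
  have hn : (0 : ℝ) < Fintype.card n := by exact_mod_cast Fintype.card_pos
  rw [hA.isHermitian.det_eq_prod_eigenvalues, hA.isHermitian.trace_eq_sum_eigenvalues]
  have h0 := hA.eigenvalues_nonneg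
  have h := Real.geom_mean_le_arith_mean_weighted Finset.univ
    (fun _ : n => (1 : ℝ) / Fintype.card n) hA.isHermitian.eigenvalues
    (fun _ _ => by positivity) (by simp) (fun i _ => h0 i)
  have h2 := pow_le_pow_left₀ (Finset.prod_nonneg fun i _ => Real.rpow_nonneg (h0 i) _) h
    (Fintype.card n)
  rw [← Finset.prod_pow] at h2
  refine le_trans (le_of_eq ?_) (h2.trans (le_of_eq ?_))
  · simp only [RCLike.ofReal_real_eq_id, id]
    refine Finset.prod_congr rfl fun i _ => ?_
    rw [← Real.rpow_natCast, ← Real.rpow_mul (h0 i), one_div_mul_cancel hn.ne', Real.rpow_one]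
  · simp only [RCLike.ofReal_real_eq_id, id]
    rw [← Finset.mul_sum]
    congr 1
    ring

lemma mul_dotProduct_self_le_of_le_eigenvalues {A : Matrix n n ℝ} (hA : A.IsHermitian) {c : ℝ}
    (hc : ∀ i, c ≤ hA.eigenvalues i) (x : n → ℝ) : c * (x ⬝ᵥ x) ≤ x ⬝ᵥ (A *ᵥ x) := by
  let b := hA.eigenvectorBasis
  let X : EuclideanSpace ℝ n := WithLp.toLp 2 x
  let Y : EuclideanSpace ℝ n := WithLp.toLp 2 (A *ᵥ x)
  have hXX : x ⬝ᵥ x = ∑ i, inner ℝ X (b i) * inner ℝ (b i) X := by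
    rw [b.sum_inner_mul_inner, EuclideanSpace.inner_eq_star_dotProduct]
    simp [X]
  have hXY : x ⬝ᵥ (A *ᵥ x) = ∑ i, inner ℝ X (b i) * inner ℝ (b i) Y := by
    rw [b.sum_inner_mul_inner, EuclideanSpace.inner_eq_star_dotProduct, dotProduct_comm]
    simp [X, Y]
  have hb : ∀ i, inner ℝ (b i) Y = hA.eigenvalues i * inner ℝ (b i) X := by
    intro i
    rw [EuclideanSpace.inner_eq_star_dotProduct, EuclideanSpace.inner_eq_star_dotProduct]
    simp only [X, Y, star_trivial]
    rw [dotProduct_comm, dotProduct_mulVec_comm hA, hA.mulVec_eigenvectorBasis i]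
    simp [dotProduct_smul, b]
  rw [hXX, hXY, Finset.mul_sum]
  apply Finset.sum_le_sum
  intro i _
  rw [hb i, real_inner_comm]
  nlinarith [hc i, sq_nonneg (inner ℝ (b i) X)]

end Matrices

/-! ### The law of one round and conditioning on the past -/

/-- The space of the exogenous variables of one round. -/
abbrev RoundSpace (d K : ℕ) := Bool × Vec d × Bool × Fin K × ℝ

instance : IsProbabilityMeasure (volume.restrict (Set.Icc (0 : ℝ) 1)) := ⟨by simp⟩

lemma isProbabilityMeasure_uniformOn_univ_fin {K : ℕ} (hK : 0 < K) :
    IsProbabilityMeasure (uniformOn (Set.univ : Set (Fin K))) :=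
  isProbabilityMeasure_uniformOn Set.finite_univ ⟨⟨0, hK⟩, trivial⟩

lemma lintegral_unif_le {p : ℝ} (h0 : 0 ≤ p) (h1 : p ≤ 1) (a b : ENNReal) :
    ∫⁻ u, (if u ≤ p then a else b) ∂(volume.restrict (Set.Icc (0 : ℝ) 1)) =
      ENNReal.ofReal p * a + ENNReal.ofReal (1 - p) * b := by
  have hm : MeasurableSet {u : ℝ | u ≤ p} := measurableSet_Iic
  have e : (fun u : ℝ => if u ≤ p then a else b) = fun u =>
      ({u : ℝ | u ≤ p}).indicator (fun _ => a) u + ({u : ℝ | u ≤ p}ᶜ).indicator (fun _ => b) u := by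
    ext u
    by_cases h : u ≤ p <;> simp [Set.indicator, h]
  rw [e, lintegral_add_left (measurable_const.indicator hm), lintegral_indicator_const hm,
    lintegral_indicator_const hm.compl, Measure.restrict_apply hm,
    Measure.restrict_apply hm.compl]
  have e1 : {u : ℝ | u ≤ p} ∩ Set.Icc 0 1 = Set.Icc 0 p := by
    ext u; simp only [Set.mem_inter_iff, Set.mem_ofPred_eq, Set.mem_Icc]
    constructor
    · rintro ⟨h, h', _⟩; exact ⟨h', h⟩
    · rintro ⟨h, h'⟩; exact ⟨h', h, h'.trans h1⟩
  have e2 : {u : ℝ | u ≤ p}ᶜ ∩ Set.Icc 0 1 = Set.Ioc p 1 := by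
    ext u
    simp only [Set.mem_inter_iff, Set.mem_compl_iff, Set.mem_ofPred_eq, not_le, Set.mem_Icc,
      Set.mem_Ioc]
    constructor
    · rintro ⟨h, _, h'⟩; exact ⟨h, h'⟩
    · rintro ⟨h, h'⟩; exact ⟨h, h0.trans h.le, h'⟩
  rw [e1, e2, Real.volume_Icc, Real.volume_Ioc, sub_zero]
  ring

section Round

variable {d K : ℕ} {ν : Measure (Vec d)} {lam p : ℝ}

lemma isProbabilityMeasure_roundLaw [IsProbabilityMeasure ν] (hK : 0 < K) (hl0 : 0 ≤ lam)
    (hl1 : lam ≤ 1) (hp0 : 0 ≤ p) (hp1 : p ≤ 1) :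
    IsProbabilityMeasure (roundLaw K ν lam p) := by
  have := isProbabilityMeasure_bern hl0 hl1
  have := isProbabilityMeasure_bern hp0 hp1
  have := isProbabilityMeasure_uniformOn_univ_fin hK
  unfold roundLaw
  infer_instance

lemma lintegral_roundLaw [IsProbabilityMeasure ν] (hK : 0 < K) (hl0 : 0 ≤ lam)
    (hl1 : lam ≤ 1) (hp0 : 0 ≤ p) (hp1 : p ≤ 1) {f : RoundSpace d K → ENNReal}
    (hf : Measurable f) :
    ∫⁻ z, f z ∂(roundLaw K ν lam p) = ∫⁻ a, ∫⁻ x, ∫⁻ c, ∫⁻ k, ∫⁻ u, f (a, x, c, k, u)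
      ∂(volume.restrict (Set.Icc (0 : ℝ) 1)) ∂(uniformOn (Set.univ : Set (Fin K))) ∂(bern p)
      ∂ν ∂(bern lam) := by
  have := isProbabilityMeasure_bern hl0 hl1
  have := isProbabilityMeasure_bern hp0 hp1
  have := isProbabilityMeasure_uniformOn_univ_fin hK
  unfold roundLaw
  rw [lintegral_prod _ hf.aemeasurable]
  refine lintegral_congr fun a => ?_
  rw [lintegral_prod _ (by fun_prop)]
  refine lintegral_congr fun x => ?_
  rw [lintegral_prod _ (by fun_prop)]
  refine lintegral_congr fun c => ?_
  rw [lintegral_prod _ (by fun_prop)]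

variable {Ω : Type*} [m : MeasurableSpace Ω] {P : Measure Ω}
  {ℱ : Filtration ℕ m} {N : Noise Ω d K}

lemma IsNoise.measurable_round (hN : IsNoise P ℱ ν lam p N) (t : ℕ) :
    Measurable (N.round (t + 1)) := (hN.adapted t).mono (ℱ.le _) le_rfl

variable [IsProbabilityMeasure P]

/-- The exogenous variables of round `t + 1` may be integrated out first, everything known at the
end of round `t` being fixed. -/
lemma IsNoise.lintegral_round (hN : IsNoise P ℱ ν lam p N) (t : ℕ) {E : Type*}
    [MeasurableSpace E] {X : Ω → E} (hX : Measurable[ℱ t] X) {g : E × RoundSpace d K → ENNReal}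
    (hg : Measurable g) :
    ∫⁻ ω, g (X ω, N.round (t + 1) ω) ∂P =
      ∫⁻ ω, ∫⁻ z, g (X ω, z) ∂(roundLaw K ν lam p) ∂P := by
  have hX' : Measurable X := hX.mono (ℱ.le _) le_rfl
  have hR := hN.measurable_round t
  have hind : IndepFun X (N.round (t + 1)) P := by
    rw [IndepFun_iff_Indep]
    exact indep_of_indep_of_le_left (hN.indep t) hX.comap_le
  have hlaw := hN.law t
  have : IsProbabilityMeasure (roundLaw K ν lam p) := by
    rw [← hlaw]; exact Measure.isProbabilityMeasure_map hR.aemeasurable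
  have hmap := (indepFun_iff_map_prod_eq_prod_map_map hX'.aemeasurable hR.aemeasurable).1 hind
  rw [hlaw] at hmap
  have e : ∫⁻ ω, g (X ω, N.round (t + 1) ω) ∂P =
      ∫⁻ y, g y ∂(P.map fun ω => (X ω, N.round (t + 1) ω)) :=
    (lintegral_map hg (hX'.prodMk hR)).symm
  rw [e, hmap, lintegral_prod _ hg.aemeasurable, lintegral_map _ hX']
  exact hg.lintegral_prod_right'

lemma IsNoise.setLIntegral_round_le (hN : IsNoise P ℱ ν lam p N) (t : ℕ) {E : Type*}
    [MeasurableSpace E] {X : Ω → E} (hX : Measurable[ℱ t] X) {g : E × RoundSpace d K → ENNReal}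
    (hg : Measurable g) {A : Set Ω} (hA : MeasurableSet[ℱ t] A) {h : Ω → ENNReal}
    (hh : ∀ ω ∈ A, ∫⁻ z, g (X ω, z) ∂(roundLaw K ν lam p) ≤ h ω) :
    ∫⁻ ω in A, g (X ω, N.round (t + 1) ω) ∂P ≤ ∫⁻ ω in A, h ω ∂P := by
  have hA' : MeasurableSet A := ℱ.le _ _ hA
  let χ : Ω → ENNReal := A.indicator fun _ => 1
  have hχ : Measurable[ℱ t] χ := measurable_const.indicator hA
  have h1 := hN.lintegral_round t (X := fun ω => (χ ω, X ω)) (hχ.prodMk hX)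
    (g := fun y => y.1.1 * g (y.1.2, y.2)) (by fun_prop)
  have e1 : ∀ F : Ω → ENNReal, ∫⁻ ω in A, F ω ∂P = ∫⁻ ω, χ ω * F ω ∂P := by
    intro F
    rw [← lintegral_indicator hA']
    refine lintegral_congr fun ω => ?_
    by_cases h : ω ∈ A <;> simp [χ, h]
  rw [e1, e1]
  simp only at h1
  rw [h1]
  refine lintegral_mono fun ω => ?_
  by_cases h : ω ∈ A
  · simpa [χ, h] using hh ω h
  · simp [χ, h]

/-- Lower tail of the number of rounds whose exogenous variables lie in a set of probability `q`. -/
lemma IsNoise.measure_count_le (hN : IsNoise P ℱ ν lam p N) {B : Set (RoundSpace d K)}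
    (hB : MeasurableSet B) {q : ℝ} (hq0 : 0 ≤ q)
    (hq : ENNReal.ofReal q ≤ roundLaw K ν lam p B) (a n : ℕ) :
    P {ω | ∑ j ∈ Finset.range n, B.indicator (fun _ => (1 : ℝ)) (N.round (a + j + 1) ω)
      ≤ q * n / 2} ≤ ENNReal.ofReal (Real.exp (-(q * n / 8))) := by
  have : IsProbabilityMeasure (roundLaw K ν lam p) := by
    rw [← hN.law 0]; exact Measure.isProbabilityMeasure_map (hN.measurable_round 0).aemeasurable
  have hq1 : q ≤ 1 := by
    have := hq.trans prob_le_one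
    simpa using this
  let S : ℕ → Ω → ℝ := fun n ω =>
    ∑ j ∈ Finset.range n, B.indicator (fun _ => (1 : ℝ)) (N.round (a + j + 1) ω)
  have hS : ∀ n, Measurable[ℱ (a + n)] (S n) := by
    intro n
    refine Finset.measurable_sum _ fun j hj => ?_
    exact (measurable_const.indicator hB).comp
      ((hN.adapted (a + j)).mono (ℱ.mono (by have := Finset.mem_range.1 hj; omega)) le_rfl)
  have hone : ∫⁻ z, ENNReal.ofReal (Real.exp (-(B.indicator (fun _ => (1 : ℝ)) z)))
      ∂(roundLaw K ν lam p) ≤ ENNReal.ofReal (Real.exp (-(5 / 8 * q))) := by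
    have e : (fun z => ENNReal.ofReal (Real.exp (-(B.indicator (fun _ => (1 : ℝ)) z)))) = fun z =>
        B.indicator (fun _ => ENNReal.ofReal (Real.exp (-1))) z + Bᶜ.indicator (fun _ => 1) z := by
      ext z
      by_cases h : z ∈ B <;> simp [h]
    rw [e, lintegral_add_left (measurable_const.indicator hB), lintegral_indicator_const hB,
      lintegral_indicator_const hB.compl]
    set r := (roundLaw K ν lam p).real B with hr
    have hrB : roundLaw K ν lam p B = ENNReal.ofReal r := by
      rw [hr, ofReal_measureReal]
    have hqr : q ≤ r := by
      rw [hrB] at hq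
      exact (ENNReal.ofReal_le_ofReal_iff measureReal_nonneg).1 hq
    have hr1 : r ≤ 1 := measureReal_le_one
    rw [prob_compl_eq_one_sub hB, hrB, one_mul, ← ENNReal.ofReal_one, ← ENNReal.ofReal_sub _
      measureReal_nonneg, ← ENNReal.ofReal_mul (Real.exp_pos _).le, ← ENNReal.ofReal_add
      (by positivity) (by linarith)]
    apply ENNReal.ofReal_le_ofReal
    have h1 : Real.exp (-1) ≤ 3 / 8 := by
      have := Real.exp_one_gt_d9
      rw [Real.exp_neg, ← one_div, div_le_div_iff₀ (Real.exp_pos _) (by norm_num)]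
      linarith
    have h2 := Real.add_one_le_exp (-(5 / 8 * q))
    nlinarith [measureReal_nonneg (μ := roundLaw K ν lam p) (s := B)]
  have hmgf : ∀ n : ℕ, ∫⁻ ω, ENNReal.ofReal (Real.exp (-(S n ω))) ∂P ≤
      ENNReal.ofReal (Real.exp (-(5 / 8 * q * n))) := by
    intro n
    induction n with
    | zero => simp [S]
    | succ n ih =>
      have h1 := hN.lintegral_round (a + n) (hS n)
        (g := fun y => ENNReal.ofReal (Real.exp (-y.1)) *
          ENNReal.ofReal (Real.exp (-(B.indicator (fun _ => (1 : ℝ)) y.2)))) (by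
            have : Measurable (B.indicator fun _ => (1 : ℝ)) := measurable_const.indicator hB
            fun_prop)
      have e : ∀ ω, ENNReal.ofReal (Real.exp (-(S (n + 1) ω))) =
          ENNReal.ofReal (Real.exp (-(S n ω))) * ENNReal.ofReal
            (Real.exp (-(B.indicator (fun _ => (1 : ℝ)) (N.round (a + n + 1) ω)))) := by
        intro ω
        rw [← ENNReal.ofReal_mul (Real.exp_pos _).le, ← Real.exp_add]
        simp only [S, Finset.sum_range_succ]
        congr 2
        ring
      rw [lintegral_congr e]
      simp only at h1
      rw [h1]
      calc _ ≤ ∫⁻ ω, ENNReal.ofReal (Real.exp (-(S n ω))) *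
            ENNReal.ofReal (Real.exp (-(5 / 8 * q))) ∂P := by
            refine lintegral_mono fun ω => ?_
            rw [lintegral_const_mul' _ _ ENNReal.ofReal_ne_top]
            gcongr
        _ = (∫⁻ ω, ENNReal.ofReal (Real.exp (-(S n ω))) ∂P) *
            ENNReal.ofReal (Real.exp (-(5 / 8 * q))) :=
          lintegral_mul_const' _ _ ENNReal.ofReal_ne_top
        _ ≤ ENNReal.ofReal (Real.exp (-(5 / 8 * q * n))) *
            ENNReal.ofReal (Real.exp (-(5 / 8 * q))) := by gcongr
        _ = _ := by
          rw [← ENNReal.ofReal_mul (Real.exp_pos _).le, ← Real.exp_add]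
          congr 2; push_cast; ring
  have hmeas : Measurable fun ω => ENNReal.ofReal (Real.exp (-(S n ω))) := by
    have := (hS n).mono (ℱ.le _) le_rfl
    fun_prop
  have hmk := meas_ge_le_lintegral_div hmeas.aemeasurable (μ := P)
    (ε := ENNReal.ofReal (Real.exp (-(q * n / 2)))) (by simp [Real.exp_pos]) (by simp)
  refine (measure_mono ?_).trans (hmk.trans ((ENNReal.div_le_div_right (hmgf n) _).trans ?_))
  · intro ω hω
    simp only [Set.mem_ofPred_eq] at hω ⊢
    exact ENNReal.ofReal_le_ofReal (Real.exp_le_exp.2 (by simpa [S] using hω))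
  · rw [← ENNReal.ofReal_div_of_pos (Real.exp_pos _), ← Real.exp_sub]
    apply ENNReal.ofReal_le_ofReal
    apply Real.exp_le_exp.2
    linarith

end Round

/-- Ville's maximal inequality for nonnegative supermartingales. -/
lemma measure_exists_le_of_supermartingale {Ω : Type*} [m : MeasurableSpace Ω] {P : Measure Ω}
    {ℱ : Filtration ℕ m} {M : ℕ → Ω → ENNReal} (hM : ∀ t, Measurable[ℱ t] (M t))
    (hstep : ∀ t, ∀ A, MeasurableSet[ℱ t] A → ∫⁻ ω in A, M (t + 1) ω ∂P ≤ ∫⁻ ω in A, M t ω ∂P)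
    (a : ENNReal) (n : ℕ) :
    a * P {ω | ∃ s ≤ n, a ≤ M s ω} ≤ ∫⁻ ω, M 0 ω ∂P := by
  have hB : ∀ n, MeasurableSet[ℱ n] {ω | ∃ s ≤ n, a ≤ M s ω} := by
    intro n
    have : {ω | ∃ s ≤ n, a ≤ M s ω} = ⋃ s ∈ Set.Iic n, {ω | a ≤ M s ω} := by
      ext ω; simp
    rw [this]
    refine MeasurableSet.biUnion (Set.to_countable _) fun s hs => ?_
    exact ℱ.mono hs _ (measurableSet_le measurable_const (hM s))
  have key : ∀ n, a * P {ω | ∃ s ≤ n, a ≤ M s ω} + ∫⁻ ω in {ω | ∃ s ≤ n, a ≤ M s ω}ᶜ, M n ω ∂P ≤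
      ∫⁻ ω, M 0 ω ∂P := by
    intro n
    induction n with
    | zero =>
      have hB0 := ℱ.le _ _ (hB 0)
      rw [← lintegral_add_compl (μ := P) (M 0) hB0, ← setLIntegral_const]
      refine add_le_add ?_ le_rfl
      refine setLIntegral_mono' hB0 fun ω hω => ?_
      obtain ⟨s, hs, h⟩ : ∃ s ≤ 0, a ≤ M s ω := hω
      rwa [Nat.le_zero.1 hs] at h
    | succ n ih =>
      refine le_trans ?_ ih
      have hBn := ℱ.le _ _ (hB n)
      have hBn1 := ℱ.le _ _ (hB (n + 1))
      set B := {ω | ∃ s ≤ n, a ≤ M s ω} with hBdef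
      set B' := {ω | ∃ s ≤ n + 1, a ≤ M s ω} with hB'def
      have hsub : B ⊆ B' := fun ω ⟨s, hs, h⟩ => ⟨s, hs.trans (Nat.le_succ _), h⟩
      have hPB : P B' = P B + P (B' \ B) := by
        rw [← measure_sdiff_add_inter (s := B') (t := B) hBn, Set.inter_eq_self_of_subset_right hsub]
        ring
      have h1 := hstep n Bᶜ (MeasurableSet.compl (hB n))
      have hsplit : ∫⁻ ω in Bᶜ, M (n + 1) ω ∂P =
          ∫⁻ ω in B' \ B, M (n + 1) ω ∂P + ∫⁻ ω in B'ᶜ, M (n + 1) ω ∂P := by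
        rw [← lintegral_inter_add_sdiff _ Bᶜ hBn1]
        congr 3
        · ext ω; simp [and_comm]
        · ext ω
          simp only [Set.mem_sdiff, Set.mem_compl_iff]
          exact ⟨fun h => h.2, fun h => ⟨fun h' => h (hsub h'), h⟩⟩
      have h2 : a * P (B' \ B) ≤ ∫⁻ ω in B' \ B, M (n + 1) ω ∂P := by
        rw [← setLIntegral_const]
        refine setLIntegral_mono' (hBn1.diff hBn) fun ω hω => ?_
        obtain ⟨⟨s, hs, h⟩, h'⟩ := hω
        rcases Nat.lt_or_ge s (n + 1) with hlt | hge
        · exact absurd ⟨s, Nat.lt_succ_iff.1 hlt, h⟩ h'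
        · rwa [le_antisymm hs hge] at h
      calc a * P B' + ∫⁻ ω in B'ᶜ, M (n + 1) ω ∂P
          = a * P B + (a * P (B' \ B) + ∫⁻ ω in B'ᶜ, M (n + 1) ω ∂P) := by rw [hPB]; ring
        _ ≤ a * P B + (∫⁻ ω in B' \ B, M (n + 1) ω ∂P + ∫⁻ ω in B'ᶜ, M (n + 1) ω ∂P) := by gcongr
        _ = a * P B + ∫⁻ ω in Bᶜ, M (n + 1) ω ∂P := by rw [hsplit]
        _ ≤ _ := by gcongr
  exact le_trans (le_add_of_nonneg_right (zero_le)) (key n)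

/-! ### Comparison of queues served with common random numbers -/

section Comparison

variable {ι : Type*} (r : ℕ → ι → ℝ)

open Classical in
/-- The jobs of `A` whose departure rates are all below `v`. -/
noncomputable def slowJobs (A : Finset ℕ) (v : ℝ) : Finset ℕ := A.filter fun a => ∀ k, r a k < v

/-- `A` has at most `n` slow jobs more than `B`, at every threshold. For a threshold above all
departure rates this bounds the difference of the queue lengths; the other thresholds make the
relation stable under optimal service of `B`. -/
def Dominated (n : ℕ) (A B : Finset ℕ) : Prop :=
  ∀ v, (slowJobs r A v).card ≤ (slowJobs r B v).card + n

variable {r}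

lemma mem_slowJobs {A : Finset ℕ} {v : ℝ} {a : ℕ} :
    a ∈ slowJobs r A v ↔ a ∈ A ∧ ∀ k, r a k < v := by
  classical
  simp [slowJobs]

lemma slowJobs_mono {A A' : Finset ℕ} (h : A ⊆ A') (v : ℝ) : slowJobs r A v ⊆ slowJobs r A' v := by
  intro a ha
  rw [mem_slowJobs] at ha ⊢
  exact ⟨h ha.1, ha.2⟩

lemma slowJobs_subset (A : Finset ℕ) (v : ℝ) : slowJobs r A v ⊆ A :=
  fun _ ha => (mem_slowJobs.1 ha).1

lemma slowJobs_eq_self {A : Finset ℕ} {v : ℝ} (h : ∀ a ∈ A, ∀ k, r a k < v) :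
    slowJobs r A v = A :=
  Finset.Subset.antisymm (slowJobs_subset A v) fun a ha => mem_slowJobs.2 ⟨ha, h a ha⟩

lemma slowJobs_erase (A : Finset ℕ) (j : ℕ) (v : ℝ) :
    slowJobs r (A.erase j) v = (slowJobs r A v).erase j := by
  ext a
  simp only [mem_slowJobs, Finset.mem_erase]
  tauto

lemma Dominated.mono {n n' : ℕ} {A B : Finset ℕ} (h : Dominated r n A B) (hn : n ≤ n') :
    Dominated r n' A B := fun v => (h v).trans (by omega)

lemma Dominated.card_le [Finite ι] {n : ℕ} {A B : Finset ℕ} (h : Dominated r n A B) :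
    A.card ≤ B.card + n := by
  have hbdd : ∃ v, ∀ a ∈ A ∪ B, ∀ k, r a k < v := by
    have hfin : ((fun p : ℕ × ι => r p.1 p.2) '' ((A ∪ B : Finset ℕ) ×ˢ Set.univ)).Finite :=
      (((A ∪ B).finite_toSet).prod Set.finite_univ).image _
    obtain ⟨v, hv⟩ := hfin.bddAbove
    refine ⟨v + 1, fun a ha k => ?_⟩
    have : r a k ≤ v := hv ⟨(a, k), ⟨ha, trivial⟩, rfl⟩
    linarith
  obtain ⟨v, hv⟩ := hbdd
  have := h v
  rwa [slowJobs_eq_self fun a ha => hv a (Finset.mem_union_left _ ha),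
    slowJobs_eq_self fun a ha => hv a (Finset.mem_union_right _ ha)] at this

lemma dominated_empty (n : ℕ) (B : Finset ℕ) : Dominated r n ∅ B := by
  intro v
  have : slowJobs r ∅ v = ∅ := Finset.subset_empty.1 (slowJobs_subset _ _)
  simp [this]

lemma Dominated.union_singleton {n t : ℕ} {A B : Finset ℕ} (h : Dominated r n A B)
    (hA : t ∉ A) (hB : t ∉ B) : Dominated r n (A ∪ {t}) (B ∪ {t}) := by
  classical
  intro v
  have key : ∀ {X : Finset ℕ}, t ∉ X → (slowJobs r (X ∪ {t}) v).card =
      (slowJobs r X v).card + if ∀ k, r t k < v then 1 else 0 := by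
    intro X hX
    rw [slowJobs, Finset.filter_union, Finset.card_union_of_disjoint]
    · rw [Finset.filter_singleton]
      congr 1
      split_ifs <;> simp
    · refine Finset.disjoint_filter_filter (Finset.disjoint_singleton_right.2 hX)
  rw [key hA, key hB]
  have := h v
  omega

lemma card_slowJobs_erase_of_mem_max {B : Finset ℕ} {j' : ℕ} {k' : ι} (hj' : j' ∈ B)
    (hmax : ∀ b ∈ B, ∀ k, r b k ≤ r j' k') (v : ℝ) :
    (slowJobs r (B.erase j') v).card = (slowJobs r B v).card ∨
      ((slowJobs r (B.erase j') v).card + 1 = B.card ∧ (slowJobs r B v).card = B.card) := by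
  by_cases hv : r j' k' < v
  · right
    have hall : ∀ b ∈ B, ∀ k, r b k < v := fun b hb k => (hmax b hb k).trans_lt hv
    rw [slowJobs_erase, slowJobs_eq_self hall]
    exact ⟨Finset.card_erase_add_one hj', rfl⟩
  · left
    rw [slowJobs_erase, Finset.erase_eq_of_notMem]
    exact fun h => hv ((mem_slowJobs.1 h).2 k')

/-- One round of service, `A` being served arbitrarily and `B` optimally, with the same uniform
variable `u`. The relation survives unless `u` lies between the rate used for `A` and the best rate
available in `A`. -/
lemma Dominated.serve [Finite ι] {n : ℕ} {A B : Finset ℕ} (h : Dominated r n A B) {u : ℝ} {j j' : ℕ}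
    {k k' : ι} (hj : A.Nonempty → j ∈ A) (hj' : B.Nonempty → j' ∈ B)
    (hmax : ∀ b ∈ B, ∀ k, r b k ≤ r j' k')
    (hloss : u ≤ r j k ∨ ∀ a ∈ A, ∀ k, r a k < u) :
    Dominated r n (if u ≤ r j k then A.erase j else A)
      (if u ≤ r j' k' then B.erase j' else B) := by
  have hAsub : (if u ≤ r j k then A.erase j else A) ⊆ A := by
    split_ifs
    · exact Finset.erase_subset _ _
    · exact subset_rfl
  by_cases hB : B.Nonempty; swap
  · rw [Finset.not_nonempty_iff_eq_empty] at hB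
    subst hB
    intro v
    have := h v
    have h1 := Finset.card_le_card (slowJobs_mono (r := r) hAsub v)
    split_ifs at h1 ⊢ <;> simp_all <;> omega
  by_cases hu' : u ≤ r j' k'; swap
  · rw [if_neg hu']
    intro v
    exact (Finset.card_le_card (slowJobs_mono hAsub v)).trans (h v)
  rw [if_pos hu']
  intro v
  rcases card_slowJobs_erase_of_mem_max (hj' hB) hmax v with e | ⟨e1, e2⟩
  · rw [e]
    exact (Finset.card_le_card (slowJobs_mono hAsub v)).trans (h v)
  · by_cases hu : u ≤ r j k
    · rw [if_pos hu]
      by_cases hA : A.Nonempty; swap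
      · rw [Finset.not_nonempty_iff_eq_empty] at hA
        subst hA
        have : slowJobs r ((∅ : Finset ℕ).erase j) v = ∅ :=
          Finset.subset_empty.1 ((slowJobs_subset _ _).trans (by simp))
        rw [this]
        simp
      · have hjA := hj hA
        rw [slowJobs_erase]
        by_cases hm : j ∈ slowJobs r A v
        · have := Finset.card_erase_add_one hm
          have := h v
          omega
        · rw [Finset.erase_eq_of_notMem hm]
          -- all thresholds above the best rate of `B` see the whole of `B`, but not `j`
          have h1 : slowJobs r A v ⊆ A.erase j := fun a ha =>
            Finset.mem_erase.2 ⟨fun e => hm (e ▸ ha), slowJobs_subset _ _ ha⟩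
          have h2 := Finset.card_le_card h1
          have h3 := Finset.card_erase_add_one hjA
          have h4 : A.card ≤ B.card + n := h.card_le
          omega
    · rw [if_neg hu]
      have hlt := hloss.resolve_left hu
      -- at the threshold `u` all of `A`, but not `j'`, is counted
      have h1 := h u
      rw [slowJobs_eq_self hlt] at h1
      have h2 : slowJobs r B u ⊆ B.erase j' := fun b hb =>
        Finset.mem_erase.2 ⟨fun e => not_lt.2 hu' ((mem_slowJobs.1 (e ▸ hb)).2 k'),
          slowJobs_subset _ _ hb⟩
      have h3 := Finset.card_le_card h2
      have h4 := Finset.card_erase_add_one (hj' hB)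
      have h5 := Finset.card_le_card (slowJobs_subset (r := r) A v)
      omega

lemma Dominated.serve_of_loss {n : ℕ} {A B : Finset ℕ} (h : Dominated r n A B) {u : ℝ}
    {j j' : ℕ} {k k' : ι} :
    Dominated r (n + 1) (if u ≤ r j k then A.erase j else A)
      (if u ≤ r j' k' then B.erase j' else B) := by
  intro v
  have h1 : (slowJobs r (if u ≤ r j k then A.erase j else A) v).card ≤ (slowJobs r A v).card := by
    apply Finset.card_le_card (slowJobs_mono _ v)
    split_ifs
    · exact Finset.erase_subset _ _
    · exact subset_rfl
  have h2 : (slowJobs r B v).card ≤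
      (slowJobs r (if u ≤ r j' k' then B.erase j' else B) v).card + 1 := by
    split_ifs
    · rw [slowJobs_erase]
      have := Finset.pred_card_le_card_erase (s := slowJobs r B v) (a := j')
      omega
    · omega
  have := h v
  omega

end Comparison

/-! ### Pathwise properties of the queue -/

section Queue

variable {Ω : Type*} {d K : ℕ} {M : Model d K} {N : Noise Ω d K} {π : Schedule Ω K}

@[simp] lemma queue_zero (ω : Ω) : queue M N π 0 ω = ∅ := rfl

@[simp] lemma queue_one (ω : Ω) : queue M N π 1 ω = ∅ := by simp [queue]

lemma queue_succ {t : ℕ} (ht : 1 ≤ t) (ω : Ω) : queue M N π (t + 1) ω =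
    (if N.unif t ω ≤ serviceRate M N ω (π.job t ω) (π.server t ω)
      then (queue M N π t ω).erase (π.job t ω) else queue M N π t ω) ∪
    (if N.arrive t ω = true then {t} else ∅) := by
  rw [queue, if_neg (by omega)]

lemma mem_queue_bounds {t j : ℕ} {ω : Ω} (h : j ∈ queue M N π t ω) : 1 ≤ j ∧ j < t := by
  induction t with
  | zero => simp at h
  | succ t ih =>
    rcases Nat.eq_zero_or_pos t with h0 | h0
    · subst h0; simp at h
    · rw [queue_succ h0, Finset.mem_union] at h
      rcases h with h | h
      · have h' : j ∈ queue M N π t ω := by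
          split_ifs at h
          · exact Finset.mem_of_mem_erase h
          · exact h
        have := ih h'
        omega
      · split_ifs at h
        · rw [Finset.mem_singleton] at h; omega
        · simp at h

lemma card_queue_le (t : ℕ) (ω : Ω) : (queue M N π t ω).card ≤ t := by
  have : queue M N π t ω ⊆ Finset.range t := fun j hj =>
    Finset.mem_range.2 (mem_queue_bounds hj).2
  simpa using Finset.card_le_card this

lemma Arrived.mem_queue {t : ℕ} {ω : Ω} (h : Arrived N t ω) : t - 1 ∈ queue M N π t ω := by
  obtain ⟨h2, ha⟩ := h
  obtain ⟨s, rfl⟩ : ∃ s, t = s + 1 := ⟨t - 1, by omega⟩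
  rw [queue_succ (by omega), Finset.mem_union]
  right
  simp only [Nat.add_sub_cancel] at ha ⊢
  simp [ha]

/-- The context served in round `t`, which is `0` by convention if the queue is empty. In contrast
to `chosen` it is known at the beginning of the round. -/
noncomputable def served (M : Model d K) (N : Noise Ω d K) (π : Schedule Ω K) (t : ℕ) (ω : Ω) :
    Vec d :=
  if (queue M N π t ω).Nonempty then chosen N π t ω else 0

/-- The departure rate of the pair selected in round `t`, computed from `served`. -/
noncomputable def servedRate (M : Model d K) (N : Noise Ω d K) (π : Schedule Ω K) (t : ℕ) (ω : Ω) :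
    ℝ :=
  Real.sigmoid (inner ℝ (served M N π t ω) (M.theta (π.server t ω)))

lemma servedRate_eq {t : ℕ} {ω : Ω} (h : (queue M N π t ω).Nonempty) :
    servedRate M N π t ω = serviceRate M N ω (π.job t ω) (π.server t ω) := by
  simp [servedRate, served, h, chosen, serviceRate]

lemma card_queue_succ {t : ℕ} (ht : 1 ≤ t) {ω : Ω}
    (hmem : (queue M N π t ω).Nonempty → π.job t ω ∈ queue M N π t ω)
    (hne : (queue M N π t ω).Nonempty) :
    queueLength M N π (t + 1) ω = queueLength M N π t ω
      - (if N.unif t ω ≤ servedRate M N π t ω then 1 else 0)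
      + (if N.arrive t ω = true then 1 else 0) := by
  have hnot : t ∉ queue M N π t ω := fun h => absurd (mem_queue_bounds h).2 (lt_irrefl _)
  rw [queueLength, queueLength, queue_succ ht, servedRate_eq hne,
    Finset.card_union_of_disjoint]
  · have hc := Finset.card_erase_add_one (hmem hne)
    have hc' : (((queue M N π t ω).erase (π.job t ω)).card : ℝ) + 1 =
      (queue M N π t ω).card := by exact_mod_cast hc
    split_ifs <;> simp <;> linarith
  · rw [Finset.disjoint_left]
    intro j hj hj'
    split_ifs at hj'
    · rw [Finset.mem_singleton] at hj'
      subst hj'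
      split_ifs at hj
      · exact hnot (Finset.mem_of_mem_erase hj)
      · exact hnot hj
    · simp at hj'

lemma queueLength_succ_le (t : ℕ) (ω : Ω) :
    queueLength M N π (t + 1) ω ≤ queueLength M N π t ω + 1 := by
  rcases Nat.eq_zero_or_pos t with h0 | h0
  · subst h0; simp [queueLength]
  · rw [queueLength, queueLength, queue_succ h0]
    have h1 : (if N.unif t ω ≤ serviceRate M N ω (π.job t ω) (π.server t ω)
      then (queue M N π t ω).erase (π.job t ω) else queue M N π t ω).card ≤
        (queue M N π t ω).card := by
      apply Finset.card_le_card
      split_ifs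
      · exact Finset.erase_subset _ _
      · exact subset_rfl
    have h2 : (if N.arrive t ω = true then {t} else ∅ : Finset ℕ).card ≤ 1 := by
      split_ifs <;> simp
    have h3 := Finset.card_union_le (if N.unif t ω ≤ serviceRate M N ω (π.job t ω) (π.server t ω)
      then (queue M N π t ω).erase (π.job t ω) else queue M N π t ω)
      (if N.arrive t ω = true then {t} else ∅ : Finset ℕ)
    exact_mod_cast (by omega : _ ≤ (queue M N π t ω).card + 1)

/-- The service of round `t` fails although a better available pair would have succeeded. -/
def Loss (M : Model d K) (N : Noise Ω d K) (π : Schedule Ω K) (t : ℕ) (ω : Ω) : Prop :=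
  serviceRate M N ω (π.job t ω) (π.server t ω) < N.unif t ω ∧
    ∃ a ∈ queue M N π t ω, ∃ k, N.unif t ω ≤ serviceRate M N ω a k

open Classical in
/-- After a visit of the queue to `0`, its excess over the optimal queue is at most the number of
losses. -/
lemma card_queue_le_add_losses [m : MeasurableSpace Ω] {ℱ : Filtration ℕ m} {πopt : Schedule Ω K}
    (hmem : ∀ t, 1 ≤ t → ∀ ω, (queue M N π t ω).Nonempty → π.job t ω ∈ queue M N π t ω)
    (hopt : IsOptimal M N πopt ℱ) {s : ℕ} (hs1 : 1 ≤ s) {ω : Ω} (hs : queue M N π s ω = ∅)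
    {T : ℕ} (hT : s ≤ T) :
    (queue M N π T ω).card ≤ (queue M N πopt T ω).card +
      ((Finset.Ico s T).filter fun t => Loss M N π t ω).card := by
  suffices h : Dominated (serviceRate M N ω) ((Finset.Ico s T).filter fun t => Loss M N π t ω).card
      (queue M N π T ω) (queue M N πopt T ω) from h.card_le
  induction T, hT using Nat.le_induction with
  | base => rw [hs]; exact dominated_empty _ _
  | succ t hst ih =>
    have ht : 1 ≤ t := hs1.trans hst
    have hnot : ∀ π' : Schedule Ω K, t ∉ (if N.unif t ω ≤ serviceRate M N ω (π'.job t ω)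
        (π'.server t ω) then (queue M N π' t ω).erase (π'.job t ω) else queue M N π' t ω) := by
      intro π' h
      have : t ∈ queue M N π' t ω := by
        split_ifs at h
        · exact Finset.mem_of_mem_erase h
        · exact h
      exact absurd (mem_queue_bounds this).2 (lt_irrefl _)
    rw [queue_succ ht, queue_succ ht, ← Finset.insert_Ico_right_eq_Ico_add_one hst,
      Finset.filter_insert]
    have hserve : Dominated (serviceRate M N ω) (if Loss M N π t ω then
        insert t ((Finset.Ico s t).filter fun t => Loss M N π t ω) else
        (Finset.Ico s t).filter fun t => Loss M N π t ω).card
        (if N.unif t ω ≤ serviceRate M N ω (π.job t ω) (π.server t ω)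
          then (queue M N π t ω).erase (π.job t ω) else queue M N π t ω)
        (if N.unif t ω ≤ serviceRate M N ω (πopt.job t ω) (πopt.server t ω)
          then (queue M N πopt t ω).erase (πopt.job t ω) else queue M N πopt t ω) := by
      by_cases hl : Loss M N π t ω
      · rw [if_pos hl, Finset.card_insert_of_notMem (by simp)]
        exact ih.serve_of_loss
      · rw [if_neg hl]
        refine ih.serve (hmem t ht ω) (hopt.mem t ht ω) (hopt.max t ht ω) ?_
        rw [Loss, not_and_or] at hl
        rcases hl with hl | hl
        · exact Or.inl (not_lt.1 hl)
        · push Not at hl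
          exact Or.inr hl
    by_cases ha : N.arrive t ω = true
    · rw [if_pos ha]
      exact hserve.union_singleton (hnot π) (hnot πopt)
    · rw [if_neg ha, Finset.union_empty, Finset.union_empty]
      exact hserve

end Queue

/-! ### Measurability of the queue -/

lemma measurableSet_finset_of_mem {Ω : Type*} {m₀ : MeasurableSpace Ω} {Q : Ω → Finset ℕ}
    (h : ∀ j, MeasurableSet {ω | j ∈ Q ω}) (S : Set (Finset ℕ)) : MeasurableSet {ω | Q ω ∈ S} :=
  have hQ : Measurable Q := measurable_finset_iff.2 fun j => measurableSet_setOfPred.1 (h j)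
  hQ (MeasurableSet.of_discrete (s := S))

section Measurability

variable {Ω : Type*} [m : MeasurableSpace Ω] {P : Measure Ω} {ℱ : Filtration ℕ m} {d K : ℕ}
  {M : Model d K} {N : Noise Ω d K} {π : Schedule Ω K} {ν : Measure (Vec d)} {lam p : ℝ}

lemma IsNoise.measurable_round_of_le (hN : IsNoise P ℱ ν lam p N) {j t : ℕ} (hj : 1 ≤ j)
    (hjt : j ≤ t) : Measurable[ℱ t] (N.round j) := by
  obtain ⟨i, rfl⟩ : ∃ i, j = i + 1 := ⟨j - 1, by omega⟩
  exact (hN.adapted i).mono (ℱ.mono hjt) le_rfl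

lemma IsNoise.measurable_arrive (hN : IsNoise P ℱ ν lam p N) {j t : ℕ} (hj : 1 ≤ j)
    (hjt : j ≤ t) : Measurable[ℱ t] (N.arrive j) :=
  measurable_fst.comp (hN.measurable_round_of_le hj hjt)

lemma IsNoise.measurable_feature (hN : IsNoise P ℱ ν lam p N) {j t : ℕ} (hj : 1 ≤ j)
    (hjt : j ≤ t) : Measurable[ℱ t] (N.feature j) :=
  measurable_fst.comp (measurable_snd.comp (hN.measurable_round_of_le hj hjt))

lemma IsNoise.measurable_coin (hN : IsNoise P ℱ ν lam p N) {j t : ℕ} (hj : 1 ≤ j)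
    (hjt : j ≤ t) : Measurable[ℱ t] (N.coin j) :=
  measurable_fst.comp (measurable_snd.comp (measurable_snd.comp
    (hN.measurable_round_of_le hj hjt)))

lemma IsNoise.measurable_unif (hN : IsNoise P ℱ ν lam p N) {j t : ℕ} (hj : 1 ≤ j)
    (hjt : j ≤ t) : Measurable[ℱ t] (N.unif j) :=
  measurable_snd.comp (measurable_snd.comp (measurable_snd.comp (measurable_snd.comp
    (hN.measurable_round_of_le hj hjt))))

lemma measurable_theta_server (hπ : π.Adapted ℱ) (t : ℕ) :
    Measurable[ℱ t] fun ω => M.theta (π.server (t + 1) ω) :=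
  (measurable_of_finite M.theta).comp (hπ.server t)

lemma measurableSet_mem_queue (hN : IsNoise P ℱ ν lam p N) (hπ : π.Adapted ℱ) (t j : ℕ) :
    MeasurableSet[ℱ t] {ω | j ∈ queue M N π (t + 1) ω} := by
  induction t with
  | zero => simp
  | succ t ih =>
    rcases Nat.eq_zero_or_pos j with h0 | h0
    · have : {ω | j ∈ queue M N π (t + 1 + 1) ω} = ∅ := by
        ext ω
        simp only [Set.mem_ofPred_eq, Set.mem_empty_iff_false, iff_false]
        intro h; have := (mem_queue_bounds h).1; omega
      rw [this]; exact @MeasurableSet.empty _ (ℱ (t + 1))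
    by_cases hjt : j ≤ t + 1; swap
    · have : {ω | j ∈ queue M N π (t + 1 + 1) ω} = ∅ := by
        ext ω
        simp only [Set.mem_ofPred_eq, Set.mem_empty_iff_false, iff_false]
        intro h; have := (mem_queue_bounds h).2; omega
      rw [this]; exact @MeasurableSet.empty _ (ℱ (t + 1))
    have e : {ω | j ∈ queue M N π (t + 1 + 1) ω} =
        ({ω | j ∈ queue M N π (t + 1) ω} \ ({ω | N.unif (t + 1) ω ≤ Real.sigmoid
          (inner ℝ (N.feature j ω) (M.theta (π.server (t + 1) ω)))} ∩ {ω | π.job (t + 1) ω = j})) ∪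
        ({ω | N.arrive (t + 1) ω = true} ∩ {_ω | j = t + 1}) := by
      ext ω
      rw [Set.mem_ofPred_eq, queue_succ (by omega), Finset.mem_union]
      simp only [Set.mem_union, Set.mem_sdiff, Set.mem_ofPred_eq, Set.mem_inter_iff]
      apply or_congr
      · by_cases hjob : π.job (t + 1) ω = j
        · rw [hjob, serviceRate]
          split_ifs with hu <;> simp [hu]
        · split_ifs
          · simp [hjob, Finset.mem_erase, Ne.symm hjob]
          · simp [hjob]
      · split_ifs with ha <;> simp [ha]
    rw [e]
    have hle : ℱ t ≤ ℱ (t + 1) := ℱ.mono (Nat.le_succ t)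
    refine MeasurableSet.union (MeasurableSet.diff (hle _ ih) (MeasurableSet.inter ?_ ?_))
      (MeasurableSet.inter ?_ (by simp))
    · apply measurableSet_le (hN.measurable_unif (by omega) le_rfl)
      exact continuous_sigmoid.measurable.comp ((hN.measurable_feature h0 hjt).inner
        ((measurable_theta_server hπ t).mono hle le_rfl))
    · exact hle _ (hπ.job t (measurableSet_singleton j))
    · exact hN.measurable_arrive (by omega) le_rfl (measurableSet_singleton true)

lemma measurableSet_queue (hN : IsNoise P ℱ ν lam p N) (hπ : π.Adapted ℱ) (t : ℕ)
    (S : Set (Finset ℕ)) : MeasurableSet[ℱ t] {ω | queue M N π (t + 1) ω ∈ S} :=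
  measurableSet_finset_of_mem (measurableSet_mem_queue hN hπ t) S

lemma measurableSet_queue_nonempty (hN : IsNoise P ℱ ν lam p N) (hπ : π.Adapted ℱ) (t : ℕ) :
    MeasurableSet[ℱ t] {ω | (queue M N π (t + 1) ω).Nonempty} :=
  measurableSet_queue hN hπ t {X | X.Nonempty}

lemma measurable_queueLength (hN : IsNoise P ℱ ν lam p N) (hπ : π.Adapted ℱ) (t : ℕ) :
    Measurable[ℱ t] (queueLength M N π (t + 1)) := fun S _ =>
  measurableSet_queue hN hπ t {X | ((X.card : ℕ) : ℝ) ∈ S}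

lemma measurable_served (hN : IsNoise P ℱ ν lam p N) (hπ : π.Adapted ℱ)
    (hmem : ∀ t, 1 ≤ t → ∀ ω, (queue M N π t ω).Nonempty → π.job t ω ∈ queue M N π t ω) (t : ℕ) :
    Measurable[ℱ t] (served M N π (t + 1)) := by
  classical
  have e : served M N π (t + 1) = fun ω => ∑ j ∈ Finset.Icc 1 t,
      ({ω | (queue M N π (t + 1) ω).Nonempty} ∩ {ω | π.job (t + 1) ω = j}).indicator
        (N.feature j) ω := by
    ext1 ω
    rw [served]
    split_ifs with h
    · have hb := mem_queue_bounds (hmem (t + 1) (by omega) ω h)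
      rw [Finset.sum_eq_single (π.job (t + 1) ω)]
      · simp [h, chosen]
      · intro j _ hj
        simp [hj.symm]
      · intro hj
        exact absurd (Finset.mem_Icc.2 ⟨hb.1, by omega⟩) hj
    · symm
      apply Finset.sum_eq_zero
      intro j _
      simp [h]
  rw [e]
  refine Finset.measurable_sum _ fun j hj => ?_
  obtain ⟨h1, h2⟩ := Finset.mem_Icc.1 hj
  exact (hN.measurable_feature h1 h2).indicator
    ((measurableSet_queue_nonempty hN hπ t).inter (hπ.job t (measurableSet_singleton j)))

lemma measurable_servedRate (hN : IsNoise P ℱ ν lam p N) (hπ : π.Adapted ℱ)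
    (hmem : ∀ t, 1 ≤ t → ∀ ω, (queue M N π t ω).Nonempty → π.job t ω ∈ queue M N π t ω) (t : ℕ) :
    Measurable[ℱ t] (servedRate M N π (t + 1)) :=
  continuous_sigmoid.measurable.comp
    ((measurable_served hN hπ hmem t).inner (measurable_theta_server hπ t))

end Measurability

/-! ### A self-normalized bound for the noise of the rewards -/

section MatrixMeasurability

variable {Ω : Type*} {m₀ : MeasurableSpace Ω} {n : Type*} [Fintype n] [DecidableEq n]

lemma measurable_det {A : Ω → Matrix n n ℝ} (hA : ∀ a b, Measurable fun ω => A ω a b) :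
    Measurable fun ω => (A ω).det := by
  simp only [Matrix.det_apply']
  exact Finset.measurable_sum _ fun σ _ =>
    measurable_const.mul (Finset.measurable_prod _ fun i _ => hA _ _)

lemma measurable_inv_quadForm {A : Ω → Matrix n n ℝ} (hA : ∀ a b, Measurable fun ω => A ω a b)
    {x y : Ω → n → ℝ} (hx : ∀ a, Measurable fun ω => x ω a) (hy : ∀ a, Measurable fun ω => y ω a) :
    Measurable fun ω => x ω ⬝ᵥ ((A ω)⁻¹ *ᵥ y ω) := by
  have hadj : ∀ a b, Measurable fun ω => (A ω).adjugate a b := by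
    intro a b
    simp only [Matrix.adjugate_apply]
    refine measurable_det fun i j => ?_
    by_cases h : i = b
    · subst h; simp
    · simpa [Matrix.updateRow_apply, h] using hA i j
  have hinv : ∀ a b, Measurable fun ω => (A ω)⁻¹ a b := by
    intro a b
    simp only [Matrix.inv_def, Ring.inverse_eq_inv', Matrix.smul_apply, smul_eq_mul]
    exact (measurable_det hA).inv.mul (hadj a b)
  simp only [dotProduct, Matrix.mulVec]
  exact Finset.measurable_sum _ fun a _ => (hx a).mul
    (Finset.measurable_sum _ fun b _ => (hinv a b).mul (hy b))

end MatrixMeasurability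

/-- One step of the exponential supermartingale: the increment of the self-normalized exponent is
controlled by Hoeffding's lemma for the linear term and by `η² ≤ 1` for the quadratic one. -/
lemma bernoulli_self_normalized_le {p b w : ℝ} (h0 : 0 ≤ p) (h1 : p ≤ 1) (hw : 0 ≤ w) :
    p * Real.exp (2 * ((2 * (1 - p) * b + (1 - p) ^ 2 * w - b ^ 2) / (1 + w))) +
      (1 - p) * Real.exp (2 * ((2 * (0 - p) * b + (0 - p) ^ 2 * w - b ^ 2) / (1 + w))) ≤
      (1 + w) ^ 2 := by
  have hw1 : 0 < 1 + w := by linarith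
  set s := 4 * b / (1 + w) with hs
  have key : ∀ η : ℝ, η ^ 2 ≤ 1 → Real.exp (2 * ((2 * η * b + η ^ 2 * w - b ^ 2) / (1 + w))) ≤
      Real.exp (2 * w / (1 + w)) * Real.exp (-(2 * b ^ 2 / (1 + w))) * Real.exp (s * η) := by
    intro η hη
    rw [← Real.exp_add, ← Real.exp_add]
    apply Real.exp_le_exp.2
    have e : 2 * w / (1 + w) + -(2 * b ^ 2 / (1 + w)) + s * η =
        2 * ((2 * η * b + w - b ^ 2) / (1 + w)) := by rw [hs]; field_simp; ring
    rw [e]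
    gcongr
    nlinarith
  have hA := key (1 - p) (by nlinarith)
  have hB := key (0 - p) (by nlinarith)
  have hH := bernoulli_mgf_le h0 h1 s
  have hsq : s ^ 2 / 8 ≤ 2 * b ^ 2 / (1 + w) := by
    have e : s ^ 2 / 8 = 2 * b ^ 2 / (1 + w) / (1 + w) := by rw [hs]; field_simp; ring
    rw [e]
    exact div_le_self (by positivity) (by linarith)
  set F := Real.exp (2 * w / (1 + w)) * Real.exp (-(2 * b ^ 2 / (1 + w))) with hF
  have hF0 : 0 < F := by positivity
  calc _ ≤ p * (F * Real.exp (s * (1 - p))) + (1 - p) * (F * Real.exp (s * (0 - p))) := by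
        have : 0 ≤ 1 - p := by linarith
        gcongr
    _ = F * (p * Real.exp (s * (1 - p)) + (1 - p) * Real.exp (s * (-p))) := by
        rw [zero_sub]; ring
    _ ≤ F * Real.exp (2 * b ^ 2 / (1 + w)) := by
        apply mul_le_mul_of_nonneg_left (hH.trans (Real.exp_le_exp.2 hsq)) hF0.le
    _ = Real.exp (2 * w / (1 + w)) := by
        rw [hF, mul_assoc, ← Real.exp_add]; simp
    _ ≤ _ := exp_two_mul_div_le hw

section SelfNormalized

variable {Ω : Type*} {d K : ℕ} {M : Model d K} {N : Noise Ω d K} {π : Schedule Ω K}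

lemma rounds_succ (t : ℕ) (k : Fin K) (ω : Ω) : rounds M N π (t + 1) k ω =
    if (queue M N π (t + 1) ω).Nonempty ∧ π.server (t + 1) ω = k
      then insert (t + 1) (rounds M N π t k ω) else rounds M N π t k ω := by
  unfold rounds
  rw [← Finset.insert_Icc_right_eq_Icc_add_one (by omega), Finset.filter_insert]

lemma mem_rounds {t i : ℕ} {k : Fin K} {ω : Ω} : i ∈ rounds M N π t k ω ↔
    (1 ≤ i ∧ i ≤ t) ∧ (queue M N π i ω).Nonempty ∧ π.server i ω = k := by
  simp [rounds]

lemma rounds_subset {s t : ℕ} (hst : s ≤ t) (k : Fin K) (ω : Ω) :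
    rounds M N π s k ω ⊆ rounds M N π t k ω := by
  intro i hi
  rw [mem_rounds] at hi ⊢
  exact ⟨⟨hi.1.1, hi.1.2.trans hst⟩, hi.2⟩

lemma card_rounds_le (t : ℕ) (k : Fin K) (ω : Ω) : (rounds M N π t k ω).card ≤ t := by
  have := Finset.card_filter_le (Finset.Icc 1 t)
    fun i => (queue M N π i ω).Nonempty ∧ π.server i ω = k
  simpa [rounds] using this

lemma served_eq_chosen {i t : ℕ} {k : Fin K} {ω : Ω} (hi : i ∈ rounds M N π t k ω) :
    served M N π i ω = chosen N π i ω := by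
  rw [served, if_pos (mem_rounds.1 hi).2.1]

lemma design_eq (kap lam0 : ℝ) (t : ℕ) (k : Fin K) (ω : Ω) :
    design M N π kap lam0 t k ω = (kap * lam0) • (1 : Matrix (Fin d) (Fin d) ℝ) +
      ∑ i ∈ rounds M N π t k ω, Matrix.vecMulVec (⇑(served M N π i ω)) (⇑(served M N π i ω)) := by
  rw [design]
  congr 1
  refine Finset.sum_congr rfl fun i hi => ?_
  rw [served_eq_chosen hi]

lemma design_posDef {kap lam0 : ℝ} (h : 0 < kap * lam0) (t : ℕ) (k : Fin K) (ω : Ω) :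
    (design M N π kap lam0 t k ω).PosDef :=
  (Matrix.PosDef.one.smul h).add_posSemidef
    (Matrix.posSemidef_sum _ fun _ _ => vecMulVec_self_posSemidef _)

lemma design_succ (kap lam0 : ℝ) (t : ℕ) (k : Fin K) (ω : Ω) :
    design M N π kap lam0 (t + 1) k ω = design M N π kap lam0 t k ω +
      if (queue M N π (t + 1) ω).Nonempty ∧ π.server (t + 1) ω = k then
        Matrix.vecMulVec (⇑(served M N π (t + 1) ω)) (⇑(served M N π (t + 1) ω)) else 0 := by
  rw [design_eq, design_eq, rounds_succ]
  split_ifs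
  · rw [Finset.sum_insert, add_assoc]
    · congr 1; rw [add_comm]
    · rw [mem_rounds]; omega
  · rw [add_zero]

lemma dotProduct_vec (x y : Vec d) : (⇑x) ⬝ᵥ (⇑y) = inner ℝ x y := by
  rw [EuclideanSpace.inner_eq_star_dotProduct, dotProduct_comm]; simp

lemma quadForm_design (kap lam0 : ℝ) (t : ℕ) (k : Fin K) (ω : Ω) (u : Vec d) :
    (⇑u) ⬝ᵥ (design M N π kap lam0 t k ω *ᵥ (⇑u)) =
      designForm (kap * lam0) (rounds M N π t k ω) (fun i => served M N π i ω) u := by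
  rw [design_eq, designForm, Matrix.add_mulVec, dotProduct_add, Matrix.smul_mulVec,
    Matrix.one_mulVec, dotProduct_smul, dotProduct_vec, real_inner_self_eq_norm_sq,
    Matrix.sum_mulVec, dotProduct_sum]
  congr 1
  refine Finset.sum_congr rfl fun i _ => ?_
  rw [vecMulVec_self_mulVec, dotProduct_smul, dotProduct_vec, dotProduct_vec, smul_eq_mul,
    real_inner_comm, sq]

/-- The centred reward of round `t`. -/
noncomputable def rewardNoise (M : Model d K) (N : Noise Ω d K) (π : Schedule Ω K) (t : ℕ)
    (ω : Ω) : ℝ :=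
  (if N.unif t ω ≤ servedRate M N π t ω then 1 else 0) - servedRate M N π t ω

/-- The score `∑ (rᵢ - μ(xᵢᵀ θ*)) xᵢ` of server `k` at the true parameter. -/
noncomputable def score (M : Model d K) (N : Noise Ω d K) (π : Schedule Ω K) (t : ℕ) (k : Fin K)
    (ω : Ω) : Vec d :=
  ∑ i ∈ rounds M N π t k ω, rewardNoise M N π i ω • served M N π i ω

lemma score_succ (t : ℕ) (k : Fin K) (ω : Ω) : score M N π (t + 1) k ω =
    score M N π t k ω + if (queue M N π (t + 1) ω).Nonempty ∧ π.server (t + 1) ω = k then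
      rewardNoise M N π (t + 1) ω • served M N π (t + 1) ω else 0 := by
  rw [score, score, rounds_succ]
  split_ifs
  · rw [Finset.sum_insert, add_comm]
    rw [mem_rounds]; omega
  · rw [add_zero]

/-- The squared norm of the score in the dual norm of the design. -/
noncomputable def scoreForm (M : Model d K) (N : Noise Ω d K) (π : Schedule Ω K) (kap lam0 : ℝ)
    (t : ℕ) (k : Fin K) (ω : Ω) : ℝ :=
  (⇑(score M N π t k ω)) ⬝ᵥ ((design M N π kap lam0 t k ω)⁻¹ *ᵥ (⇑(score M N π t k ω)))

/-- The exponential supermartingale of the self-normalized bound. -/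
noncomputable def expScore (M : Model d K) (N : Noise Ω d K) (π : Schedule Ω K) (kap lam0 : ℝ)
    (k : Fin K) (t : ℕ) (ω : Ω) : ℝ :=
  Real.exp (2 * scoreForm M N π kap lam0 t k ω) *
    ((kap * lam0) ^ d / (design M N π kap lam0 t k ω).det) ^ 2

variable {kap lam0 : ℝ}

lemma measurable_vec_apply {m₀ : MeasurableSpace Ω} {f : Ω → Vec d} (hf : Measurable f)
    (a : Fin d) : Measurable fun ω => f ω a :=
  (EuclideanSpace.proj (𝕜 := ℝ) a).continuous.measurable.comp hf

lemma expScore_zero (h : 0 < kap * lam0) (k : Fin K) (ω : Ω) :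
    expScore M N π kap lam0 k 0 ω = 1 := by
  have h1 : score M N π 0 k ω = 0 := by simp [score, rounds]
  have h2 : design M N π kap lam0 0 k ω = (kap * lam0) • 1 := by simp [design, rounds]
  rw [expScore, scoreForm, h1, h2, Matrix.det_smul]
  have : ((kap * lam0) ^ d) ≠ 0 := by positivity
  simp [this]

lemma expScore_succ_of_not_selected {t : ℕ} {k : Fin K} {ω : Ω}
    (h : ¬ ((queue M N π (t + 1) ω).Nonempty ∧ π.server (t + 1) ω = k)) :
    expScore M N π kap lam0 k (t + 1) ω = expScore M N π kap lam0 k t ω := by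
  rw [expScore, scoreForm, design_succ, score_succ, if_neg h, if_neg h, add_zero, add_zero,
    expScore, scoreForm]

lemma expScore_succ_of_selected (hkl : 0 < kap * lam0) {t : ℕ} {k : Fin K} {ω : Ω}
    (h : (queue M N π (t + 1) ω).Nonempty ∧ π.server (t + 1) ω = k) :
    expScore M N π kap lam0 k (t + 1) ω =
      (expScore M N π kap lam0 k t ω / (1 + (⇑(served M N π (t + 1) ω)) ⬝ᵥ
        ((design M N π kap lam0 t k ω)⁻¹ *ᵥ (⇑(served M N π (t + 1) ω)))) ^ 2) *
      Real.exp (2 * ((2 * rewardNoise M N π (t + 1) ω * ((⇑(served M N π (t + 1) ω)) ⬝ᵥ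
        ((design M N π kap lam0 t k ω)⁻¹ *ᵥ (⇑(score M N π t k ω)))) +
        rewardNoise M N π (t + 1) ω ^ 2 * ((⇑(served M N π (t + 1) ω)) ⬝ᵥ
        ((design M N π kap lam0 t k ω)⁻¹ *ᵥ (⇑(served M N π (t + 1) ω)))) -
        ((⇑(served M N π (t + 1) ω)) ⬝ᵥ
        ((design M N π kap lam0 t k ω)⁻¹ *ᵥ (⇑(score M N π t k ω)))) ^ 2) /
        (1 + (⇑(served M N π (t + 1) ω)) ⬝ᵥ
        ((design M N π kap lam0 t k ω)⁻¹ *ᵥ (⇑(served M N π (t + 1) ω)))))) := by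
  have hV := design_posDef (M := M) (N := N) (π := π) hkl t k ω
  have hco : (⇑(score M N π t k ω + rewardNoise M N π (t + 1) ω • served M N π (t + 1) ω)) =
    (⇑(score M N π t k ω)) + rewardNoise M N π (t + 1) ω • (⇑(served M N π (t + 1) ω)) := rfl
  have hw := quadForm_nonneg hV.inv.posSemidef (⇑(served M N π (t + 1) ω))
  rw [expScore, scoreForm, design_succ, score_succ, if_pos h, if_pos h, hco,
    quadForm_inv_add_vecMulVec hV, det_add_vecMulVec hV, mul_add, Real.exp_add, expScore,
    scoreForm]
  have hdet : (design M N π kap lam0 t k ω).det ≠ 0 := hV.det_pos.ne'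
  field_simp

lemma servedRate_mem (t : ℕ) (ω : Ω) : 0 ≤ servedRate M N π t ω ∧ servedRate M N π t ω ≤ 1 :=
  ⟨Real.sigmoid_nonneg _, Real.sigmoid_le_one _⟩

lemma det_design_le (hkl : 0 < kap * lam0) (hd : 0 < d) {t : ℕ} {k : Fin K} {ω : Ω}
    (hx : ∀ i ∈ rounds M N π t k ω, ‖served M N π i ω‖ ≤ 1) {T : ℕ} (htT : t ≤ T) :
    Real.log ((design M N π kap lam0 t k ω).det / (kap * lam0) ^ d) ≤
      d * Real.log (1 + 1 / (kap * lam0 * d) * T) := by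
  have hV := design_posDef (M := M) (N := N) (π := π) hkl t k ω
  have hd' : (0 : ℝ) < d := by exact_mod_cast hd
  have : Nonempty (Fin d) := ⟨⟨0, hd⟩⟩
  have h1 := det_le_trace_div_card_pow hV.posSemidef
  rw [Fintype.card_fin] at h1
  have htr : (design M N π kap lam0 t k ω).trace ≤ kap * lam0 * d + T := by
    rw [design_eq, Matrix.trace_add, Matrix.trace_smul, Matrix.trace_one, Fintype.card_fin,
      smul_eq_mul, Matrix.trace_sum]
    have h2 : ∑ i ∈ rounds M N π t k ω,
        (Matrix.vecMulVec (⇑(served M N π i ω)) (⇑(served M N π i ω))).trace ≤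
        ∑ i ∈ rounds M N π t k ω, (1 : ℝ) := by
      refine Finset.sum_le_sum fun i hi => ?_
      rw [Matrix.trace_vecMulVec, dotProduct_vec, real_inner_self_eq_norm_sq]
      exact pow_le_one₀ (norm_nonneg _) (hx i hi)
    have h3 : ((rounds M N π t k ω).card : ℝ) ≤ T := by
      exact_mod_cast (card_rounds_le t k ω).trans htT
    rw [Finset.sum_const, nsmul_eq_mul, mul_one] at h2
    linarith
  have h4 : (design M N π kap lam0 t k ω).det / (kap * lam0) ^ d ≤
      (1 + 1 / (kap * lam0 * d) * T) ^ d := by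
    rw [div_le_iff₀ (by positivity), ← mul_pow]
    refine h1.trans (pow_le_pow_left₀ (div_nonneg hV.posSemidef.trace_nonneg hd'.le) ?_ _)
    rw [div_le_iff₀ hd']
    refine htr.trans (le_of_eq ?_)
    have h1 := left_ne_zero_of_mul hkl.ne'
    have h2 := right_ne_zero_of_mul hkl.ne'
    field_simp
  have h5 := Real.log_le_log (div_pos hV.det_pos (by positivity)) h4
  rwa [Real.log_pow] at h5

variable [m : MeasurableSpace Ω] {P : Measure Ω} {ℱ : Filtration ℕ m} {ν : Measure (Vec d)}
  {lam p : ℝ}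

lemma measurableSet_selected (hN : IsNoise P ℱ ν lam p N) (hπ : π.Adapted ℱ) (t : ℕ)
    (k : Fin K) : MeasurableSet[ℱ t]
      {ω | (queue M N π (t + 1) ω).Nonempty ∧ π.server (t + 1) ω = k} :=
  (measurableSet_queue_nonempty hN hπ t).inter (hπ.server t (measurableSet_singleton k))

lemma measurable_rewardNoise (hN : IsNoise P ℱ ν lam p N) (hπ : π.Adapted ℱ)
    (hmem : ∀ t, 1 ≤ t → ∀ ω, (queue M N π t ω).Nonempty → π.job t ω ∈ queue M N π t ω) (t : ℕ) :
    Measurable[ℱ (t + 1)] (rewardNoise M N π (t + 1)) := by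
  have h1 : Measurable[ℱ (t + 1)] (servedRate M N π (t + 1)) :=
    (measurable_servedRate hN hπ hmem t).mono (ℱ.mono (Nat.le_succ t)) le_rfl
  exact (Measurable.ite (measurableSet_le (hN.measurable_unif (by omega) le_rfl) h1)
    measurable_const measurable_const).sub h1

lemma measurable_design (hN : IsNoise P ℱ ν lam p N) (hπ : π.Adapted ℱ)
    (hmem : ∀ t, 1 ≤ t → ∀ ω, (queue M N π t ω).Nonempty → π.job t ω ∈ queue M N π t ω)
    (t : ℕ) (k : Fin K) (a b : Fin d) :
    Measurable[ℱ t] fun ω => design M N π kap lam0 t k ω a b := by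
  induction t with
  | zero => simp [design, rounds]
  | succ t ih =>
    have hle := ℱ.mono (Nat.le_succ t)
    simp only [design_succ, Matrix.add_apply]
    refine (ih.mono hle le_rfl).add ?_
    have h1 : Measurable[ℱ t] (served M N π (t + 1)) := measurable_served hN hπ hmem t
    have h2 : Measurable[ℱ t] fun ω => if (queue M N π (t + 1) ω).Nonempty ∧
        π.server (t + 1) ω = k then served M N π (t + 1) ω a * served M N π (t + 1) ω b else 0 :=
      Measurable.ite (measurableSet_selected hN hπ t k)
        ((measurable_vec_apply h1 a).mul (measurable_vec_apply h1 b)) measurable_const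
    convert h2.mono hle le_rfl using 2 with ω
    split_ifs <;> simp [Matrix.vecMulVec_apply]

lemma measurable_score (hN : IsNoise P ℱ ν lam p N) (hπ : π.Adapted ℱ)
    (hmem : ∀ t, 1 ≤ t → ∀ ω, (queue M N π t ω).Nonempty → π.job t ω ∈ queue M N π t ω)
    (t : ℕ) (k : Fin K) : Measurable[ℱ t] (score M N π t k) := by
  induction t with
  | zero =>
    have : score M N π 0 k = fun _ => 0 := by ext1 ω; simp [score, rounds]
    rw [this]; exact measurable_const
  | succ t ih =>
    have hle := ℱ.mono (Nat.le_succ t)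
    have : score M N π (t + 1) k = fun ω => score M N π t k ω +
      if (queue M N π (t + 1) ω).Nonempty ∧ π.server (t + 1) ω = k then
        rewardNoise M N π (t + 1) ω • served M N π (t + 1) ω else 0 := funext fun ω =>
      score_succ t k ω
    rw [this]
    refine (ih.mono hle le_rfl).add (Measurable.ite (hle _ (measurableSet_selected hN hπ t k))
      ((measurable_rewardNoise hN hπ hmem t).smul
        ((measurable_served hN hπ hmem t).mono hle le_rfl)) measurable_const)

lemma measurable_expScore (hN : IsNoise P ℱ ν lam p N) (hπ : π.Adapted ℱ)
    (hmem : ∀ t, 1 ≤ t → ∀ ω, (queue M N π t ω).Nonempty → π.job t ω ∈ queue M N π t ω)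
    (t : ℕ) (k : Fin K) : Measurable[ℱ t] (expScore M N π kap lam0 k t) := by
  have h1 : ∀ a b, Measurable[ℱ t] fun ω => design M N π kap lam0 t k ω a b :=
    measurable_design hN hπ hmem t k
  have h2 := fun a => measurable_vec_apply (measurable_score hN hπ hmem t k) a
  exact (Real.measurable_exp.comp ((measurable_inv_quadForm h1 h2 h2).const_mul 2)).mul
    ((measurable_const.div (measurable_det h1)).pow_const 2)

end SelfNormalized

section RoundIntegrals

variable {d K : ℕ} {ν : Measure (Vec d)} {lam p : ℝ}

lemma lintegral_roundLaw_unif [IsProbabilityMeasure ν] (hK : 0 < K) (hl0 : 0 ≤ lam)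
    (hl1 : lam ≤ 1) (hp0 : 0 ≤ p) (hp1 : p ≤ 1) {f : ℝ → ENNReal} (hf : Measurable f) :
    ∫⁻ z : RoundSpace d K, f z.2.2.2.2 ∂(roundLaw K ν lam p) =
      ∫⁻ u, f u ∂(volume.restrict (Set.Icc (0 : ℝ) 1)) := by
  have := isProbabilityMeasure_bern hl0 hl1
  have := isProbabilityMeasure_bern hp0 hp1
  have := isProbabilityMeasure_uniformOn_univ_fin hK
  rw [lintegral_roundLaw hK hl0 hl1 hp0 hp1 (by fun_prop)]
  simp only [lintegral_const, measure_univ, mul_one]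

end RoundIntegrals

section SelfNormalizedBound

variable {Ω : Type*} {d K : ℕ} {M : Model d K} {N : Noise Ω d K} {π : Schedule Ω K}
  [m : MeasurableSpace Ω] {P : Measure Ω} [IsProbabilityMeasure P] {ℱ : Filtration ℕ m}
  {ν : Measure (Vec d)} [IsProbabilityMeasure ν] {lam p kap lam0 : ℝ}

lemma setLIntegral_expScore_succ_le (hK : 0 < K) (hl0 : 0 ≤ lam)
    (hl1 : lam ≤ 1) (hp0 : 0 ≤ p) (hp1 : p ≤ 1) (hkl : 0 < kap * lam0)
    (hN : IsNoise P ℱ ν lam p N) (hπ : π.Adapted ℱ)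
    (hmem : ∀ t, 1 ≤ t → ∀ ω, (queue M N π t ω).Nonempty → π.job t ω ∈ queue M N π t ω)
    (k : Fin K) (t : ℕ) {A : Set Ω} (hA : MeasurableSet[ℱ t] A) :
    ∫⁻ ω in A, ENNReal.ofReal (expScore M N π kap lam0 k (t + 1) ω) ∂P ≤
      ∫⁻ ω in A, ENNReal.ofReal (expScore M N π kap lam0 k t ω) ∂P := by
  set B := {ω | (queue M N π (t + 1) ω).Nonempty ∧ π.server (t + 1) ω = k} with hBdef
  have hB : MeasurableSet[ℱ t] B := measurableSet_selected hN hπ t k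
  have hB' : MeasurableSet B := ℱ.le _ _ hB
  have hA' : MeasurableSet A := ℱ.le _ _ hA
  rw [← lintegral_inter_add_sdiff _ A hB', ← lintegral_inter_add_sdiff _ A hB' (μ := P)]
  apply add_le_add
  · let b : Ω → ℝ := fun ω => (⇑(served M N π (t + 1) ω)) ⬝ᵥ
        ((design M N π kap lam0 t k ω)⁻¹ *ᵥ (⇑(score M N π t k ω)))
    let w : Ω → ℝ := fun ω => (⇑(served M N π (t + 1) ω)) ⬝ᵥ
        ((design M N π kap lam0 t k ω)⁻¹ *ᵥ (⇑(served M N π (t + 1) ω)))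
    have h1 : ∀ a b, Measurable[ℱ t] fun ω => design M N π kap lam0 t k ω a b :=
      measurable_design hN hπ hmem t k
    have h2 := fun a => measurable_vec_apply (measurable_score hN hπ hmem t k) a
    have h3 := fun a => measurable_vec_apply (measurable_served hN hπ hmem t) a
    have hb : Measurable[ℱ t] b := measurable_inv_quadForm h1 h3 h2
    have hw : Measurable[ℱ t] w := measurable_inv_quadForm h1 h3 h3
    have hD : Measurable[ℱ t] (expScore M N π kap lam0 k t) := measurable_expScore hN hπ hmem t k
    have hr : Measurable[ℱ t] (servedRate M N π (t + 1)) := measurable_servedRate hN hπ hmem t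
    have hX : Measurable[ℱ t] fun ω => ((expScore M N π kap lam0 k t ω, b ω), w ω,
      servedRate M N π (t + 1) ω) := (hD.prodMk hb).prodMk (hw.prodMk hr)
    let η : ℝ → ℝ → ℝ := fun u q => (if u ≤ q then 1 else 0) - q
    have hη : Measurable fun y : ℝ × ℝ => η y.1 y.2 :=
      (Measurable.ite (measurableSet_le measurable_fst measurable_snd) measurable_const
        measurable_const).sub measurable_snd
    let g : ((ℝ × ℝ) × ℝ × ℝ) × RoundSpace d K → ENNReal := fun y =>
      ENNReal.ofReal (y.1.1.1 / (1 + y.1.2.1) ^ 2) * ENNReal.ofReal (Real.exp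
        (2 * ((2 * η y.2.2.2.2.2 y.1.2.2 * y.1.1.2 + η y.2.2.2.2.2 y.1.2.2 ^ 2 * y.1.2.1 -
          y.1.1.2 ^ 2) / (1 + y.1.2.1))))
    have hηc : Measurable fun y : ((ℝ × ℝ) × ℝ × ℝ) × RoundSpace d K =>
        η y.2.2.2.2.2 y.1.2.2 :=
      hη.comp (f := fun y : ((ℝ × ℝ) × ℝ × ℝ) × RoundSpace d K => (y.2.2.2.2.2, y.1.2.2))
        (by fun_prop)
    have hg : Measurable g := by
      simp only [g]
      fun_prop
    have hwpos : ∀ ω, 0 ≤ w ω := fun ω =>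
      quadForm_nonneg (design_posDef hkl t k ω).inv.posSemidef _
    have hDpos : ∀ ω, 0 ≤ expScore M N π kap lam0 k t ω := fun ω => by
      unfold expScore; positivity
    have hstep := hN.setLIntegral_round_le t hX hg (hA.inter hB)
      (h := fun ω => ENNReal.ofReal (expScore M N π kap lam0 k t ω)) (by
        intro ω _
        simp only [g]
        rw [lintegral_const_mul' _ _ ENNReal.ofReal_ne_top]
        have hinner : ∫⁻ z : RoundSpace d K, ENNReal.ofReal (Real.exp
            (2 * ((2 * η z.2.2.2.2 (servedRate M N π (t + 1) ω) * b ω +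
              η z.2.2.2.2 (servedRate M N π (t + 1) ω) ^ 2 * w ω - b ω ^ 2) / (1 + w ω))))
              ∂(roundLaw K ν lam p) ≤ ENNReal.ofReal ((1 + w ω) ^ 2) := by
          have hηu : Measurable fun u => η u (servedRate M N π (t + 1) ω) :=
            hη.comp (measurable_id.prodMk measurable_const)
          rw [lintegral_roundLaw_unif hK hl0 hl1 hp0 hp1 (f := fun u => ENNReal.ofReal (Real.exp
            (2 * ((2 * η u (servedRate M N π (t + 1) ω) * b ω +
              η u (servedRate M N π (t + 1) ω) ^ 2 * w ω - b ω ^ 2) / (1 + w ω)))))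
              (by fun_prop)]
          obtain ⟨hr0, hr1⟩ := servedRate_mem (M := M) (N := N) (π := π) (t + 1) ω
          set q := servedRate M N π (t + 1) ω
          have e : (fun u => ENNReal.ofReal (Real.exp
              (2 * ((2 * η u q * b ω + η u q ^ 2 * w ω - b ω ^ 2) / (1 + w ω))))) = fun u =>
              if u ≤ q then ENNReal.ofReal (Real.exp
                (2 * ((2 * (1 - q) * b ω + (1 - q) ^ 2 * w ω - b ω ^ 2) / (1 + w ω)))) else
              ENNReal.ofReal (Real.exp
                (2 * ((2 * (0 - q) * b ω + (0 - q) ^ 2 * w ω - b ω ^ 2) / (1 + w ω)))) := by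
            ext u
            simp only [η]
            split_ifs <;> rfl
          rw [e, lintegral_unif_le hr0 hr1, ← ENNReal.ofReal_mul hr0,
            ← ENNReal.ofReal_mul (by linarith), ← ENNReal.ofReal_add
              (mul_nonneg hr0 (Real.exp_pos _).le) (mul_nonneg (by linarith) (Real.exp_pos _).le)]
          exact ENNReal.ofReal_le_ofReal (bernoulli_self_normalized_le hr0 hr1 (hwpos ω))
        refine (mul_le_mul_right hinner _).trans ?_
        have h1w : 0 < 1 + w ω := by linarith [hwpos ω]
        rw [← ENNReal.ofReal_mul (div_nonneg (hDpos ω) (by positivity))]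
        apply ENNReal.ofReal_le_ofReal
        rw [div_mul_cancel₀ _ (by positivity)])
    refine le_trans (le_of_eq ?_) hstep
    refine setLIntegral_congr_fun (hA'.inter hB') fun ω hω => ?_
    simp only [g]
    rw [← ENNReal.ofReal_mul (div_nonneg (hDpos ω) (by positivity)),
      expScore_succ_of_selected hkl hω.2]
    rfl
  · refine le_of_eq (setLIntegral_congr_fun (hA'.diff hB') fun ω hω => ?_)
    rw [expScore_succ_of_not_selected hω.2]

/-- With probability at least `1 - q` the score is bounded in the dual norm of the design, at all
times simultaneously. -/
lemma measure_exists_scoreForm_ge_le (hK : 0 < K) (hl0 : 0 ≤ lam)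
    (hl1 : lam ≤ 1) (hp0 : 0 ≤ p) (hp1 : p ≤ 1) (hkl : 0 < kap * lam0)
    (hN : IsNoise P ℱ ν lam p N) (hπ : π.Adapted ℱ)
    (hmem : ∀ t, 1 ≤ t → ∀ ω, (queue M N π t ω).Nonempty → π.job t ω ∈ queue M N π t ω)
    (k : Fin K) (T : ℕ) {q : ℝ} (hq : 0 < q) :
    P {ω | ∃ s ≤ T, Real.log ((design M N π kap lam0 s k ω).det / (kap * lam0) ^ d)
      + 1 / 2 * Real.log (1 / q) ≤ scoreForm M N π kap lam0 s k ω} ≤ ENNReal.ofReal q := by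
  have hv := measure_exists_le_of_supermartingale (P := P) (ℱ := ℱ)
    (M := fun t ω => ENNReal.ofReal (expScore M N π kap lam0 k t ω))
    (fun t => (measurable_expScore hN hπ hmem t k).ennreal_ofReal)
    (fun t A hA => setLIntegral_expScore_succ_le hK hl0 hl1 hp0 hp1 hkl hN hπ hmem k t hA)
    (ENNReal.ofReal (1 / q)) T
  simp only [expScore_zero hkl, ENNReal.ofReal_one, lintegral_const, measure_univ, mul_one] at hv
  have hsub : {ω | ∃ s ≤ T, Real.log ((design M N π kap lam0 s k ω).det / (kap * lam0) ^ d)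
      + 1 / 2 * Real.log (1 / q) ≤ scoreForm M N π kap lam0 s k ω} ⊆
      {ω | ∃ s ≤ T, ENNReal.ofReal (1 / q) ≤
        ENNReal.ofReal (expScore M N π kap lam0 k s ω)} := by
    rintro ω ⟨s, hs, h⟩
    refine ⟨s, hs, ENNReal.ofReal_le_ofReal ?_⟩
    have hdet := (design_posDef (M := M) (N := N) (π := π) hkl s k ω).det_pos
    rw [expScore]
    set D := (design M N π kap lam0 s k ω).det
    set v := (kap * lam0) ^ d with hv
    have hv0 : 0 < v := by positivity
    have h1 : Real.log (1 / q) ≤ 2 * scoreForm M N π kap lam0 s k ω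
        + Real.log ((v / D) ^ 2) := by
      rw [Real.log_pow, Real.log_div hv0.ne' hdet.ne']
      rw [Real.log_div hdet.ne' hv0.ne'] at h
      push_cast
      linarith
    have h2 := Real.exp_le_exp.2 h1
    rwa [Real.exp_log (by positivity), Real.exp_add, Real.exp_log (by positivity)] at h2
  refine (measure_mono hsub).trans ?_
  have h3 : ENNReal.ofReal (1 / q) = (ENNReal.ofReal q)⁻¹ := by
    rw [one_div, ENNReal.ofReal_inv_of_pos hq]
  rw [h3] at hv
  have := mul_le_mul_right hv (ENNReal.ofReal q)
  rwa [← mul_assoc, ENNReal.mul_inv_cancel (by simpa using hq) ENNReal.ofReal_ne_top, one_mul,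
    mul_one, ← h3] at this

end SelfNormalizedBound

/-! ### Estimation error and the gap of an exploitation round -/

section Gap

variable {Ω : Type*} {d K : ℕ} {M : Model d K} {N : Noise Ω d K} {π : Schedule Ω K}
  {lam kap R S sig0 eps lam0 delta : ℝ}

lemma radius_nonneg (hkap : 0 ≤ kap) (hS : 0 ≤ S) (n : ℕ) :
    0 ≤ radius d K kap S lam0 delta n := by
  unfold radius; positivity

lemma radius_mono (hkap : 0 ≤ kap) (hlam0 : 0 ≤ lam0) {n n' : ℕ} (h : n ≤ n') :
    radius d K kap S lam0 delta n ≤ radius d K kap S lam0 delta n' := by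
  unfold radius
  gcongr

lemma mul_sqrt_add_le_radius {q : ℝ} {T : ℕ} (hkap : 4 ≤ kap) (hS : 0 ≤ S)
    (hq : q ≤ d * Real.log (1 + 1 / (kap * lam0 * d) * T) + 1 / 2 * Real.log (K / delta)) :
    kap * Real.sqrt q + S * Real.sqrt (kap * lam0) ≤ 2 * radius d K kap S lam0 delta T := by
  have hk0 : 0 ≤ kap := by linarith
  unfold radius
  set X := 2 * d * Real.log (1 + 1 / (kap * lam0 * d) * T) + Real.log (K / delta) with hX
  have h1 : Real.sqrt q ≤ Real.sqrt X := by
    rcases le_or_gt q 0 with h | h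
    · rw [Real.sqrt_eq_zero_of_nonpos h]; exact Real.sqrt_nonneg _
    · exact Real.sqrt_le_sqrt (by rw [hX]; linarith)
  have h2 : Real.sqrt kap ≤ kap := by
    rw [Real.sqrt_le_left hk0]; nlinarith
  have h3 : S * Real.sqrt (kap * lam0) ≤ kap * S * Real.sqrt lam0 := by
    rw [Real.sqrt_mul hk0]
    calc S * (Real.sqrt kap * Real.sqrt lam0) ≤ S * (kap * Real.sqrt lam0) := by gcongr
      _ = _ := by ring
  have h4 : kap * Real.sqrt q ≤ kap * Real.sqrt X := by gcongr
  linarith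

lemma mul_sqrt_le_radius (hkap : 4 ≤ kap) (hS : 0 ≤ S) (n : ℕ) :
    S * Real.sqrt (kap * lam0) ≤ radius d K kap S lam0 delta n := by
  have hk0 : 0 ≤ kap := by linarith
  have h2 : Real.sqrt kap ≤ kap / 2 := by
    rw [Real.sqrt_le_left (by linarith)]; nlinarith
  rw [Real.sqrt_mul hk0]
  have h3 : S * (Real.sqrt kap * Real.sqrt lam0) ≤ S * (kap / 2 * Real.sqrt lam0) := by gcongr
  have h4 : 0 ≤ kap / 2 * Real.sqrt (2 * d * Real.log (1 + 1 / (kap * lam0 * d) * n)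
    + Real.log (K / delta)) := by positivity
  unfold radius
  linarith

/-- If the score is bounded as in the self-normalized bound and the design dominates `m ‖u‖²`, the
estimate has error `O(β / √m)`. -/
lemma norm_estimate_sub_le (hA : Assumptions M lam kap R S sig0 eps) (hkap : 4 ≤ kap)
    (hlam0 : 0 < lam0) {t T : ℕ} {k : Fin K} {ω : Ω}
    (hctx : ∀ j, 1 ≤ j → N.feature j ω ∈ M.contexts)
    (hmem : ∀ t, 1 ≤ t → (queue M N π t ω).Nonempty → π.job t ω ∈ queue M N π t ω)
    (hsf : scoreForm M N π kap lam0 t k ω ≤ d * Real.log (1 + 1 / (kap * lam0 * d) * T)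
      + 1 / 2 * Real.log (K / delta))
    {m : ℝ} (hm : 0 < m) (hmq : ∀ u : Vec d, m * ‖u‖ ^ 2 ≤ designForm (kap * lam0)
      (rounds M N π t k ω) (fun i => served M N π i ω) u)
    (hsmall : 4 * radius d K kap S lam0 delta T < Real.sqrt m) {θh : Vec d}
    (hest : IsEstimate M N π kap S lam0 t k ω θh) :
    ‖θh - M.theta k‖ ≤ 14 * radius d K kap S lam0 delta T / Real.sqrt m := by
  have hk0 : 0 < kap := hA.kap_pos
  have hkl : 0 < kap * lam0 := by positivity
  have hS : 0 ≤ S := (norm_nonneg _).trans (hA.theta_norm k)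
  have hV := design_posDef (M := M) (N := N) (π := π) hkl t k ω
  obtain ⟨hθS, θ1, hmax, hmin⟩ := hest
  set I := rounds M N π t k ω with hI
  set β := radius d K kap S lam0 delta T with hβ
  have hcs : ∀ i ∈ I, served M N π i ω = chosen N π i ω := fun i hi => served_eq_chosen hi
  have hxc : ∀ i ∈ I, served M N π i ω ∈ M.contexts := by
    intro i hi
    have hi' := mem_rounds.1 hi
    rw [hcs i hi]
    exact hctx _ (mem_queue_bounds (hmem i hi'.1.1 hi'.2.1)).1
  let x : ℕ → Vec d := fun i => served M N π i ω
  let r : ℕ → ℝ := fun i => reward M N π i ω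
  set q := designForm (kap * lam0) I x with hq
  have hquad : ∀ u : Vec d, (⇑u) ⬝ᵥ (design M N π kap lam0 t k ω *ᵥ (⇑u)) = q u :=
    fun u => quadForm_design kap lam0 t k ω u
  have hfoc : ∀ u, ∑ i ∈ I, (r i - Real.sigmoid (inner ℝ (x i) θ1)) * inner ℝ (x i) u
      = lam0 * inner ℝ θ1 u := by
    apply likelihood_equation
    intro θ
    have h := hmax θ
    simp only [logLik] at h
    have e : ∀ θ : Vec d, ∑ i ∈ I, (r i * Real.log (Real.sigmoid (inner ℝ (x i) θ)) +
        (1 - r i) * Real.log (1 - Real.sigmoid (inner ℝ (x i) θ))) =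
        ∑ i ∈ I, (reward M N π i ω * Real.log (Real.sigmoid (inner ℝ (chosen N π i ω) θ)) +
        (1 - reward M N π i ω) *
          Real.log (1 - Real.sigmoid (inner ℝ (chosen N π i ω) θ))) := fun θ =>
      Finset.sum_congr rfl fun i hi => by simp only [x, r, hcs i hi]
    rw [e, e]
    exact h
  have hvec : ∀ θ : Vec d, ∑ i ∈ I, (Real.sigmoid (inner ℝ (chosen N π i ω) θ)
      - Real.sigmoid (inner ℝ (chosen N π i ω) θ1)) • chosen N π i ω =
      ∑ i ∈ I, (Real.sigmoid (inner ℝ (x i) θ) - Real.sigmoid (inner ℝ (x i) θ1)) • x i := fun θ =>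
    Finset.sum_congr rfl fun i hi => by simp only [x, hcs i hi]
  have hin : ∀ (θ u : Vec d), inner ℝ (∑ i ∈ I, (Real.sigmoid (inner ℝ (x i) θ)
      - Real.sigmoid (inner ℝ (x i) θ1)) • x i) u =
      ∑ i ∈ I, (Real.sigmoid (inner ℝ (x i) θ) - Real.sigmoid (inner ℝ (x i) θ1)) *
        inner ℝ (x i) u := by
    intro θ u
    rw [sum_inner]
    exact Finset.sum_congr rfl fun i _ => by rw [real_inner_smul_left]
  have hproj : ∀ c : ℝ, 0 ≤ c → (∀ u, ∑ i ∈ I, (Real.sigmoid (inner ℝ (x i) (M.theta k))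
        - Real.sigmoid (inner ℝ (x i) θ1)) * inner ℝ (x i) u ≤ c * Real.sqrt (q u)) →
      ∀ u, ∑ i ∈ I, (Real.sigmoid (inner ℝ (x i) θh)
        - Real.sigmoid (inner ℝ (x i) θ1)) * inner ℝ (x i) u ≤ c * Real.sqrt (q u) := by
    intro c hc h u
    have h1 := hmin (M.theta k) (hA.theta_norm k)
    rw [hvec, hvec, wnorm, wnorm] at h1
    have h2 := sqrt_quadForm_inv_le hV (g := ⇑(∑ i ∈ I, (Real.sigmoid (inner ℝ (x i) (M.theta k))
        - Real.sigmoid (inner ℝ (x i) θ1)) • x i)) hc (by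
      intro v
      have h3 := h (WithLp.toLp 2 v)
      rw [← hin, ← hquad, ← dotProduct_vec] at h3
      exact h3)
    have h4 := dotProduct_le_of_posDef hV (⇑(∑ i ∈ I, (Real.sigmoid (inner ℝ (x i) θh)
        - Real.sigmoid (inner ℝ (x i) θ1)) • x i)) (⇑u)
    rw [dotProduct_vec, hin, hquad] at h4
    exact h4.trans (mul_le_mul_of_nonneg_right (h1.trans h2) (Real.sqrt_nonneg _))
  set W := Real.sqrt (scoreForm M N π kap lam0 t k ω) + lam0 * S / Real.sqrt (kap * lam0) with hWdef
  have hsk : 0 < Real.sqrt (kap * lam0) := Real.sqrt_pos.2 hkl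
  have hW : ∀ u, ∑ i ∈ I, (r i - Real.sigmoid (inner ℝ (x i) (M.theta k))) * inner ℝ (x i) u
      - lam0 * inner ℝ (M.theta k) u ≤ W * Real.sqrt (q u) := by
    intro u
    have h1 := dotProduct_le_of_posDef hV (⇑(score M N π t k ω)) (⇑u)
    rw [dotProduct_vec, hquad] at h1
    have h2 : inner ℝ (score M N π t k ω) u =
        ∑ i ∈ I, (r i - Real.sigmoid (inner ℝ (x i) (M.theta k))) * inner ℝ (x i) u := by
      rw [score, sum_inner]
      refine Finset.sum_congr rfl fun i hi => ?_
      have hi' := (mem_rounds.1 hi).2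
      have e1 : Real.sigmoid (inner ℝ (x i) (M.theta k)) = servedRate M N π i ω := by
        rw [servedRate, hi'.2]
      rw [real_inner_smul_left, e1, rewardNoise]
      congr 2
      simp only [r, reward, servedRate_eq hi'.1]
    rw [h2] at h1
    have h3 : -(lam0 * inner ℝ (M.theta k) u) ≤
        lam0 * S / Real.sqrt (kap * lam0) * Real.sqrt (q u) := by
      have h4 : -(inner ℝ (M.theta k) u) ≤ S * ‖u‖ := by
        have := (abs_le.1 (abs_real_inner_le_norm (M.theta k) u)).1
        nlinarith [hA.theta_norm k, norm_nonneg u]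
      have h5 : ‖u‖ ≤ Real.sqrt (q u) / Real.sqrt (kap * lam0) := by
        rw [le_div_iff₀ hsk, mul_comm]
        exact sqrt_mul_le_sqrt hkl.le (norm_nonneg _) (mul_norm_sq_le_designForm _ _ _ _)
      calc -(lam0 * inner ℝ (M.theta k) u) = lam0 * -(inner ℝ (M.theta k) u) := by ring
        _ ≤ lam0 * (S * (Real.sqrt (q u) / Real.sqrt (kap * lam0))) := by gcongr; exact h4.trans (by gcongr)
        _ = _ := by ring
    rw [hWdef, add_mul, scoreForm]
    linarith
  have hW0 : 0 ≤ W := by positivity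
  have hkW : kap * W ≤ 2 * β := by
    have := mul_sqrt_add_le_radius (S := S) hkap hS hsf
    have e : kap * (lam0 * S / Real.sqrt (kap * lam0)) = S * Real.sqrt (kap * lam0) := by
      rw [mul_div_assoc', div_eq_iff hsk.ne', mul_assoc, Real.mul_self_sqrt hkl.le]; ring
    rw [hWdef, mul_add, e]
    exact this
  have hmain := designForm_projection_sub_le (r := r) (θs := M.theta k) (θ1 := θ1) (θh := θh)
    hk0 hlam0
    (fun i hi => hA.context_norm _ (hxc i hi))
    (fun i hi θ hθ => (hA.deriv_bounds _ (hxc i hi) θ hθ).1) (hA.theta_norm k) hθS hfoc hproj hW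
    hW0 hm hmq (by linarith)
  have h14 := hmain.trans (show 6 * kap * W + 2 * S * Real.sqrt (kap * lam0) ≤ 14 * β by
    have := mul_sqrt_le_radius (d := d) (K := K) (lam0 := lam0) (delta := delta) hkap hS T
    linarith)
  rw [le_div_iff₀ (Real.sqrt_pos.2 hm), mul_comm]
  exact (sqrt_mul_le_sqrt hm.le (norm_nonneg _) (hmq _)).trans h14

/-- In an exploitation round the selected pair is within `8 β / √m` of the best available one. Only
the accuracy of the estimates is used, not the optimism of the confidence bounds. -/
lemma serviceRate_le_servedRate_add (hA : Assumptions M lam kap R S sig0 eps) (hkap : 4 ≤ kap)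
    (hlam0 : 0 < lam0) {t T : ℕ} (htT : t ≤ T) {ω : Ω}
    (hctx : ∀ j, 1 ≤ j → N.feature j ω ∈ M.contexts)
    (hmem : ∀ t, 1 ≤ t → (queue M N π t ω).Nonempty → π.job t ω ∈ queue M N π t ω)
    (hsf : ∀ k, scoreForm M N π kap lam0 (t - 1) k ω ≤
      d * Real.log (1 + 1 / (kap * lam0 * d) * T) + 1 / 2 * Real.log (K / delta))
    {m : ℝ} (hm : 0 < m) (hmq : ∀ k, ∀ u : Vec d, m * ‖u‖ ^ 2 ≤ designForm (kap * lam0)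
      (rounds M N π (t - 1) k ω) (fun i => served M N π i ω) u)
    (hsmall : 4 * radius d K kap S lam0 delta T < Real.sqrt m)
    {est : ℕ → Fin K → Ω → Vec d} (hest : ∀ k, IsEstimate M N π kap S lam0 (t - 1) k ω
      (est (t - 1) k ω)) (ht : 1 ≤ t)
    (hucb : ∀ j ∈ queue M N π t ω, ∀ k, ucb M N π kap S lam0 delta est t ω j k ≤
        ucb M N π kap S lam0 delta est t ω (π.job t ω) (π.server t ω))
    {j : ℕ} (hj : j ∈ queue M N π t ω) (k : Fin K) :
    serviceRate M N ω j k ≤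
      servedRate M N π t ω + 8 * radius d K kap S lam0 delta T / Real.sqrt m := by
  set β := radius d K kap S lam0 delta T with hβ
  have hk0 : 0 < kap := hA.kap_pos
  have hkl : 0 < kap * lam0 := by positivity
  have hS : 0 ≤ S := (norm_nonneg _).trans (hA.theta_norm k)
  have hsm : 0 < Real.sqrt m := Real.sqrt_pos.2 hm
  have herr : ∀ j ∈ queue M N π t ω, ∀ k,
      |Real.sigmoid (inner ℝ (N.feature j ω) (est (t - 1) k ω)) - serviceRate M N ω j k| ≤
        7 / 2 * β / Real.sqrt m := by
    intro j hj k
    have hx := hA.context_norm _ (hctx j (mem_queue_bounds hj).1)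
    have h1 := norm_estimate_sub_le hA hkap hlam0 hctx hmem (hsf k) hm (hmq k) hsmall (hest k)
    refine (abs_sigmoid_sub_le _ _).trans ?_
    rw [← inner_sub_right]
    have h2 : |inner ℝ (N.feature j ω) (est (t - 1) k ω - M.theta k)| ≤
        14 * β / Real.sqrt m := (abs_real_inner_le_norm _ _).trans
      ((mul_le_of_le_one_left (norm_nonneg _) hx).trans h1)
    calc _ ≤ 1 / 4 * (14 * β / Real.sqrt m) := by gcongr
      _ = _ := by ring
  have hne : (queue M N π t ω).Nonempty := ⟨j, hj⟩
  have hjob := hmem t ht hne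
  have hbonus : radius d K kap S lam0 delta (rounds M N π (t - 1) (π.server t ω) ω).card *
      wnorm (design M N π kap lam0 (t - 1) (π.server t ω) ω)⁻¹ (N.feature (π.job t ω) ω) ≤
      β / Real.sqrt m := by
    have hx := hA.context_norm _ (hctx _ (mem_queue_bounds hjob).1)
    have h1 : radius d K kap S lam0 delta (rounds M N π (t - 1) (π.server t ω) ω).card ≤ β :=
      radius_mono hk0.le hlam0.le ((card_rounds_le _ _ _).trans (by omega))
    have h2 : wnorm (design M N π kap lam0 (t - 1) (π.server t ω) ω)⁻¹
        (N.feature (π.job t ω) ω) ≤ 1 / Real.sqrt m := by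
      apply sqrt_quadForm_inv_le (design_posDef hkl _ _ _) (by positivity)
      intro v
      have e1 := dotProduct_vec (N.feature (π.job t ω) ω) (WithLp.toLp 2 v)
      have e2 := quadForm_design (M := M) (N := N) (π := π) kap lam0 (t - 1) (π.server t ω) ω
        (WithLp.toLp 2 v)
      simp only at e1 e2
      rw [e1, e2, one_div, ← div_eq_inv_mul, le_div_iff₀ hsm, mul_comm]
      refine le_trans ?_ (sqrt_mul_le_sqrt hm.le (norm_nonneg _) (hmq (π.server t ω) _))
      gcongr
      exact (real_inner_le_norm _ _).trans (mul_le_of_le_one_left (norm_nonneg _) hx)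
    calc _ ≤ β * (1 / Real.sqrt m) := mul_le_mul h1 h2 (Real.sqrt_nonneg _)
          (radius_nonneg hk0.le hS _)
      _ = _ := by ring
  have hopt : 0 ≤ radius d K kap S lam0 delta (rounds M N π (t - 1) k ω).card *
      wnorm (design M N π kap lam0 (t - 1) k ω)⁻¹ (N.feature j ω) :=
    mul_nonneg (radius_nonneg hk0.le hS _) (Real.sqrt_nonneg _)
  have h1 := hucb j hj k
  rw [ucb, ucb] at h1
  have h2 := (abs_le.1 (herr j hj k)).1
  have h3 := (abs_le.1 (herr _ hjob (π.server t ω))).2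
  rw [servedRate_eq hne]
  have e : 8 * β / Real.sqrt m = 7 / 2 * β / Real.sqrt m + 7 / 2 * β / Real.sqrt m
    + β / Real.sqrt m := by ring
  rw [e]
  linarith

end Gap

/-! ### Second moments as vectors of a Hilbert space -/

section Outer

variable {d : ℕ}

/-- The matrix `x xᵀ` as a vector of the Euclidean space of `d × d` matrices. The Frobenius norm of
sums of such matrices concentrates at a rate that does not depend on the dimension. -/
noncomputable def outer (x : Vec d) : EuclideanSpace ℝ (Fin d × Fin d) :=
  WithLp.toLp 2 fun p => x p.1 * x p.2

lemma inner_outer (x u : Vec d) : inner ℝ (outer x) (outer u) = (inner ℝ x u) ^ 2 := by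
  rw [PiLp.inner_apply, PiLp.inner_apply, Fintype.sum_prod_type, sq, Finset.sum_mul_sum]
  refine Finset.sum_congr rfl fun i _ => Finset.sum_congr rfl fun j _ => ?_
  simp [outer]
  ring

lemma norm_outer (x : Vec d) : ‖outer x‖ = ‖x‖ ^ 2 := by
  have h := inner_outer x x
  rw [real_inner_self_eq_norm_sq, real_inner_self_eq_norm_sq] at h
  exact (pow_left_inj₀ (norm_nonneg _) (by positivity) two_ne_zero).1 h

lemma continuous_outer : Continuous (outer : Vec d → _) := by
  unfold outer
  fun_prop

variable (ν : Measure (Vec d))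

/-- The mean of `x xᵀ`. -/
noncomputable def meanOuter : EuclideanSpace ℝ (Fin d × Fin d) := ∫ x, outer x ∂ν

variable {ν} [IsProbabilityMeasure ν]

lemma integrable_outer (hν : ∀ᵐ x ∂ν, ‖x‖ ≤ 1) : Integrable outer ν :=
  .of_bound continuous_outer.aestronglyMeasurable 1 (hν.mono fun x hx => by
    rw [norm_outer]; exact pow_le_one₀ (norm_nonneg _) hx)

lemma norm_meanOuter_le (hν : ∀ᵐ x ∂ν, ‖x‖ ≤ 1) : ‖meanOuter ν‖ ≤ 1 := by
  have := norm_integral_le_of_norm_le_const (μ := ν) (f := outer) (C := 1) (hν.mono fun x hx => by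
    rw [norm_outer]; exact pow_le_one₀ (norm_nonneg _) hx)
  simpa [meanOuter] using this

lemma inner_meanOuter (hν : ∀ᵐ x ∂ν, ‖x‖ ≤ 1) (u : Vec d) :
    inner ℝ (meanOuter ν) (outer u) = (⇑u) ⬝ᵥ (secondMoment ν *ᵥ (⇑u)) := by
  have h : ∀ p : Fin d × Fin d, meanOuter ν p = ∫ x, x p.1 * x p.2 ∂ν := by
    intro p
    have := (EuclideanSpace.proj (𝕜 := ℝ) p).integral_comp_comm (integrable_outer hν)
    rw [meanOuter]
    simpa [outer] using this.symm
  rw [PiLp.inner_apply, Fintype.sum_prod_type, dotProduct]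
  refine Finset.sum_congr rfl fun i _ => ?_
  rw [Matrix.mulVec, dotProduct, Finset.mul_sum]
  refine Finset.sum_congr rfl fun j _ => ?_
  rw [h]
  simp [outer, secondMoment]
  ring

/-- One step of the concentration of bounded vectors in a Hilbert space. -/
lemma lintegral_cosh_norm_add_le (hν : ∀ᵐ x ∂ν, ‖x‖ ≤ 1) (s : ℝ)
    (v : EuclideanSpace ℝ (Fin d × Fin d)) :
    ∫⁻ x, ENNReal.ofReal (Real.cosh (s * ‖v + (outer x - meanOuter ν)‖)) ∂ν ≤
      ENNReal.ofReal (Real.cosh (s * ‖v‖) * Real.exp (2 * s ^ 2)) := by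
  set a := ‖v‖ with ha
  have hmean := norm_meanOuter_le hν
  have hint : Integrable (fun x => inner ℝ v (outer x - meanOuter ν) / (2 * a)) ν :=
    (((integrable_outer hν).sub (integrable_const _)).const_inner v).div_const _
  have hzero : ∫ x, inner ℝ v (outer x - meanOuter ν) / (2 * a) ∂ν = 0 := by
    have hD : Integrable (fun x => outer x - meanOuter ν) ν :=
      (integrable_outer hν).sub (integrable_const _)
    rw [integral_div, integral_inner hD, integral_sub (integrable_outer hν) (integrable_const _)]
    simp [meanOuter]
  have hpt : ∀ᵐ x ∂ν, Real.cosh (s * ‖v + (outer x - meanOuter ν)‖) ≤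
      Real.cosh (s * a) * Real.cosh (2 * s) + inner ℝ v (outer x - meanOuter ν) / (2 * a) *
        (Real.sinh (s * a) * Real.sinh (2 * s)) := by
    filter_upwards [hν] with x hx
    set D := outer x - meanOuter ν with hD
    have hDn : ‖D‖ ≤ 2 := by
      refine (norm_sub_le _ _).trans ?_
      have : ‖outer x‖ ≤ 1 := by rw [norm_outer]; exact pow_le_one₀ (norm_nonneg _) hx
      linarith
    have hcs : |inner ℝ v D| ≤ 2 * a := (abs_real_inner_le_norm _ _).trans (by
      rw [mul_comm]; exact mul_le_mul_of_nonneg_right hDn (norm_nonneg _))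
    have hc : inner ℝ v D / (2 * a) ∈ Set.Icc (-1 : ℝ) 1 := by
      have : |inner ℝ v D / (2 * a)| ≤ 1 := by
        rw [abs_div, abs_of_nonneg (by positivity : 0 ≤ 2 * a)]
        exact div_le_one_of_le₀ hcs (by positivity)
      exact abs_le.1 this
    -- for `v = 0` the quotient is `0` by convention, and so is the inner product
    have hca : 2 * a * (inner ℝ v D / (2 * a)) = inner ℝ v D := by
      rcases eq_or_ne a 0 with h0 | h0
      · have : v = 0 := norm_eq_zero.1 (ha ▸ h0)
        rw [this, inner_zero_left]; simp
      · field_simp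
    refine le_trans ?_ (cosh_sqrt_le (s * a) (2 * s) _ hc)
    rw [Real.cosh_le_cosh, abs_of_nonneg (Real.sqrt_nonneg _)]
    apply Real.le_sqrt_of_sq_le
    rw [sq_abs, mul_pow, norm_add_sq_real, ← ha]
    have e : 2 * (s * a) * (2 * s) * (inner ℝ v D / (2 * a)) = s ^ 2 * (2 * inner ℝ v D) := by
      linear_combination 2 * s ^ 2 * hca
    rw [e]
    nlinarith [mul_le_mul_of_nonneg_left (pow_le_pow_left₀ (norm_nonneg D) hDn 2) (sq_nonneg s)]
  have hint2 := (hint.mul_const (Real.sinh (s * a) * Real.sinh (2 * s)))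
  have hint3 : Integrable (fun x => Real.cosh (s * a) * Real.cosh (2 * s) +
      inner ℝ v (outer x - meanOuter ν) / (2 * a) * (Real.sinh (s * a) * Real.sinh (2 * s))) ν :=
    (integrable_const _).add hint2
  calc _ ≤ ∫⁻ x, ENNReal.ofReal (Real.cosh (s * a) * Real.cosh (2 * s) +
        inner ℝ v (outer x - meanOuter ν) / (2 * a) * (Real.sinh (s * a) * Real.sinh (2 * s))) ∂ν :=
        lintegral_mono_ae (hpt.mono fun x hx => ENNReal.ofReal_le_ofReal hx)
    _ = ENNReal.ofReal (∫ x, (Real.cosh (s * a) * Real.cosh (2 * s) +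
        inner ℝ v (outer x - meanOuter ν) / (2 * a) *
          (Real.sinh (s * a) * Real.sinh (2 * s))) ∂ν) := by
        rw [ofReal_integral_eq_lintegral_ofReal hint3]
        exact hpt.mono fun x hx => (Real.cosh_pos _).le.trans hx
    _ ≤ _ := by
        apply ENNReal.ofReal_le_ofReal
        rw [integral_add (integrable_const _) hint2, integral_mul_const (μ := ν)
          (Real.sinh (s * a) * Real.sinh (2 * s)), hzero]
        simp only [integral_const, probReal_univ, one_smul, zero_mul, add_zero]
        gcongr
        refine (Real.cosh_le_exp_half_sq _).trans (Real.exp_le_exp.2 (le_of_eq ?_))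
        ring

end Outer

section SecondMoment

variable {d K : ℕ} {M : Model d K} {lam kap R S sig0 eps : ℝ}

lemma Assumptions.ae_norm_le (hA : Assumptions M lam kap R S sig0 eps) :
    ∀ᵐ x ∂M.dist, ‖x‖ ≤ 1 := hA.dist_contexts.mono fun x hx => hA.context_norm x hx

lemma Assumptions.sq_mul_le_inner_meanOuter (hA : Assumptions M lam kap R S sig0 eps)
    (u : Vec d) : sig0 ^ 2 * ‖u‖ ^ 2 ≤ inner ℝ (meanOuter M.dist) (outer u) := by
  have := hA.dist_prob
  obtain ⟨Sg, h, hpsd, hleast⟩ := hA.second_moment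
  rw [inner_meanOuter hA.ae_norm_le]
  have h1 := mul_dotProduct_self_le_of_le_eigenvalues h.isHermitian
    (fun i => hleast.2 ⟨i, rfl⟩) (⇑u)
  have h2 := quadForm_nonneg hpsd (⇑u)
  rw [Matrix.sub_mulVec, dotProduct_sub] at h2
  rw [dotProduct_vec, real_inner_self_eq_norm_sq] at h1
  linarith

lemma Assumptions.dim_pos (hA : Assumptions M lam kap R S sig0 eps) : 0 < d := by
  obtain ⟨Sg, h, hpsd, ⟨i, _⟩, _⟩ := hA.second_moment
  exact Fin.pos i

lemma Assumptions.sig0_le_one (hA : Assumptions M lam kap R S sig0 eps) : sig0 ≤ 1 := by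
  have := hA.dist_prob
  let u : Vec d := EuclideanSpace.single ⟨0, hA.dim_pos⟩ 1
  have hu : ‖u‖ = 1 := by simp [u]
  have h1 := hA.sq_mul_le_inner_meanOuter u
  have h2 := real_inner_le_norm (meanOuter M.dist) (outer u)
  rw [norm_outer, hu] at h2
  rw [hu] at h1
  have h3 := norm_meanOuter_le hA.ae_norm_le
  nlinarith [hA.sig0_pos]

end SecondMoment

/-! ### Data collected by exploration -/

section Exploration

variable {Ω : Type*} {d K : ℕ} {M : Model d K} {N : Noise Ω d K} {π : Schedule Ω K}

lemma pointer_two (tau : ℝ) (ω : Ω) : pointer (K := K) N tau 2 ω = 0 := by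
  simp [pointer, PureExploration, Arrived]

/-- The job arriving in round `j` is sent to server `k` in an exploration round, the next one. -/
def Explores (N : Noise Ω d K) (tau : ℝ) (k : Fin K) (j : ℕ) (ω : Ω) : Prop :=
  N.arrive j ω = true ∧ ((((j + 1 : ℕ) : ℝ) ≤ tau ∧ pointer (K := K) N tau (j + 1) ω = k) ∨
    (tau < ((j + 1 : ℕ) : ℝ) ∧ N.coin j ω = true ∧ N.pick j ω = k))

open Classical in
/-- The centred sum of the matrices `x xᵀ` over the exploration data of server `k`. -/
noncomputable def explorationSum (M : Model d K) (N : Noise Ω d K) (tau : ℝ) (k : Fin K) (t : ℕ)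
    (ω : Ω) : EuclideanSpace ℝ (Fin d × Fin d) :=
  ∑ j ∈ Finset.range t, if Explores N tau k (j + 1) ω then
    outer (N.feature (j + 1) ω) - meanOuter M.dist else 0

open Classical in
/-- The number of exploration data of server `k`. -/
noncomputable def explorationCount (N : Noise Ω d K) (tau : ℝ) (k : Fin K) (t : ℕ) (ω : Ω) : ℝ :=
  ∑ j ∈ Finset.range t, if Explores N tau k (j + 1) ω then 1 else 0

lemma explorationCount_nonneg (tau : ℝ) (k : Fin K) (t : ℕ) (ω : Ω) :
    0 ≤ explorationCount N tau k t ω :=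
  Finset.sum_nonneg fun _ _ => by split_ifs <;> norm_num

lemma explorationCount_mono (tau : ℝ) (k : Fin K) {s t : ℕ} (h : s ≤ t) (ω : Ω) :
    explorationCount N tau k s ω ≤ explorationCount N tau k t ω :=
  Finset.sum_le_sum_of_subset_of_nonneg (Finset.range_mono h) fun _ _ _ => by
    split_ifs <;> norm_num

section Deterministic

variable [m : MeasurableSpace Ω] {ℱ : Filtration ℕ m} {kap S lam0 delta tau : ℝ}
  {est : ℕ → Fin K → Ω → Vec d}

lemma Explores.mem_rounds (hπ : IsCQB M N π ℱ kap S lam0 delta tau est) {k : Fin K} {j t : ℕ}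
    (hj : 1 ≤ j) (hjt : j + 1 ≤ t) {ω : Ω} (h : Explores N tau k j ω) :
    j + 1 ∈ rounds M N π t k ω ∧ served M N π (j + 1) ω = N.feature j ω := by
  have harr : Arrived N (j + 1) ω := ⟨by omega, by simpa using h.1⟩
  have hq : (queue M N π (j + 1) ω).Nonempty := ⟨_, harr.mem_queue⟩
  have key : π.job (j + 1) ω = j ∧ π.server (j + 1) ω = k := by
    rcases h.2 with ⟨h1, h2⟩ | ⟨h1, h2, h3⟩
    · have := hπ.pure (j + 1) (by omega) ω ⟨h1, harr⟩
      exact ⟨by simpa using this.1, Fin.ext (this.2.trans h2)⟩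
    · have := hπ.explore (j + 1) (by omega) ω ⟨h1, by simpa using h2, harr⟩
      exact ⟨by simpa using this.1, by simpa [h3] using this.2⟩
  refine ⟨CQB.mem_rounds.2 ⟨⟨by omega, hjt⟩, hq, key.2⟩, ?_⟩
  rw [served, if_pos hq, chosen, key.1]

/-- The design of server `k` dominates that of its exploration data. -/
lemma designForm_ge_of_exploration {lam R sig0 eps : ℝ}
    (hA : Assumptions M lam kap R S sig0 eps) (hlam0 : 0 < lam0)
    (hπ : IsCQB M N π ℱ kap S lam0 delta tau est) {k : Fin K} {t s : ℕ} (hts : t + 1 ≤ s) {ω : Ω}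
    (hsum : ‖explorationSum M N tau k t ω‖ ≤ sig0 ^ 2 / 2 * explorationCount N tau k t ω)
    (u : Vec d) : sig0 ^ 2 / 2 * explorationCount N tau k t ω * ‖u‖ ^ 2 ≤
      designForm (kap * lam0) (rounds M N π s k ω) (fun i => served M N π i ω) u := by
  classical
  have hk := hA.kap_pos
  have h1 : inner ℝ (explorationSum M N tau k t ω) (outer u) =
      (∑ j ∈ Finset.range t, if Explores N tau k (j + 1) ω then
        (inner ℝ (N.feature (j + 1) ω) u) ^ 2 else 0) -
      explorationCount N tau k t ω * inner ℝ (meanOuter M.dist) (outer u) := by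
    rw [explorationSum, explorationCount, sum_inner, Finset.sum_mul, ← Finset.sum_sub_distrib]
    refine Finset.sum_congr rfl fun j _ => ?_
    split_ifs
    · rw [inner_sub_left, inner_outer, one_mul]
    · simp
  have h2 : (∑ j ∈ Finset.range t, if Explores N tau k (j + 1) ω then
      (inner ℝ (N.feature (j + 1) ω) u) ^ 2 else 0) ≤
      designForm (kap * lam0) (rounds M N π s k ω) (fun i => served M N π i ω) u := by
    rw [designForm, ← Finset.sum_filter]
    refine le_trans ?_ (le_add_of_nonneg_left (by positivity))
    have hinj : Function.Injective fun j : ℕ => j + 2 := fun a b h => by simpa using h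
    calc _ = ∑ j ∈ (Finset.range t).filter fun j => Explores N tau k (j + 1) ω,
          (inner ℝ (served M N π (j + 2) ω) u) ^ 2 := by
          refine Finset.sum_congr rfl fun j hj => ?_
          rw [Finset.mem_filter, Finset.mem_range] at hj
          rw [(hj.2.mem_rounds hπ (by omega) (t := s) (by omega)).2]
      _ = ∑ i ∈ ((Finset.range t).filter fun j => Explores N tau k (j + 1) ω).map
          ⟨fun j => j + 2, hinj⟩, (inner ℝ (served M N π i ω) u) ^ 2 := by
          rw [Finset.sum_map]; rfl
      _ ≤ _ := by
          refine Finset.sum_le_sum_of_subset_of_nonneg ?_ fun _ _ _ => sq_nonneg _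
          intro i hi
          rw [Finset.mem_map] at hi
          obtain ⟨j, hj, rfl⟩ := hi
          rw [Finset.mem_filter, Finset.mem_range] at hj
          exact (hj.2.mem_rounds hπ (by omega) (t := s) (by omega)).1
  have h3 := hA.sq_mul_le_inner_meanOuter u
  have h4 := (abs_le.1 (abs_real_inner_le_norm (explorationSum M N tau k t ω) (outer u))).1
  rw [norm_outer] at h4
  have h5 := mul_le_mul_of_nonneg_right hsum (sq_nonneg ‖u‖)
  have h6 := mul_le_mul_of_nonneg_left h3 (explorationCount_nonneg (N := N) tau k t ω)
  nlinarith

end Deterministic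

open Classical in
/-- During pure exploration the servers are used in turn. -/
lemma pointer_eq_and_explorationCount_eq (tau : ℝ) (k : Fin K) (ω : Ω) {n : ℕ}
    (hn : ((n + 1 : ℕ) : ℝ) ≤ tau) :
    pointer (K := K) N tau (n + 2) ω =
      ((Finset.range n).filter fun j => N.arrive (j + 1) ω = true).card % K ∧
    explorationCount N tau k n ω = Nat.count (fun i => i ≡ k [MOD K])
      ((Finset.range n).filter fun j => N.arrive (j + 1) ω = true).card := by
  have hkK : (k : ℕ) % K = k := Nat.mod_eq_of_lt k.2
  induction n with
  | zero => simp [pointer_two, explorationCount]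
  | succ n ih =>
    have hn' : ((n + 1 : ℕ) : ℝ) ≤ tau := le_trans (by exact_mod_cast Nat.le_succ _) hn
    obtain ⟨ih1, ih2⟩ := ih hn'
    have hpure : PureExploration N tau (n + 2) ω ↔ N.arrive (n + 1) ω = true := by
      constructor
      · intro h; simpa using h.2.2
      · intro h; exact ⟨hn, by omega, by simpa using h⟩
    have hexp : Explores N tau k (n + 1) ω ↔
        N.arrive (n + 1) ω = true ∧ pointer (K := K) N tau (n + 2) ω = k := by
      unfold Explores
      constructor
      · rintro ⟨h1, ⟨_, h2⟩ | ⟨h2, _⟩⟩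
        · exact ⟨h1, h2⟩
        · exact absurd hn (not_le.2 h2)
      · rintro ⟨h1, h2⟩
        exact ⟨h1, Or.inl ⟨hn, h2⟩⟩
    rw [Finset.range_add_one, Finset.filter_insert, explorationCount, Finset.sum_range_succ,
      ← explorationCount, pointer]
    by_cases ha : N.arrive (n + 1) ω = true
    · rw [if_pos (hpure.2 ha), if_pos ha, Finset.card_insert_of_notMem (by simp), ih1, ih2,
        Nat.count_succ]
      refine ⟨by rw [Nat.mod_add_mod], ?_⟩
      have : Explores N tau k (n + 1) ω ↔
          ((Finset.range n).filter fun j => N.arrive (j + 1) ω = true).card ≡ k [MOD K] := by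
        rw [hexp, ih1, Nat.ModEq, hkK]
        exact ⟨fun h => h.2, fun h => ⟨ha, h⟩⟩
      push_cast
      simp only [this]
    · rw [if_neg (fun h => ha (hpure.1 h)), if_neg ha, if_neg (fun h => ha (hexp.1 h).1), ih1, ih2]
      simp

lemma explorationCount_ge_of_arrivals (hK : 0 < K) (tau : ℝ) (k : Fin K) (ω : Ω) {n : ℕ}
    (hn : ((n + 1 : ℕ) : ℝ) ≤ tau) :
    (((Finset.range n).filter fun j => N.arrive (j + 1) ω = true).card : ℝ) / K - 1 ≤
      explorationCount N tau k n ω := by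
  classical
  rw [(pointer_eq_and_explorationCount_eq tau k ω hn).2, Nat.count_modEq_card _ hK]
  set c := ((Finset.range n).filter fun j => N.arrive (j + 1) ω = true).card
  have h1 : (c : ℝ) / K < (c / K : ℕ) + 1 := by
    rw [div_lt_iff₀ (by exact_mod_cast hK)]
    have := Nat.lt_mul_div_succ c hK
    have h2 : c < (c / K + 1) * K := by rw [mul_comm]; exact this
    exact_mod_cast h2
  push_cast
  have h3 : (0 : ℝ) ≤ ((if (k : ℕ) % K < c % K then 1 else 0 : ℕ) : ℝ) := Nat.cast_nonneg _
  push_cast at h3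
  linarith

end Exploration

section ExplorationLaw

variable {d K : ℕ} {ν : Measure (Vec d)} [IsProbabilityMeasure ν] {lam p : ℝ}

/-- A bound that holds after integration over the context alone holds for the law of a round. -/
lemma lintegral_roundLaw_le_of_feature (hK : 0 < K) (hl0 : 0 ≤ lam)
    (hl1 : lam ≤ 1) (hp0 : 0 ≤ p) (hp1 : p ≤ 1) {f : RoundSpace d K → ENNReal}
    (hf : Measurable f) {B : ENNReal} (h : ∀ a c k u, ∫⁻ x, f (a, x, c, k, u) ∂ν ≤ B) :
    ∫⁻ z, f z ∂(roundLaw K ν lam p) ≤ B := by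
  have := isProbabilityMeasure_bern hl0 hl1
  have := isProbabilityMeasure_bern hp0 hp1
  have := isProbabilityMeasure_uniformOn_univ_fin hK
  unfold roundLaw
  rw [lintegral_prod _ hf.aemeasurable]
  have hin : ∀ a, ∫⁻ y, f (a, y) ∂(ν.prod ((bern p).prod
      ((uniformOn (Set.univ : Set (Fin K))).prod (volume.restrict (Set.Icc (0 : ℝ) 1))))) ≤ B := by
    intro a
    rw [lintegral_prod_symm _ (by fun_prop)]
    calc _ ≤ ∫⁻ _, B ∂((bern p).prod ((uniformOn (Set.univ : Set (Fin K))).prod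
          (volume.restrict (Set.Icc (0 : ℝ) 1)))) :=
          lintegral_mono fun y => h a y.1 y.2.1 y.2.2
      _ = B := by rw [lintegral_const, measure_univ, mul_one]
  calc _ ≤ ∫⁻ _, B ∂(bern lam) := lintegral_mono hin
    _ = B := by rw [lintegral_const, measure_univ, mul_one]

lemma bern_true (q : ℝ) : bern q {true} = ENNReal.ofReal q := by
  simp [bern]

lemma roundLaw_arrive (hK : 0 < K) (hl0 : 0 ≤ lam) (hl1 : lam ≤ 1) (hp0 : 0 ≤ p) (hp1 : p ≤ 1) :
    roundLaw K ν lam p {z | z.1 = true} = ENNReal.ofReal lam := by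
  have := isProbabilityMeasure_bern hl0 hl1
  have := isProbabilityMeasure_bern hp0 hp1
  have := isProbabilityMeasure_uniformOn_univ_fin hK
  have e : {z : RoundSpace d K | z.1 = true} = ({true} : Set Bool) ×ˢ Set.univ := by
    ext z; simp
  rw [e, roundLaw, Measure.prod_prod, measure_univ, mul_one, bern_true]

lemma roundLaw_explore (hK : 0 < K) (hl0 : 0 ≤ lam) (hl1 : lam ≤ 1) (hp0 : 0 ≤ p) (hp1 : p ≤ 1)
    (k : Fin K) :
    roundLaw K ν lam p {z | z.1 = true ∧ z.2.2.1 = true ∧ z.2.2.2.1 = k} =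
      ENNReal.ofReal (lam * p / K) := by
  have := isProbabilityMeasure_bern hl0 hl1
  have := isProbabilityMeasure_bern hp0 hp1
  have := isProbabilityMeasure_uniformOn_univ_fin hK
  have e : {z : RoundSpace d K | z.1 = true ∧ z.2.2.1 = true ∧ z.2.2.2.1 = k} =
      ({true} : Set Bool) ×ˢ ((Set.univ : Set (Vec d)) ×ˢ (({true} : Set Bool) ×ˢ
        (({k} : Set (Fin K)) ×ˢ (Set.univ : Set ℝ)))) := by
    ext z; simp
  have hK' : (0 : ℝ) < K := by exact_mod_cast hK
  rw [e, roundLaw, Measure.prod_prod, Measure.prod_prod, Measure.prod_prod, Measure.prod_prod,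
    measure_univ, measure_univ, mul_one, one_mul, bern_true, bern_true, uniformOn_univ,
    Measure.count_singleton, Fintype.card_fin, mul_div_assoc,
    ENNReal.ofReal_mul hl0, ENNReal.ofReal_div_of_pos hK', ENNReal.ofReal_natCast,
    one_div, div_eq_mul_inv]

end ExplorationLaw

section ExplorationTail

variable {Ω : Type*} {d K : ℕ} {M : Model d K} {N : Noise Ω d K}

/-- The outcomes of a round that lead to exploration of server `k` in the next round; `b` tells
whether the next round belongs to the pure-exploration phase, and the first component whether the
round-robin pointer is then at `k`. -/
def exploreSet (k : Fin K) (b : Prop) : Set (Bool × RoundSpace d K) :=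
  {y | y.2.1 = true ∧ ((b ∧ y.1 = true) ∨ (¬ b ∧ y.2.2.2.1 = true ∧ y.2.2.2.2.1 = k))}

lemma measurableSet_exploreSet (k : Fin K) (b : Prop) :
    MeasurableSet (exploreSet (d := d) k b) := by
  unfold exploreSet
  have h1 : MeasurableSet {y : Bool × RoundSpace d K | y.2.1 = true} :=
    (measurable_fst.comp measurable_snd) (measurableSet_singleton true)
  have h2 : MeasurableSet {y : Bool × RoundSpace d K | y.1 = true} :=
    measurable_fst (measurableSet_singleton true)
  have h3 : MeasurableSet {y : Bool × RoundSpace d K | y.2.2.2.1 = true} :=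
    (show Measurable fun y : Bool × RoundSpace d K => y.2.2.2.1 by fun_prop)
      (measurableSet_singleton true)
  have h4 : MeasurableSet {y : Bool × RoundSpace d K | y.2.2.2.2.1 = k} :=
    (show Measurable fun y : Bool × RoundSpace d K => y.2.2.2.2.1 by fun_prop)
      (measurableSet_singleton k)
  exact h1.inter (((MeasurableSet.const b).inter h2).union
    ((MeasurableSet.const (¬ b)).inter (h3.inter h4)))

open Classical in
lemma explores_iff (tau : ℝ) (k : Fin K) (t : ℕ) (ω : Ω) : Explores N tau k (t + 1) ω ↔
    (decide (pointer (K := K) N tau (t + 2) ω = k), N.round (t + 1) ω) ∈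
      exploreSet k (((t + 2 : ℕ) : ℝ) ≤ tau) := by
  have e : t + 1 + 1 = t + 2 := rfl
  rw [Explores, e]
  simp only [exploreSet, Noise.round, Set.mem_ofPred_eq, decide_eq_true_eq, not_le]

variable [m : MeasurableSpace Ω] {P : Measure Ω} {ℱ : Filtration ℕ m} {lam p kap R S sig0 eps : ℝ}

lemma measurable_pointer {ν : Measure (Vec d)} (hN : IsNoise P ℱ ν lam p N) (tau : ℝ) (t : ℕ) :
    Measurable[ℱ t] (pointer (K := K) N tau (t + 2)) := by
  classical
  induction t with
  | zero =>
    have : pointer (K := K) N tau (0 + 2) = fun _ => 0 := funext fun ω => pointer_two tau ω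
    rw [this]; exact measurable_const
  | succ t ih =>
    have ih' := ih.mono (ℱ.mono (Nat.le_succ t)) le_rfl
    have e : pointer (K := K) N tau (t + 1 + 2) = fun ω =>
        if PureExploration N tau (t + 2) ω then (pointer (K := K) N tau (t + 2) ω + 1) % K
        else pointer (K := K) N tau (t + 2) ω := by
      ext ω; rfl
    rw [e]
    refine Measurable.ite ?_ ((measurable_of_countable fun n : ℕ => (n + 1) % K).comp ih') ih'
    by_cases h : ((t + 2 : ℕ) : ℝ) ≤ tau
    · have : {ω | PureExploration N tau (t + 2) ω} = {ω | N.arrive (t + 1) ω = true} := by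
        ext ω
        simp only [Set.mem_ofPred_eq, PureExploration, Arrived]
        exact ⟨fun h' => h'.2.2, fun h' => ⟨h, by omega, h'⟩⟩
      rw [this]
      exact hN.measurable_arrive (by omega) le_rfl (measurableSet_singleton true)
    · have : {ω | PureExploration N tau (t + 2) ω} = ∅ := by
        ext ω
        simp only [Set.mem_ofPred_eq, PureExploration, Set.mem_empty_iff_false, iff_false]
        exact fun h' => h h'.1
      rw [this]
      exact @MeasurableSet.empty _ (ℱ (t + 1))

variable [IsProbabilityMeasure P]

open Classical in
/-- The exponential supermartingale of the centred exploration data. Each datum multiplies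
`E cosh (s ‖·‖)` by at most `exp (2 s²)`, and the counter of the data compensates for it. -/
lemma lintegral_exp_explorationSum_le (hA : Assumptions M lam kap R S sig0 eps) (hK : 0 < K)
    (hl0 : 0 ≤ lam) (hl1 : lam ≤ 1) (hp0 : 0 ≤ p) (hp1 : p ≤ 1)
    (hN : IsNoise P ℱ M.dist lam p N) (tau : ℝ) (k : Fin K) (s : ℝ) (t : ℕ) :
    (Measurable[ℱ t] (explorationSum M N tau k t) ∧
      Measurable[ℱ t] (explorationCount N tau k t)) ∧
    ∫⁻ ω, ENNReal.ofReal (Real.cosh (s * ‖explorationSum M N tau k t ω‖) *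
      Real.exp (-(2 * s ^ 2 * explorationCount N tau k t ω))) ∂P ≤ 1 := by
  have := hA.dist_prob
  induction t with
  | zero =>
    have h1 : explorationSum M N tau k 0 = fun _ => 0 := by ext1 ω; simp [explorationSum]
    have h2 : explorationCount N tau k 0 = fun _ => 0 := by ext1 ω; simp [explorationCount]
    rw [h1, h2]
    exact ⟨⟨measurable_const, measurable_const⟩, by simp⟩
  | succ t ih =>
    obtain ⟨⟨ih1, ih2⟩, ih3⟩ := ih
    have hle := ℱ.mono (Nat.le_succ t)
    obtain ⟨χ, hχdef⟩ : ∃ χ : Ω → Bool,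
        χ = fun ω => decide (pointer (K := K) N tau (t + 2) ω = k) := ⟨_, rfl⟩
    have hχ : Measurable[ℱ t] χ := by
      rw [hχdef]
      exact (measurable_of_countable fun n : ℕ => decide (n = k)).comp (measurable_pointer hN tau t)
    set b : Prop := ((t + 2 : ℕ) : ℝ) ≤ tau with hb
    have hE : MeasurableSet (exploreSet (d := d) k b) := measurableSet_exploreSet k b
    obtain ⟨incS, hSdef⟩ : ∃ f : Bool × RoundSpace d K → EuclideanSpace ℝ (Fin d × Fin d),
      f = (exploreSet k b).indicator fun y => outer y.2.2.1 - meanOuter M.dist := ⟨_, rfl⟩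
    obtain ⟨incN, hNdef⟩ : ∃ f : Bool × RoundSpace d K → ℝ,
      f = (exploreSet k b).indicator fun _ => 1 := ⟨_, rfl⟩
    have hincS : Measurable incS := by
      rw [hSdef]
      refine Measurable.indicator ?_ hE
      have := continuous_outer.measurable (α := Vec d)
      fun_prop
    have hincN : Measurable incN := by
      rw [hNdef]; exact measurable_const.indicator hE
    have eS : explorationSum M N tau k (t + 1) = fun ω =>
        explorationSum M N tau k t ω + incS (χ ω, N.round (t + 1) ω) := by
      ext1 ω
      rw [explorationSum, Finset.sum_range_succ, ← explorationSum]
      simp only [explores_iff, hSdef, Set.indicator, hχdef]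
      rfl
    have eN : explorationCount N tau k (t + 1) = fun ω =>
        explorationCount N tau k t ω + incN (χ ω, N.round (t + 1) ω) := by
      ext1 ω
      rw [explorationCount, Finset.sum_range_succ, ← explorationCount]
      simp only [explores_iff, hNdef, Set.indicator, hχdef]
      rfl
    have hχR : Measurable[ℱ (t + 1)] fun ω => (χ ω, N.round (t + 1) ω) :=
      (hχ.mono hle le_rfl).prodMk (hN.adapted t)
    refine ⟨⟨?_, ?_⟩, ?_⟩
    · rw [eS]; exact (ih1.mono hle le_rfl).add (hincS.comp hχR)
    · rw [eN]; exact (ih2.mono hle le_rfl).add (hincN.comp hχR)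
    have hX : Measurable[ℱ t] fun ω => (explorationSum M N tau k t ω,
      explorationCount N tau k t ω, χ ω) := ih1.prodMk (ih2.prodMk hχ)
    let g : (EuclideanSpace ℝ (Fin d × Fin d) × ℝ × Bool) × RoundSpace d K → ENNReal := fun y =>
      ENNReal.ofReal (Real.cosh (s * ‖y.1.1 + incS (y.1.2.2, y.2)‖) *
        Real.exp (-(2 * s ^ 2 * (y.1.2.1 + incN (y.1.2.2, y.2)))))
    have hg : Measurable g := by
      simp only [g]
      have := Real.measurable_cosh
      fun_prop
    rw [eS, eN]
    have hstep := hN.lintegral_round t hX hg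
    simp only [g] at hstep
    refine (le_of_eq hstep).trans (le_trans (lintegral_mono fun ω => ?_) ih3)
    have hgω : Measurable fun z => g ((explorationSum M N tau k t ω,
      explorationCount N tau k t ω, χ ω), z) := hg.comp measurable_prodMk_left
    refine lintegral_roundLaw_le_of_feature hK hl0 hl1 hp0 hp1 hgω fun a c k' u => ?_
    simp only [g]
    by_cases hmem : a = true ∧ ((b ∧ χ ω = true) ∨ (¬ b ∧ c = true ∧ k' = k))
    · have e1 : ∀ x, incS (χ ω, a, x, c, k', u) = outer x - meanOuter M.dist := fun x =>
        hSdef ▸ Set.indicator_of_mem (show (χ ω, a, x, c, k', u) ∈ exploreSet k b from hmem) _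
      have e2 : ∀ x, incN (χ ω, a, x, c, k', u) = 1 := fun x =>
        hNdef ▸ Set.indicator_of_mem (show (χ ω, a, x, c, k', u) ∈ exploreSet k b from hmem) _
      simp only [e1, e2]
      have h1 := lintegral_cosh_norm_add_le hA.ae_norm_le s (explorationSum M N tau k t ω)
      have h2 : ∀ x, ENNReal.ofReal (Real.cosh (s * ‖explorationSum M N tau k t ω +
          (outer x - meanOuter M.dist)‖) * Real.exp (-(2 * s ^ 2 *
            (explorationCount N tau k t ω + 1)))) =
          ENNReal.ofReal (Real.cosh (s * ‖explorationSum M N tau k t ω +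
          (outer x - meanOuter M.dist)‖)) * ENNReal.ofReal (Real.exp (-(2 * s ^ 2 *
            (explorationCount N tau k t ω + 1)))) := fun x =>
        ENNReal.ofReal_mul (Real.cosh_pos _).le
      rw [lintegral_congr h2, lintegral_mul_const' _ _ ENNReal.ofReal_ne_top]
      refine (mul_le_mul_left h1 _).trans ?_
      rw [← ENNReal.ofReal_mul (by have := Real.cosh_pos (s * ‖explorationSum M N tau k t ω‖);
                                   positivity), mul_assoc, ← Real.exp_add]
      apply ENNReal.ofReal_le_ofReal
      apply le_of_eq
      congr 2
      ring
    · have e1 : ∀ x, incS (χ ω, a, x, c, k', u) = 0 := fun x =>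
        hSdef ▸ Set.indicator_of_notMem (show (χ ω, a, x, c, k', u) ∉ exploreSet k b from hmem) _
      have e2 : ∀ x, incN (χ ω, a, x, c, k', u) = 0 := fun x =>
        hNdef ▸ Set.indicator_of_notMem (show (χ ω, a, x, c, k', u) ∉ exploreSet k b from hmem) _
      simp only [e1, e2, add_zero, lintegral_const, measure_univ, mul_one, le_refl]

/-- Concentration of the exploration data at a fixed time, with a rate that does not depend on the
dimension. -/
lemma measure_explorationSum_gt_le (hA : Assumptions M lam kap R S sig0 eps) (hK : 0 < K)
    (hl0 : 0 ≤ lam) (hl1 : lam ≤ 1) (hp0 : 0 ≤ p) (hp1 : p ≤ 1)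
    (hN : IsNoise P ℱ M.dist lam p N) (tau : ℝ) (k : Fin K) (t : ℕ) (n : ℝ) :
    P {ω | n ≤ explorationCount N tau k t ω ∧ sig0 ^ 2 / 2 * explorationCount N tau k t ω <
      ‖explorationSum M N tau k t ω‖} ≤ ENNReal.ofReal (2 * Real.exp (-(sig0 ^ 4 * n / 32))) := by
  have hs0 := hA.sig0_pos
  obtain ⟨⟨h1, h2⟩, h3⟩ := lintegral_exp_explorationSum_le hA hK hl0 hl1 hp0 hp1 hN tau k
    (sig0 ^ 2 / 8) t
  have h1' := h1.mono (ℱ.le t) le_rfl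
  have h2' := h2.mono (ℱ.le t) le_rfl
  have hmeas : Measurable fun ω => ENNReal.ofReal
      (Real.cosh (sig0 ^ 2 / 8 * ‖explorationSum M N tau k t ω‖) *
      Real.exp (-(2 * (sig0 ^ 2 / 8) ^ 2 * explorationCount N tau k t ω))) := by
    have := Real.measurable_cosh
    fun_prop
  have hpos : 0 < 1 / 2 * Real.exp (sig0 ^ 4 * n / 32) := by positivity
  have hmk := meas_ge_le_lintegral_div hmeas.aemeasurable (μ := P)
    (ε := ENNReal.ofReal (1 / 2 * Real.exp (sig0 ^ 4 * n / 32))) (by simpa using hpos) ENNReal.ofReal_ne_top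
  refine (measure_mono ?_).trans (hmk.trans ((ENNReal.div_le_div_right h3 _).trans ?_))
  · rintro ω ⟨hn, hlt⟩
    apply ENNReal.ofReal_le_ofReal
    set c := explorationCount N tau k t ω
    set v := ‖explorationSum M N tau k t ω‖
    have hc : 1 / 2 * Real.exp (sig0 ^ 2 / 8 * v) ≤ Real.cosh (sig0 ^ 2 / 8 * v) := by
      rw [Real.cosh_eq]
      have := Real.exp_pos (-(sig0 ^ 2 / 8 * v))
      linarith
    calc 1 / 2 * Real.exp (sig0 ^ 4 * n / 32) ≤ 1 / 2 * (Real.exp (sig0 ^ 2 / 8 * v) *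
          Real.exp (-(2 * (sig0 ^ 2 / 8) ^ 2 * c))) := by
          rw [← Real.exp_add]
          gcongr
          have h5 := mul_le_mul_of_nonneg_left hlt.le (by positivity : 0 ≤ sig0 ^ 2 / 8)
          have h6 := mul_le_mul_of_nonneg_left hn (by positivity : 0 ≤ sig0 ^ 4 / 32)
          nlinarith
      _ = 1 / 2 * Real.exp (sig0 ^ 2 / 8 * v) * Real.exp (-(2 * (sig0 ^ 2 / 8) ^ 2 * c)) := by
          ring
      _ ≤ _ := by gcongr
  · rw [← ENNReal.ofReal_one, ← ENNReal.ofReal_div_of_pos hpos]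
    apply ENNReal.ofReal_le_ofReal
    rw [Real.exp_neg]
    apply le_of_eq
    field_simp

/-- Lower tail of the number of exploration data of the pure-exploration phase. -/
lemma measure_explorationCount_pure_lt_le {ν : Measure (Vec d)} [IsProbabilityMeasure ν]
    (hK : 0 < K) (hl0 : 0 ≤ lam) (hl1 : lam ≤ 1) (hp0 : 0 ≤ p) (hp1 : p ≤ 1)
    (hN : IsNoise P ℱ ν lam p N) {tau : ℝ} {n : ℕ} (hn : ((n + 1 : ℕ) : ℝ) ≤ tau) :
    P {ω | ∃ k : Fin K, explorationCount N tau k n ω < lam * n / (2 * K) - 1} ≤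
      ENNReal.ofReal (Real.exp (-(lam * n / 8))) := by
  classical
  have hB : MeasurableSet {z : RoundSpace d K | z.1 = true} :=
    measurable_fst (measurableSet_singleton true)
  have h := hN.measure_count_le hB hl0 (roundLaw_arrive hK hl0 hl1 hp0 hp1).ge 0 n
  refine (measure_mono ?_).trans h
  rintro ω ⟨k, hk⟩
  have h1 := explorationCount_ge_of_arrivals (N := N) hK tau k ω hn
  have hK' : (0 : ℝ) < K := by exact_mod_cast hK
  have h2 : (((Finset.range n).filter fun j => N.arrive (j + 1) ω = true).card : ℝ) =
      ∑ j ∈ Finset.range n, {z : RoundSpace d K | z.1 = true}.indicator (fun _ => (1 : ℝ))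
        (N.round (0 + j + 1) ω) := by
    rw [Finset.card_filter]
    push_cast
    refine Finset.sum_congr rfl fun j _ => ?_
    simp [Set.indicator, Noise.round]
  simp only [Set.mem_ofPred_eq]
  rw [← h2]
  have h3 : (((Finset.range n).filter fun j => N.arrive (j + 1) ω = true).card : ℝ) / K <
      lam * n / (2 * K) := by linarith
  rw [div_lt_div_iff₀ hK' (by positivity)] at h3
  nlinarith

/-- Lower tail of the number of data of the `ε`-exploration of server `k`. -/
lemma measure_explorationCount_eps_le {ν : Measure (Vec d)} [IsProbabilityMeasure ν]
    (hK : 0 < K) (hl0 : 0 ≤ lam) (hl1 : lam ≤ 1) (hp0 : 0 ≤ p) (hp1 : p ≤ 1)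
    (hN : IsNoise P ℱ ν lam p N) {tau : ℝ} {a : ℕ} (ha : tau < (a + 2 : ℕ)) (n : ℕ) (k : Fin K) :
    P {ω | explorationCount N tau k (a + n) ω ≤ lam * p / K * n / 2} ≤
      ENNReal.ofReal (Real.exp (-(lam * p / K * n / 8))) := by
  classical
  have hB : MeasurableSet {z : RoundSpace d K | z.1 = true ∧ z.2.2.1 = true ∧ z.2.2.2.1 = k} := by
    have h1 : MeasurableSet {y : RoundSpace d K | y.1 = true} :=
      measurable_fst (measurableSet_singleton true)
    have h3 : MeasurableSet {y : RoundSpace d K | y.2.2.1 = true} :=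
      (show Measurable fun y : RoundSpace d K => y.2.2.1 by fun_prop)
        (measurableSet_singleton true)
    have h4 : MeasurableSet {y : RoundSpace d K | y.2.2.2.1 = k} :=
      (show Measurable fun y : RoundSpace d K => y.2.2.2.1 by fun_prop)
        (measurableSet_singleton k)
    exact h1.inter (h3.inter h4)
  have h := hN.measure_count_le hB (by positivity) (roundLaw_explore hK hl0 hl1 hp0 hp1 k).ge a n
  refine (measure_mono ?_).trans h
  intro ω (hω : explorationCount N tau k (a + n) ω ≤ lam * p / K * n / 2)
  refine le_trans ?_ hω
  rw [explorationCount, Finset.sum_range_add]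
  refine le_trans ?_ (le_add_of_nonneg_left (Finset.sum_nonneg fun _ _ => by
    split_ifs <;> norm_num))
  refine Finset.sum_le_sum fun j _ => ?_
  by_cases hz : N.round (a + j + 1) ω ∈
      {z : RoundSpace d K | z.1 = true ∧ z.2.2.1 = true ∧ z.2.2.2.1 = k}
  · have hex : Explores N tau k (a + j + 1) ω := by
      refine ⟨hz.1, Or.inr ⟨ha.trans_le ?_, hz.2.1, hz.2.2⟩⟩
      exact_mod_cast (by omega : a + 2 ≤ a + j + 1 + 1)
    rw [Set.indicator_of_mem hz, if_pos hex]
  · rw [Set.indicator_of_notMem hz]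
    split_ifs <;> norm_num

end ExplorationTail

/-! ### Exponential drift of the queue length -/

/-- With service slack `e / 2` the factor `exp (e / 8)` per job loses `e² / 64` on average, even
after paying for a possible exploration bit of probability `p ≤ e / 64`. -/
lemma drift_of_rate {e l p r : ℝ} (he0 : 0 < e) (he1 : e ≤ 1) (hl0 : 0 ≤ l) (hp0 : 0 ≤ p)
    (hp : p ≤ e / 64) (hr : l + e / 2 ≤ r) (hr1 : r ≤ 1) :
    (1 + l * (Real.exp (e / 8) - 1)) * (1 + e * p) * (1 - r * (1 - Real.exp (-(e / 8)))) ≤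
      1 - e ^ 2 / 64 := by
  set s := e / 8 with hs
  have hs0 : 0 < s := by positivity
  have hs1 : s ≤ 1 / 8 := by linarith
  have h1 : Real.exp s ≤ 1 + s + s ^ 2 := by
    have := Real.abs_exp_sub_one_sub_id_le (x := s) (by rw [abs_of_pos hs0]; linarith)
    have := (abs_le.1 this).2
    linarith
  have h2 : Real.exp (-s) ≤ 1 - s + s ^ 2 := by
    have := Real.abs_exp_sub_one_sub_id_le (x := -s) (by rw [abs_neg, abs_of_pos hs0]; linarith)
    have := (abs_le.1 this).2
    linarith [neg_sq s]
  have hpos : 0 ≤ s - s ^ 2 := by nlinarith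
  have h3 : 1 - r * (1 - Real.exp (-s)) ≤ 1 - (l + e / 2) * (s - s ^ 2) := by
    have : (l + e / 2) * (s - s ^ 2) ≤ r * (1 - Real.exp (-s)) := by
      apply mul_le_mul hr (by linarith) hpos (by linarith)
    linarith
  have h4 : 1 + l * (Real.exp s - 1) ≤ 1 + l * (s + s ^ 2) := by
    have := mul_le_mul_of_nonneg_left h1 hl0
    linarith
  have h5 : 0 ≤ 1 - (l + e / 2) * (s - s ^ 2) := by nlinarith
  have hone := Real.add_one_le_exp s
  have h6 : (1 + l * (Real.exp s - 1)) * (1 - r * (1 - Real.exp (-s))) ≤ 1 - e ^ 2 / 32 := by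
    calc _ ≤ (1 + l * (s + s ^ 2)) * (1 - (l + e / 2) * (s - s ^ 2)) :=
          (mul_le_mul_of_nonneg_left h3 (by nlinarith)).trans
            (mul_le_mul_of_nonneg_right h4 h5)
      _ ≤ 1 - e / 2 * s + 2 * s ^ 2 := by
          have h7 : 0 ≤ l * (s + s ^ 2) * ((l + e / 2) * (s - s ^ 2)) := by positivity
          nlinarith [mul_nonneg hs0.le hs0.le]
      _ = 1 - e ^ 2 / 32 := by rw [hs]; ring
  have h8 : 1 + e * p ≤ 1 + e ^ 2 / 64 := by nlinarith
  calc _ = (1 + l * (Real.exp s - 1)) * (1 - r * (1 - Real.exp (-s))) * (1 + e * p) := by ring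
    _ ≤ (1 - e ^ 2 / 32) * (1 + e ^ 2 / 64) :=
        (mul_le_mul_of_nonneg_right h6 (by positivity)).trans
          (mul_le_mul_of_nonneg_left h8 (by nlinarith))
    _ ≤ _ := by nlinarith [sq_nonneg (e ^ 2)]

/-- After an exploration bit `true` no service is needed: the factor `1 + e` that is released covers
an arrival. -/
lemma drift_of_coin {e l p r : ℝ} (he0 : 0 < e) (he1 : e ≤ 1) (hl0 : 0 ≤ l) (hl1 : l ≤ 1)
    (hp0 : 0 ≤ p) (hp : p ≤ e / 64) (hr0 : 0 ≤ r) :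
    (1 + l * (Real.exp (e / 8) - 1)) * (1 + e * p) * (1 - r * (1 - Real.exp (-(e / 8)))) ≤
      (1 - e ^ 2 / 64) * (1 + e) := by
  set s := e / 8 with hs
  have hs0 : 0 < s := by positivity
  have h1 : Real.exp s ≤ 1 + s + s ^ 2 := by
    have := Real.abs_exp_sub_one_sub_id_le (x := s) (by rw [abs_of_pos hs0]; linarith)
    have := (abs_le.1 this).2
    linarith
  have h2 : Real.exp (-s) ≤ 1 := Real.exp_le_one_iff.2 (by linarith)
  have h3 : 1 - r * (1 - Real.exp (-s)) ≤ 1 := by nlinarith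
  have hone := Real.add_one_le_exp s
  have h4 : 1 + l * (Real.exp s - 1) ≤ 1 + s + s ^ 2 := by nlinarith
  calc _ ≤ (1 + l * (Real.exp s - 1)) * (1 + e * p) * 1 :=
        mul_le_mul_of_nonneg_left h3 (mul_nonneg (by nlinarith) (by positivity))
    _ ≤ (1 + s + s ^ 2) * (1 + e ^ 2 / 64) := by
        rw [mul_one]
        exact mul_le_mul h4 (by nlinarith) (by positivity) (by positivity)
    _ ≤ _ := by
        have : s ^ 2 = e ^ 2 / 64 := by rw [hs]; ring
        rw [this, hs]
        have h5 : e ^ 2 ≤ e := by nlinarith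
        have h6 : 0 ≤ e ^ 2 := sq_nonneg e
        have h7 : e ^ 3 ≤ e := by nlinarith
        have h8 : e ^ 4 ≤ e := by nlinarith
        nlinarith

section Drift

variable {d K : ℕ} {ν : Measure (Vec d)} {lam p : ℝ}

lemma lintegral_roundLaw_drift [IsProbabilityMeasure ν] (hK : 0 < K) (hl0 : 0 ≤ lam) (hl1 : lam ≤ 1) (hp0 : 0 ≤ p)
    (hp1 : p ≤ 1) {e q r : ℝ} (he : 0 ≤ e) (hr0 : 0 ≤ r) (hr1 : r ≤ 1) (s : ℝ) :
    ∫⁻ z : RoundSpace d K, ENNReal.ofReal (Real.exp (s * (q - (if z.2.2.2.2 ≤ r then 1 else 0) +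
        (if z.1 = true then 1 else 0))) * (1 + e * (if z.2.2.1 = true then 1 else 0)))
        ∂(roundLaw K ν lam p) =
      ENNReal.ofReal (Real.exp (s * q) * ((1 + lam * (Real.exp s - 1)) * (1 + e * p) *
        (1 - r * (1 - Real.exp (-s))))) := by
  have := isProbabilityMeasure_uniformOn_univ_fin hK
  have hm1 : MeasurableSet {z : RoundSpace d K | z.2.2.2.2 ≤ r} :=
    measurableSet_le (by fun_prop) measurable_const
  have hm2 : MeasurableSet {z : RoundSpace d K | z.1 = true} :=
    measurable_fst (measurableSet_singleton true)
  have hm3 : MeasurableSet {z : RoundSpace d K | z.2.2.1 = true} :=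
    (show Measurable fun z : RoundSpace d K => z.2.2.1 by fun_prop) (measurableSet_singleton true)
  have hmeas : Measurable fun z : RoundSpace d K => ENNReal.ofReal (Real.exp (s * (q -
      (if z.2.2.2.2 ≤ r then 1 else 0) + (if z.1 = true then 1 else 0))) *
      (1 + e * (if z.2.2.1 = true then 1 else 0))) := by
    have h1 : Measurable fun z : RoundSpace d K => (if z.2.2.2.2 ≤ r then (1 : ℝ) else 0) :=
      Measurable.ite hm1 measurable_const measurable_const
    have h2 : Measurable fun z : RoundSpace d K => (if z.1 = true then (1 : ℝ) else 0) :=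
      Measurable.ite hm2 measurable_const measurable_const
    have h3 : Measurable fun z : RoundSpace d K => (if z.2.2.1 = true then (1 : ℝ) else 0) :=
      Measurable.ite hm3 measurable_const measurable_const
    fun_prop
  rw [lintegral_roundLaw hK hl0 hl1 hp0 hp1 hmeas]
  have hu : ∀ A C : ℝ, 0 ≤ C → ∫⁻ u, ENNReal.ofReal (Real.exp (s * (q -
      (if u ≤ r then 1 else 0) + A)) * C) ∂(volume.restrict (Set.Icc (0 : ℝ) 1)) =
      ENNReal.ofReal (Real.exp (s * (q + A)) * C * (1 - r * (1 - Real.exp (-s)))) := by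
    intro A C hC
    have h1 : ∀ u : ℝ, ENNReal.ofReal (Real.exp (s * (q - (if u ≤ r then 1 else 0) + A)) * C) =
        if u ≤ r then ENNReal.ofReal (Real.exp (s * (q + A)) * C * Real.exp (-s)) else
          ENNReal.ofReal (Real.exp (s * (q + A)) * C) := by
      intro u
      split_ifs
      · congr 1
        rw [mul_right_comm, ← Real.exp_add]
        ring_nf
      · rw [sub_zero]
    rw [lintegral_congr h1, lintegral_unif_le hr0 hr1, ← ENNReal.ofReal_mul hr0,
      ← ENNReal.ofReal_mul (by linarith), ← ENNReal.ofReal_add (by positivity)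
        (mul_nonneg (by linarith) (by positivity))]
    congr 1
    ring
  have hC : ∀ c : Bool, 0 ≤ 1 + e * (if c = true then (1 : ℝ) else 0) := by
    intro c; split_ifs <;> linarith
  have hD : 0 ≤ 1 - r * (1 - Real.exp (-s)) := by
    have := Real.exp_pos (-s)
    nlinarith
  have hin := fun a c : Bool => hu (if a = true then 1 else 0) _ (hC c)
  simp only [hin, lintegral_const, measure_univ, mul_one, lintegral_bern]
  simp only [if_true, Bool.false_eq_true, if_false, mul_zero, mul_one, add_zero]
  have hcoin : ∀ X : ℝ, 0 ≤ X → ENNReal.ofReal p * ENNReal.ofReal (X * (1 + e) *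
      (1 - r * (1 - Real.exp (-s)))) + ENNReal.ofReal (1 - p) * ENNReal.ofReal (X *
      (1 - r * (1 - Real.exp (-s)))) = ENNReal.ofReal (X * (1 + e * p) *
        (1 - r * (1 - Real.exp (-s)))) := by
    intro X hX
    rw [← ENNReal.ofReal_mul hp0, ← ENNReal.ofReal_mul (by linarith),
      ← ENNReal.ofReal_add (by positivity) (mul_nonneg (by linarith) (by positivity))]
    congr 1
    ring
  rw [hcoin _ (Real.exp_pos _).le, hcoin _ (Real.exp_pos _).le, ← ENNReal.ofReal_mul hl0,
    ← ENNReal.ofReal_mul (by linarith), ← ENNReal.ofReal_add (by positivity)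
      (mul_nonneg (by linarith) (by positivity))]
  congr 1
  rw [mul_add s q 1, Real.exp_add, mul_one]
  ring

variable {Ω : Type*} {M : Model d K} {N : Noise Ω d K} {π : Schedule Ω K}

/-- An exponential Lyapunov function of the queue length at the beginning of round `t`. The second
factor pays for the possibly slow service of a round following the exploration bit `true`. -/
noncomputable def lyapunov (M : Model d K) (N : Noise Ω d K) (π : Schedule Ω K) (e : ℝ) (t : ℕ)
    (ω : Ω) : ℝ :=
  Real.exp (e / 8 * queueLength M N π t ω) * (1 + e * (if N.coin (t - 1) ω = true then 1 else 0))

/-- The service of round `t` leaves a downward drift of the queue, or the lack of it is harmless. -/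
def Stable (M : Model d K) (N : Noise Ω d K) (π : Schedule Ω K) (lam e : ℝ) (t : ℕ) (ω : Ω) :
    Prop :=
  queue M N π t ω = ∅ ∨ N.coin (t - 1) ω = true ∨ lam + e / 2 ≤ servedRate M N π t ω

lemma lyapunov_nonneg {e : ℝ} (he : 0 ≤ e) (t : ℕ) (ω : Ω) : 0 ≤ lyapunov M N π e t ω := by
  unfold lyapunov
  split_ifs <;> positivity

lemma lyapunov_le {e : ℝ} (he1 : e ≤ 1) (t : ℕ) (ω : Ω) :
    lyapunov M N π e t ω ≤ 2 * Real.exp (e / 8 * queueLength M N π t ω) := by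
  unfold lyapunov
  have := Real.exp_pos (e / 8 * queueLength M N π t ω)
  split_ifs <;> nlinarith

lemma exp_le_lyapunov {e : ℝ} (he : 0 ≤ e) (t : ℕ) (ω : Ω) :
    Real.exp (e / 8 * queueLength M N π t ω) ≤ lyapunov M N π e t ω := by
  unfold lyapunov
  have := Real.exp_pos (e / 8 * queueLength M N π t ω)
  split_ifs <;> nlinarith

variable [m : MeasurableSpace Ω] {P : Measure Ω} {ℱ : Filtration ℕ m}

lemma measurableSet_stable (hN : IsNoise P ℱ ν lam p N) (hπ : π.Adapted ℱ)
    (hmem : ∀ t, 1 ≤ t → ∀ ω, (queue M N π t ω).Nonempty → π.job t ω ∈ queue M N π t ω) {e : ℝ}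
    {t : ℕ} (ht : 1 ≤ t) : MeasurableSet[ℱ t] {ω | Stable M N π lam e (t + 1) ω} := by
  have h1 : MeasurableSet[ℱ t] {ω | queue M N π (t + 1) ω = ∅} :=
    measurableSet_queue hN hπ t {X | X = ∅}
  have h2 : MeasurableSet[ℱ t] {ω | N.coin t ω = true} :=
    hN.measurable_coin ht le_rfl (measurableSet_singleton true)
  have h3 : MeasurableSet[ℱ t] {ω | lam + e / 2 ≤ servedRate M N π (t + 1) ω} :=
    measurable_servedRate hN hπ hmem t measurableSet_Ici
  exact h1.union (h2.union h3)

lemma measurable_lyapunov (hN : IsNoise P ℱ ν lam p N) (hπ : π.Adapted ℱ) (e : ℝ) {t : ℕ}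
    (ht : 1 ≤ t) : Measurable[ℱ t] (lyapunov M N π e (t + 1)) := by
  have h1 := measurable_queueLength (M := M) hN hπ t
  have h2 : Measurable[ℱ t] fun ω => (if N.coin t ω = true then (1 : ℝ) else 0) :=
    Measurable.ite (hN.measurable_coin ht le_rfl (measurableSet_singleton true)) measurable_const
      measurable_const
  have h3 : lyapunov M N π e (t + 1) = fun ω => Real.exp (e / 8 * queueLength M N π (t + 1) ω) *
      (1 + e * (if N.coin t ω = true then 1 else 0)) := by
    ext ω; simp [lyapunov]
  rw [h3]
  fun_prop

lemma measurableSet_forall_stable (hN : IsNoise P ℱ ν lam p N) (hπ : π.Adapted ℱ)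
    (hmem : ∀ t, 1 ≤ t → ∀ ω, (queue M N π t ω).Nonempty → π.job t ω ∈ queue M N π t ω) {e : ℝ}
    {a : ℕ} (ha : 1 ≤ a) (t : ℕ) :
    MeasurableSet[ℱ t] {ω | ∀ i, a ≤ i → i ≤ t → Stable M N π lam e (i + 1) ω} := by
  have : {ω | ∀ i, a ≤ i → i ≤ t → Stable M N π lam e (i + 1) ω} =
      ⋂ i ∈ Set.Icc a t, {ω | Stable M N π lam e (i + 1) ω} := by
    ext ω; simp
  rw [this]
  refine MeasurableSet.biInter (Set.to_countable _) fun i hi => ?_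
  exact ℱ.mono hi.2 _ (measurableSet_stable hN hπ hmem (ha.trans hi.1))

variable [IsProbabilityMeasure ν] [IsProbabilityMeasure P]

lemma setLIntegral_lyapunov_succ_le_of_nonempty (hK : 0 < K) (hl0 : 0 ≤ lam) (hl1 : lam ≤ 1)
    (hp0 : 0 ≤ p) (hN : IsNoise P ℱ ν lam p N) (hπ : π.Adapted ℱ)
    (hmem : ∀ t, 1 ≤ t → ∀ ω, (queue M N π t ω).Nonempty → π.job t ω ∈ queue M N π t ω) {e : ℝ}
    (he0 : 0 < e) (he1 : e ≤ 1) (hp : p ≤ e / 64) {t : ℕ} {E : Set Ω}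
    (hE : MeasurableSet[ℱ t] E) (hst : ∀ ω ∈ E, Stable M N π lam e (t + 1) ω)
    (hne : ∀ ω ∈ E, (queue M N π (t + 1) ω).Nonempty) :
    ∫⁻ ω in E, ENNReal.ofReal (lyapunov M N π e (t + 2) ω) ∂P ≤
      ENNReal.ofReal (1 - e ^ 2 / 64) *
        ∫⁻ ω in E, ENNReal.ofReal (lyapunov M N π e (t + 1) ω) ∂P := by
  have hp1 : p ≤ 1 := by linarith
  let g : (ℝ × ℝ) × RoundSpace d K → ENNReal := fun y =>
    ENNReal.ofReal (Real.exp (e / 8 * (y.1.1 - (if y.2.2.2.2.2 ≤ y.1.2 then 1 else 0) +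
      (if y.2.1 = true then 1 else 0))) * (1 + e * (if y.2.2.2.1 = true then 1 else 0)))
  have hg : Measurable g := by
    have h1 : Measurable fun y : (ℝ × ℝ) × RoundSpace d K =>
        (if y.2.2.2.2.2 ≤ y.1.2 then (1 : ℝ) else 0) :=
      Measurable.ite (measurableSet_le (by fun_prop) (by fun_prop)) measurable_const
        measurable_const
    have h2 : Measurable fun y : (ℝ × ℝ) × RoundSpace d K =>
        (if y.2.1 = true then (1 : ℝ) else 0) :=
      Measurable.ite ((show Measurable fun y : (ℝ × ℝ) × RoundSpace d K => y.2.1 by fun_prop)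
        (measurableSet_singleton true)) measurable_const measurable_const
    have h3 : Measurable fun y : (ℝ × ℝ) × RoundSpace d K =>
        (if y.2.2.2.1 = true then (1 : ℝ) else 0) :=
      Measurable.ite ((show Measurable fun y : (ℝ × ℝ) × RoundSpace d K => y.2.2.2.1 by fun_prop)
        (measurableSet_singleton true)) measurable_const measurable_const
    fun_prop
  have hX : Measurable[ℱ t] fun ω => (queueLength M N π (t + 1) ω, servedRate M N π (t + 1) ω) :=
    (measurable_queueLength hN hπ t).prodMk (measurable_servedRate hN hπ hmem t)
  have hE' := ℱ.le _ _ hE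
  rw [← lintegral_const_mul' _ _ ENNReal.ofReal_ne_top]
  have h1 := hN.setLIntegral_round_le t hX hg hE
    (h := fun ω => ENNReal.ofReal (1 - e ^ 2 / 64) * ENNReal.ofReal (lyapunov M N π e (t + 1) ω)) ?_
  · refine le_trans (le_of_eq ?_) h1
    refine setLIntegral_congr_fun hE' fun ω hω => ?_
    simp only [lyapunov, g, Noise.round]
    rw [card_queue_succ (by omega) (hmem (t + 1) (by omega) ω) (hne ω hω)]
    rfl
  · intro ω hω
    obtain ⟨hr0, hr1⟩ := servedRate_mem (M := M) (N := N) (π := π) (t + 1) ω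
    simp only [g]
    rw [lintegral_roundLaw_drift hK hl0 hl1 hp0 hp1 he0.le hr0 hr1,
      ← ENNReal.ofReal_mul (by nlinarith)]
    apply ENNReal.ofReal_le_ofReal
    rw [lyapunov, mul_left_comm (1 - e ^ 2 / 64)]
    refine mul_le_mul_of_nonneg_left ?_ (Real.exp_pos _).le
    simp only [Nat.add_sub_cancel]
    rcases hst ω hω with h | h | h
    · exact absurd h (hne ω hω).ne_empty
    · simp only [Nat.add_sub_cancel] at h
      rw [if_pos h, mul_one]
      exact drift_of_coin he0 he1 hl0 hl1 hp0 hp hr0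
    · have h2 := drift_of_rate he0 he1 hl0 hp0 hp h hr1
      refine h2.trans ?_
      have h3 : 0 ≤ 1 - e ^ 2 / 64 := by nlinarith
      refine le_mul_of_one_le_right h3 ?_
      split_ifs <;> linarith

lemma setLIntegral_lyapunov_succ_le (hK : 0 < K) (hl0 : 0 ≤ lam) (hl1 : lam ≤ 1)
    (hp0 : 0 ≤ p) (hN : IsNoise P ℱ ν lam p N) (hπ : π.Adapted ℱ)
    (hmem : ∀ t, 1 ≤ t → ∀ ω, (queue M N π t ω).Nonempty → π.job t ω ∈ queue M N π t ω) {e : ℝ}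
    (he0 : 0 < e) (he1 : e ≤ 1) (hp : p ≤ e / 64) {t : ℕ} {E : Set Ω}
    (hE : MeasurableSet[ℱ t] E) (hst : ∀ ω ∈ E, Stable M N π lam e (t + 1) ω) :
    ∫⁻ ω in E, ENNReal.ofReal (lyapunov M N π e (t + 2) ω) ∂P ≤
      ENNReal.ofReal (1 - e ^ 2 / 64) *
        ∫⁻ ω in E, ENNReal.ofReal (lyapunov M N π e (t + 1) ω) ∂P + ENNReal.ofReal 4 := by
  have hB := measurableSet_queue_nonempty (M := M) hN hπ t
  rw [← lintegral_inter_add_sdiff _ E (ℱ.le _ _ hB)]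
  refine add_le_add ?_ ?_
  · refine (setLIntegral_lyapunov_succ_le_of_nonempty hK hl0 hl1 hp0 hN hπ hmem he0 he1 hp
      (MeasurableSet.inter hE hB) (fun ω hω => hst ω hω.1) fun ω hω => hω.2).trans ?_
    gcongr
    exact Set.inter_subset_left
  · calc _ ≤ ∫⁻ ω in E \ {ω | (queue M N π (t + 1) ω).Nonempty}, ENNReal.ofReal 4 ∂P := by
          refine setLIntegral_mono' ((ℱ.le _ _ hE).diff (ℱ.le _ _ hB)) fun ω hω => ?_
          apply ENNReal.ofReal_le_ofReal
          refine (lyapunov_le he1 _ _).trans ?_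
          have h1 : queueLength M N π (t + 1) ω = 0 := by
            have : queue M N π (t + 1) ω = ∅ := Finset.not_nonempty_iff_eq_empty.1 hω.2
            simp [queueLength, this]
          have h2 := queueLength_succ_le (M := M) (N := N) (π := π) (t + 1) ω
          have h3 : Real.exp (e / 8 * queueLength M N π (t + 2) ω) ≤ Real.exp (1 / 2) := by
            apply Real.exp_le_exp.2
            rw [h1] at h2
            have h4 : queueLength M N π (t + 2) ω ≤ 1 := by linarith
            nlinarith
          have h5 : Real.exp (1 / 2) ≤ 2 := by
            have := Real.exp_one_lt_d9
            have h6 : Real.exp (1 / 2) ^ 2 = Real.exp 1 := by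
              rw [← Real.exp_nat_mul]; norm_num
            nlinarith [Real.exp_pos (1 / 2)]
          linarith
      _ ≤ ENNReal.ofReal 4 * 1 := by
          rw [setLIntegral_const]
          gcongr
          exact prob_le_one
      _ = _ := mul_one _

/-- The exponential moment of the queue length relaxes geometrically from its value after `a` rounds
to a stationary level. -/
lemma setLIntegral_lyapunov_le (hK : 0 < K) (hl0 : 0 ≤ lam) (hl1 : lam ≤ 1)
    (hp0 : 0 ≤ p) (hN : IsNoise P ℱ ν lam p N) (hπ : π.Adapted ℱ)
    (hmem : ∀ t, 1 ≤ t → ∀ ω, (queue M N π t ω).Nonempty → π.job t ω ∈ queue M N π t ω) {e : ℝ}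
    (he0 : 0 < e) (he1 : e ≤ 1) (hp : p ≤ e / 64) {a : ℕ} (ha : 1 ≤ a) (n : ℕ) :
    ∫⁻ ω in {ω | ∀ i, a ≤ i → i ≤ a + n → Stable M N π lam e (i + 1) ω},
        ENNReal.ofReal (lyapunov M N π e (a + n + 1) ω) ∂P ≤
      ENNReal.ofReal ((1 - e ^ 2 / 64) ^ n * (2 * Real.exp (e / 8 * (a + 1))) + 256 / e ^ 2) := by
  have hρ : 0 ≤ 1 - e ^ 2 / 64 := by nlinarith
  induction n with
  | zero =>
    calc _ ≤ ∫⁻ ω in {ω | ∀ i, a ≤ i → i ≤ a + 0 → Stable M N π lam e (i + 1) ω},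
          ENNReal.ofReal (2 * Real.exp (e / 8 * (a + 1))) ∂P := by
          refine lintegral_mono fun ω => ENNReal.ofReal_le_ofReal ?_
          refine (lyapunov_le he1 _ _).trans ?_
          have h := card_queue_le (M := M) (N := N) (π := π) (a + 0 + 1) ω
          have : queueLength M N π (a + 0 + 1) ω ≤ a + 1 := by
            rw [queueLength]; exact_mod_cast h
          gcongr
      _ ≤ ENNReal.ofReal (2 * Real.exp (e / 8 * (a + 1))) * 1 := by
          rw [setLIntegral_const]
          gcongr
          exact prob_le_one
      _ ≤ _ := by
          rw [mul_one]
          apply ENNReal.ofReal_le_ofReal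
          rw [pow_zero, one_mul]
          have : 0 ≤ 256 / e ^ 2 := by positivity
          linarith
  | succ n ih =>
    set E := {ω | ∀ i, a ≤ i → i ≤ a + n → Stable M N π lam e (i + 1) ω} with hE
    have h1 := setLIntegral_lyapunov_succ_le hK hl0 hl1 hp0 hN hπ hmem he0 he1 hp
      (measurableSet_forall_stable hN hπ hmem (e := e) ha (a + n))
      (fun ω hω => hω (a + n) (by omega) le_rfl)
    calc _ ≤ ∫⁻ ω in E, ENNReal.ofReal (lyapunov M N π e (a + n + 2) ω) ∂P := by
          refine lintegral_mono_set fun ω hω i hi hi' => ?_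
          exact hω i hi (by omega)
      _ ≤ _ := h1
      _ ≤ ENNReal.ofReal (1 - e ^ 2 / 64) * ENNReal.ofReal ((1 - e ^ 2 / 64) ^ n *
            (2 * Real.exp (e / 8 * (a + 1))) + 256 / e ^ 2) + ENNReal.ofReal 4 := by gcongr
      _ = _ := by
          rw [← ENNReal.ofReal_mul hρ, ← ENNReal.ofReal_add (by positivity) (by norm_num)]
          congr 1
          field_simp
          ring

/-- It is unlikely that the queue stays nonempty for a long time. -/
lemma setLIntegral_lyapunov_nonempty_le (hK : 0 < K) (hl0 : 0 ≤ lam) (hl1 : lam ≤ 1)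
    (hp0 : 0 ≤ p) (hN : IsNoise P ℱ ν lam p N) (hπ : π.Adapted ℱ)
    (hmem : ∀ t, 1 ≤ t → ∀ ω, (queue M N π t ω).Nonempty → π.job t ω ∈ queue M N π t ω) {e : ℝ}
    (he0 : 0 < e) (he1 : e ≤ 1) (hp : p ≤ e / 64) {a : ℕ} (ha : 1 ≤ a) (n l : ℕ) :
    ∫⁻ ω in {ω | (∀ i, a ≤ i → i ≤ a + n + l → Stable M N π lam e (i + 1) ω) ∧
        ∀ i, a + n ≤ i → i ≤ a + n + l → (queue M N π (i + 1) ω).Nonempty},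
        ENNReal.ofReal (lyapunov M N π e (a + n + l + 1) ω) ∂P ≤
      ENNReal.ofReal ((1 - e ^ 2 / 64) ^ l *
        ((1 - e ^ 2 / 64) ^ n * (2 * Real.exp (e / 8 * (a + 1))) + 256 / e ^ 2)) := by
  have hρ : 0 ≤ 1 - e ^ 2 / 64 := by nlinarith
  induction l with
  | zero =>
    rw [pow_zero, one_mul]
    refine le_trans (lintegral_mono_set fun ω hω => ?_)
      (setLIntegral_lyapunov_le hK hl0 hl1 hp0 hN hπ hmem he0 he1 hp ha n)
    exact hω.1
  | succ l ih =>
    set E := {ω | (∀ i, a ≤ i → i ≤ a + n + l → Stable M N π lam e (i + 1) ω) ∧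
        ∀ i, a + n ≤ i → i ≤ a + n + l → (queue M N π (i + 1) ω).Nonempty} with hE
    have hmE : MeasurableSet[ℱ (a + n + l)] E := by
      have h2 : {ω | ∀ i, a + n ≤ i → i ≤ a + n + l → (queue M N π (i + 1) ω).Nonempty} =
          ⋂ i ∈ Set.Icc (a + n) (a + n + l), {ω | (queue M N π (i + 1) ω).Nonempty} := by
        ext ω; simp
      refine MeasurableSet.inter (measurableSet_forall_stable hN hπ hmem (e := e) ha _)
        (Eq.subst (motive := fun X => MeasurableSet[ℱ (a + n + l)] X) h2.symm ?_)
      refine MeasurableSet.biInter (Set.to_countable _) fun i hi => ?_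
      exact ℱ.mono hi.2 _ (measurableSet_queue_nonempty hN hπ i)
    have h1 := setLIntegral_lyapunov_succ_le_of_nonempty hK hl0 hl1 hp0 hN hπ hmem he0 he1 hp
      hmE (fun ω hω => hω.1 _ (by omega) le_rfl) (fun ω hω => hω.2 _ (by omega) le_rfl)
    calc _ ≤ ∫⁻ ω in E, ENNReal.ofReal (lyapunov M N π e (a + n + l + 2) ω) ∂P := by
          refine lintegral_mono_set fun ω hω => ⟨fun i hi hi' => ?_, fun i hi hi' => ?_⟩
          · exact hω.1 i hi (by omega)
          · exact hω.2 i hi (by omega)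
      _ ≤ _ := h1
      _ ≤ ENNReal.ofReal (1 - e ^ 2 / 64) * ENNReal.ofReal ((1 - e ^ 2 / 64) ^ l *
            ((1 - e ^ 2 / 64) ^ n * (2 * Real.exp (e / 8 * (a + 1))) + 256 / e ^ 2)) := by gcongr
      _ = _ := by
          rw [← ENNReal.ofReal_mul hρ]
          congr 1
          ring

end Drift

/-! ### Good events and the resulting bounds on the regret -/

section GoodEvents

variable {Ω : Type*} {d K : ℕ} {M : Model d K} {N : Noise Ω d K} {π : Schedule Ω K}
  {lam p kap R S sig0 eps lam0 delta tau : ℝ}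

/-- All contexts are possible ones, and the noise of the observations up to round `T` obeys the
self-normalized bound. -/
def Regular (M : Model d K) (N : Noise Ω d K) (π : Schedule Ω K) (kap lam0 delta : ℝ) (T : ℕ)
    (ω : Ω) : Prop :=
  (∀ j, 1 ≤ j → N.feature j ω ∈ M.contexts) ∧ ∀ s ≤ T, ∀ k, scoreForm M N π kap lam0 s k ω ≤
    d * Real.log (1 + 1 / (kap * lam0 * d) * T) + 1 / 2 * Real.log (K / delta)

/-- After `n` rounds every server has at least `c` exploration data, and these are well spread. -/
def WellExplored (M : Model d K) (N : Noise Ω d K) (tau sig0 : ℝ) (n : ℕ) (c : ℝ) (ω : Ω) : Prop :=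
  ∀ k, c ≤ explorationCount N tau k n ω ∧
    ‖explorationSum M N tau k n ω‖ ≤ sig0 ^ 2 / 2 * explorationCount N tau k n ω

lemma WellExplored.max {n n' : ℕ} {c c' : ℝ} {ω : Ω} (h : WellExplored M N tau sig0 n c ω)
    (h' : WellExplored M N tau sig0 n' c' ω) (hn : n ≤ n') :
    WellExplored M N tau sig0 n' (max c c') ω := fun k =>
  ⟨max_le ((h k).1.trans (explorationCount_mono tau k hn ω)) (h' k).1, (h' k).2⟩

variable [m : MeasurableSpace Ω] {P : Measure Ω} {ℱ : Filtration ℕ m}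
  {est : ℕ → Fin K → Ω → Vec d}

lemma serviceRate_le_of_wellExplored (hA : Assumptions M lam kap R S sig0 eps) (hkap : 4 ≤ kap)
    (hlam0 : 0 < lam0) (hπ : IsCQB M N π ℱ kap S lam0 delta tau est) {t T : ℕ} (htT : t ≤ T)
    {ω : Ω} (hreg : Regular M N π kap lam0 delta T ω) {n : ℕ} {c : ℝ}
    (hexp : WellExplored M N tau sig0 n c ω) (hc : 0 < c)
    (hsmall : 4 * radius d K kap S lam0 delta T < Real.sqrt (sig0 ^ 2 / 2 * c))
    (hn : n + 2 ≤ t) (htau : tau < t) (hcoin : N.coin (t - 1) ω ≠ true) {j : ℕ}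
    (hj : j ∈ queue M N π t ω) (k : Fin K) :
    serviceRate M N ω j k ≤ servedRate M N π t ω +
      8 * radius d K kap S lam0 delta T / Real.sqrt (sig0 ^ 2 / 2 * c) := by
  have hs := hA.sig0_pos
  refine serviceRate_le_servedRate_add hA hkap hlam0 htT hreg.1 (fun s hs => hπ.mem s hs ω)
    (fun k => hreg.2 (t - 1) (by omega) k) (by positivity) (fun k u => ?_) hsmall
    (fun k => hπ.est_spec (t - 1) k ω) (by omega) ?_ hj k
  · refine le_trans ?_ (designForm_ge_of_exploration hA hlam0 hπ (s := t - 1) (t := n) (by omega)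
      (hexp k).2 u)
    have := (hexp k).1
    gcongr
  · exact hπ.exploit t (by omega) ω (fun h => absurd h.1 (not_le.2 htau))
      fun h => hcoin h.2.1

lemma stable_of_wellExplored (hA : Assumptions M lam kap R S sig0 eps) (hkap : 4 ≤ kap)
    (hlam0 : 0 < lam0) (hπ : IsCQB M N π ℱ kap S lam0 delta tau est) {t T : ℕ} (htT : t ≤ T)
    {ω : Ω} (hreg : Regular M N π kap lam0 delta T ω) {n : ℕ} {c : ℝ}
    (hexp : WellExplored M N tau sig0 n c ω) (hc : 0 < c)
    (hsmall : 4 * radius d K kap S lam0 delta T < Real.sqrt (sig0 ^ 2 / 2 * c))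
    (hgap : 8 * radius d K kap S lam0 delta T / Real.sqrt (sig0 ^ 2 / 2 * c) ≤ eps / 2)
    (hn : n + 2 ≤ t) (htau : tau < t) : Stable M N π lam eps t ω := by
  by_cases hcoin : N.coin (t - 1) ω = true
  · exact Or.inr (Or.inl hcoin)
  rcases Finset.eq_empty_or_nonempty (queue M N π t ω) with h | ⟨j, hj⟩
  · exact Or.inl h
  refine Or.inr (Or.inr ?_)
  obtain ⟨k, hk⟩ := hA.slack _ (hreg.1 j (mem_queue_bounds hj).1)
  have h1 := serviceRate_le_of_wellExplored hA hkap hlam0 hπ htT hreg hexp hc hsmall hn htau hcoin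
    hj k
  rw [serviceRate] at h1
  linarith

section Probability

lemma IsNoise.ae_feature_mem {ν : Measure (Vec d)} [IsProbabilityMeasure ν] {A : Set (Vec d)}
    (hK : 0 < K) (hl0 : 0 ≤ lam) (hl1 : lam ≤ 1) (hp0 : 0 ≤ p) (hp1 : p ≤ 1)
    (hN : IsNoise P ℱ ν lam p N) (hν : ∀ᵐ x ∂ν, x ∈ A) :
    ∀ᵐ ω ∂P, ∀ j, 1 ≤ j → N.feature j ω ∈ A := by
  have := isProbabilityMeasure_bern hl0 hl1
  have := isProbabilityMeasure_bern hp0 hp1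
  have := isProbabilityMeasure_uniformOn_univ_fin hK
  rw [ae_all_iff]
  intro j
  rcases Nat.eq_zero_or_pos j with h | h
  · subst h; simp
  obtain ⟨t, rfl⟩ : ∃ t, j = t + 1 := ⟨j - 1, by omega⟩
  have hR := hN.measurable_round t
  have h1 : ∀ᵐ z ∂(roundLaw K ν lam p), z.2.1 ∈ A := by
    have h2 : Measure.QuasiMeasurePreserving (fun z : RoundSpace d K => z.2.1)
        (roundLaw K ν lam p) ν := by
      unfold roundLaw
      exact Measure.quasiMeasurePreserving_fst.comp Measure.quasiMeasurePreserving_snd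
    exact h2.ae hν
  rw [← hN.law t] at h1
  filter_upwards [ae_of_ae_map hR.aemeasurable h1] with ω hω _
  exact hω

lemma IsNoise.measure_coin_le {ν : Measure (Vec d)} [IsProbabilityMeasure ν]
    (hK : 0 < K) (hl0 : 0 ≤ lam) (hl1 : lam ≤ 1) (hp0 : 0 ≤ p) (hp1 : p ≤ 1)
    (hN : IsNoise P ℱ ν lam p N) (t : ℕ) :
    P {ω | N.coin (t + 1) ω = true} ≤ ENNReal.ofReal p := by
  have := isProbabilityMeasure_bern hl0 hl1
  have := isProbabilityMeasure_bern hp0 hp1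
  have := isProbabilityMeasure_uniformOn_univ_fin hK
  have hm : MeasurableSet {z : RoundSpace d K | z.2.2.1 = true} :=
    (show Measurable fun z : RoundSpace d K => z.2.2.1 by fun_prop) (measurableSet_singleton true)
  have e : {ω | N.coin (t + 1) ω = true} =
      N.round (t + 1) ⁻¹' {z : RoundSpace d K | z.2.2.1 = true} := rfl
  rw [e, ← Measure.map_apply (hN.measurable_round t) hm, hN.law]
  have e : {z : RoundSpace d K | z.2.2.1 = true} = (Set.univ : Set Bool) ×ˢ
      ((Set.univ : Set (Vec d)) ×ˢ (({true} : Set Bool) ×ˢ (Set.univ : Set (Fin K × ℝ)))) := by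
    ext z; simp
  rw [e, roundLaw, Measure.prod_prod, Measure.prod_prod, Measure.prod_prod, measure_univ,
    measure_univ, measure_univ, mul_one, one_mul, one_mul, bern_true]

variable [IsProbabilityMeasure P]

lemma measure_not_regular_le (hA : Assumptions M lam kap R S sig0 eps) (hK : 0 < K)
    (hl0 : 0 ≤ lam) (hl1 : lam ≤ 1) (hp0 : 0 ≤ p) (hp1 : p ≤ 1) (hlam0 : 0 < lam0)
    (hdelta : 0 < delta) (hN : IsNoise P ℱ M.dist lam p N) (hπ : π.Adapted ℱ)
    (hmem : ∀ t, 1 ≤ t → ∀ ω, (queue M N π t ω).Nonempty → π.job t ω ∈ queue M N π t ω) (T : ℕ) :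
    P {ω | ¬ Regular M N π kap lam0 delta T ω} ≤ ENNReal.ofReal delta := by
  have := hA.dist_prob
  have hkl : 0 < kap * lam0 := mul_pos hA.kap_pos hlam0
  have hK' : (0 : ℝ) < K := by exact_mod_cast hK
  have h0 := hN.ae_feature_mem hK hl0 hl1 hp0 hp1 hA.dist_contexts
  rw [ae_iff] at h0
  have hsub : {ω | ¬ Regular M N π kap lam0 delta T ω} ⊆
      {ω | ¬ ∀ j, 1 ≤ j → N.feature j ω ∈ M.contexts} ∪ ⋃ k : Fin K, {ω | ∃ s ≤ T,
        Real.log ((design M N π kap lam0 s k ω).det / (kap * lam0) ^ d)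
        + 1 / 2 * Real.log (1 / (delta / K)) ≤ scoreForm M N π kap lam0 s k ω} := by
    intro ω hω
    by_cases hctx : ∀ j, 1 ≤ j → N.feature j ω ∈ M.contexts
    · right
      have h1 : ¬ ∀ s ≤ T, ∀ k, scoreForm M N π kap lam0 s k ω ≤
        d * Real.log (1 + 1 / (kap * lam0 * d) * T) + 1 / 2 * Real.log (K / delta) :=
        fun h => hω ⟨hctx, h⟩
      push Not at h1
      obtain ⟨s, hs, k, h2⟩ := h1
      refine Set.mem_iUnion.2 ⟨k, s, hs, le_trans ?_ h2.le⟩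
      rw [one_div_div]
      gcongr
      refine det_design_le hkl hA.dim_pos (fun i hi => ?_) hs
      have h3 := (mem_rounds.1 hi)
      rw [served, if_pos h3.2.1]
      exact hA.context_norm _ (hctx _ (mem_queue_bounds (hmem i h3.1.1 ω h3.2.1)).1)
    · left; exact hctx
  refine (measure_mono hsub).trans ((measure_union_le _ _).trans ?_)
  rw [h0, zero_add]
  refine (measure_iUnion_fintype_le _ _).trans ?_
  calc _ ≤ ∑ _ : Fin K, ENNReal.ofReal (delta / K) := Finset.sum_le_sum fun k _ =>
        measure_exists_scoreForm_ge_le hK hl0 hl1 hp0 hp1 hkl hN hπ hmem k T (by positivity)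
    _ = _ := by
        rw [Finset.sum_const, Finset.card_univ, Fintype.card_fin, nsmul_eq_mul,
          ← ENNReal.ofReal_natCast, ← ENNReal.ofReal_mul hK'.le]
        congr 1
        field_simp

/-- The data of the pure-exploration phase suffice with high probability. -/
lemma measure_not_wellExplored_pure_le (hA : Assumptions M lam kap R S sig0 eps) (hK : 0 < K)
    (hl0 : 0 ≤ lam) (hl1 : lam ≤ 1) (hp0 : 0 ≤ p) (hp1 : p ≤ 1)
    (hN : IsNoise P ℱ M.dist lam p N) {n : ℕ} (hn : ((n + 1 : ℕ) : ℝ) ≤ tau) :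
    P {ω | ¬ WellExplored M N tau sig0 n (lam * n / (2 * K) - 1) ω} ≤
      ENNReal.ofReal (Real.exp (-(lam * n / 8)) +
        K * (2 * Real.exp (-(sig0 ^ 4 * (lam * n / (2 * K) - 1) / 32)))) := by
  have := hA.dist_prob
  have hsub : {ω | ¬ WellExplored M N tau sig0 n (lam * n / (2 * K) - 1) ω} ⊆
      {ω | ∃ k : Fin K, explorationCount N tau k n ω < lam * n / (2 * K) - 1} ∪
      ⋃ k : Fin K, {ω | lam * n / (2 * K) - 1 ≤ explorationCount N tau k n ω ∧
        sig0 ^ 2 / 2 * explorationCount N tau k n ω < ‖explorationSum M N tau k n ω‖} := by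
    intro ω hω
    have h1 : ¬ WellExplored M N tau sig0 n (lam * n / (2 * K) - 1) ω := hω
    rw [WellExplored] at h1
    push Not at h1
    obtain ⟨k, hk⟩ := h1
    by_cases h : explorationCount N tau k n ω < lam * n / (2 * K) - 1
    · exact Or.inl ⟨k, h⟩
    · exact Or.inr (Set.mem_iUnion.2 ⟨k, not_lt.1 h, hk (not_lt.1 h)⟩)
  refine (measure_mono hsub).trans ((measure_union_le _ _).trans ?_)
  rw [ENNReal.ofReal_add (by positivity) (by positivity)]
  refine add_le_add (measure_explorationCount_pure_lt_le hK hl0 hl1 hp0 hp1 hN hn) ?_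
  refine (measure_iUnion_fintype_le _ _).trans ?_
  calc _ ≤ ∑ _ : Fin K, ENNReal.ofReal (2 * Real.exp (-(sig0 ^ 4 * (lam * n / (2 * K) - 1) / 32))) :=
        Finset.sum_le_sum fun k _ =>
          measure_explorationSum_gt_le hA hK hl0 hl1 hp0 hp1 hN tau k n _
    _ = _ := by
        rw [Finset.sum_const, Finset.card_univ, Fintype.card_fin, nsmul_eq_mul,
          ← ENNReal.ofReal_natCast, ← ENNReal.ofReal_mul (Nat.cast_nonneg _)]

/-- The data of the `ε`-exploration rounds suffice with high probability. -/
lemma measure_not_wellExplored_eps_le (hA : Assumptions M lam kap R S sig0 eps) (hK : 0 < K)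
    (hl0 : 0 ≤ lam) (hl1 : lam ≤ 1) (hp0 : 0 ≤ p) (hp1 : p ≤ 1)
    (hN : IsNoise P ℱ M.dist lam p N) {a : ℕ} (ha : tau < (a + 2 : ℕ)) (n : ℕ) :
    P {ω | ¬ WellExplored M N tau sig0 (a + n) (lam * p / K * n / 2) ω} ≤
      ENNReal.ofReal (K * (Real.exp (-(lam * p / K * n / 8)) +
        2 * Real.exp (-(sig0 ^ 4 * (lam * p / K * n / 2) / 32)))) := by
  have := hA.dist_prob
  have hsub : {ω | ¬ WellExplored M N tau sig0 (a + n) (lam * p / K * n / 2) ω} ⊆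
      ⋃ k : Fin K, ({ω | explorationCount N tau k (a + n) ω ≤ lam * p / K * n / 2} ∪
        {ω | lam * p / K * n / 2 ≤ explorationCount N tau k (a + n) ω ∧
        sig0 ^ 2 / 2 * explorationCount N tau k (a + n) ω <
          ‖explorationSum M N tau k (a + n) ω‖}) := by
    intro ω hω
    have h1 : ¬ WellExplored M N tau sig0 (a + n) (lam * p / K * n / 2) ω := hω
    rw [WellExplored] at h1
    push Not at h1
    obtain ⟨k, hk⟩ := h1
    refine Set.mem_iUnion.2 ⟨k, ?_⟩
    by_cases h : explorationCount N tau k (a + n) ω ≤ lam * p / K * n / 2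
    · exact Or.inl h
    · exact Or.inr ⟨(not_le.1 h).le, hk (not_le.1 h).le⟩
  refine (measure_mono hsub).trans ((measure_iUnion_fintype_le _ _).trans ?_)
  calc _ ≤ ∑ _ : Fin K, ENNReal.ofReal (Real.exp (-(lam * p / K * n / 8)) +
        2 * Real.exp (-(sig0 ^ 4 * (lam * p / K * n / 2) / 32))) :=
        Finset.sum_le_sum fun k _ => by
          rw [ENNReal.ofReal_add (by positivity) (by positivity)]
          exact (measure_union_le _ _).trans (add_le_add
            (measure_explorationCount_eps_le hK hl0 hl1 hp0 hp1 hN ha n k)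
            (measure_explorationSum_gt_le hA hK hl0 hl1 hp0 hp1 hN tau k (a + n) _))
    _ = _ := by
        rw [Finset.sum_const, Finset.card_univ, Fintype.card_fin, nsmul_eq_mul,
          ← ENNReal.ofReal_natCast, ← ENNReal.ofReal_mul (Nat.cast_nonneg _)]

/-- The uniform variable of a round falls into an interval of length `g` chosen before the round
with probability at most `g`. -/
lemma IsNoise.measure_unif_mem_Ioc_le {ν : Measure (Vec d)} [IsProbabilityMeasure ν]
    (hK : 0 < K) (hl0 : 0 ≤ lam) (hl1 : lam ≤ 1) (hp0 : 0 ≤ p) (hp1 : p ≤ 1)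
    (hN : IsNoise P ℱ ν lam p N) {t : ℕ} {r : Ω → ℝ} (hr : Measurable[ℱ t] r) (g : ℝ) :
    P {ω | r ω < N.unif (t + 1) ω ∧ N.unif (t + 1) ω ≤ r ω + g} ≤ ENNReal.ofReal g := by
  have := isProbabilityMeasure_bern hl0 hl1
  have := isProbabilityMeasure_bern hp0 hp1
  have := isProbabilityMeasure_uniformOn_univ_fin hK
  have := isProbabilityMeasure_roundLaw (ν := ν) hK hl0 hl1 hp0 hp1
  have hB : MeasurableSet {y : ℝ × RoundSpace d K |
      y.1 < y.2.2.2.2.2 ∧ y.2.2.2.2.2 ≤ y.1 + g} :=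
    have h1 : Measurable fun y : ℝ × RoundSpace d K => y.2.2.2.2.2 := by fun_prop
    (measurableSet_lt measurable_fst h1).inter
      (measurableSet_le h1 (measurable_fst.add_const g))
  set B := {y : ℝ × RoundSpace d K | y.1 < y.2.2.2.2.2 ∧ y.2.2.2.2.2 ≤ y.1 + g} with hBdef
  have h1 := hN.lintegral_round t hr (g := B.indicator fun _ => 1) (measurable_const.indicator hB)
  have hr' := hr.mono (ℱ.le t) le_rfl
  have hset : MeasurableSet {ω | (r ω, N.round (t + 1) ω) ∈ B} :=
    (hr'.prodMk (hN.measurable_round t)) hB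
  have e1 : P {ω | r ω < N.unif (t + 1) ω ∧ N.unif (t + 1) ω ≤ r ω + g} =
      ∫⁻ ω, B.indicator (fun _ => 1) (r ω, N.round (t + 1) ω) ∂P := by
    have : (fun ω => B.indicator (fun _ => (1 : ENNReal)) (r ω, N.round (t + 1) ω)) =
        {ω | (r ω, N.round (t + 1) ω) ∈ B}.indicator fun _ => 1 := by
      ext ω; rfl
    rw [this]
    exact ((lintegral_indicator_const hset 1).trans (one_mul _)).symm
  rw [e1, h1]
  calc _ ≤ ∫⁻ _, ENNReal.ofReal g ∂P := by
        refine lintegral_mono fun ω => ?_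
        have hm : Measurable fun z : RoundSpace d K => (r ω, z) := measurable_prodMk_left
        have e2 : (fun z : RoundSpace d K => B.indicator (fun _ => (1 : ENNReal)) (r ω, z)) =
            {z : RoundSpace d K | (r ω, z) ∈ B}.indicator fun _ => 1 := by
          ext z; rfl
        rw [e2]
        refine ((lintegral_indicator_const (hm hB) 1).trans (one_mul _)).trans_le ?_
        change roundLaw K ν lam p {z | (r ω, z) ∈ B} ≤ _
        have e3 : {z : RoundSpace d K | (r ω, z) ∈ B} = (Set.univ : Set Bool) ×ˢ
            ((Set.univ : Set (Vec d)) ×ˢ ((Set.univ : Set Bool) ×ˢ ((Set.univ : Set (Fin K)) ×ˢ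
              Set.Ioc (r ω) (r ω + g)))) := by
          ext z; simp [hBdef]
        rw [e3, roundLaw, Measure.prod_prod, Measure.prod_prod, Measure.prod_prod,
          Measure.prod_prod, measure_univ, measure_univ, measure_univ, measure_univ, one_mul,
          one_mul, one_mul, one_mul]
        refine (Measure.restrict_apply_le _ _).trans ?_
        rw [Real.volume_Ioc]
        simp
    _ = _ := by rw [lintegral_const, measure_univ, mul_one]

lemma measure_loss_le (hA : Assumptions M lam kap R S sig0 eps) (hK : 0 < K)
    (hl0 : 0 ≤ lam) (hl1 : lam ≤ 1) (hp0 : 0 ≤ p) (hp1 : p ≤ 1) (hkap : 4 ≤ kap)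
    (hlam0 : 0 < lam0) (hN : IsNoise P ℱ M.dist lam p N)
    (hπ : IsCQB M N π ℱ kap S lam0 delta tau est) {t T : ℕ} (htT : t ≤ T) {n : ℕ} {c : ℝ}
    (hc : 0 < c)
    (hsmall : 4 * radius d K kap S lam0 delta T < Real.sqrt (sig0 ^ 2 / 2 * c))
    (hn : n + 2 ≤ t) (htau : tau < t) :
    P {ω | Loss M N π t ω ∧ Regular M N π kap lam0 delta T ω ∧ WellExplored M N tau sig0 n c ω} ≤
      ENNReal.ofReal (p + 8 * radius d K kap S lam0 delta T / Real.sqrt (sig0 ^ 2 / 2 * c)) := by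
  have := hA.dist_prob
  set g := 8 * radius d K kap S lam0 delta T / Real.sqrt (sig0 ^ 2 / 2 * c) with hg
  obtain ⟨s, rfl⟩ : ∃ s, t = s + 1 + 1 := ⟨t - 2, by omega⟩
  have hsub : {ω | Loss M N π (s + 1 + 1) ω ∧ Regular M N π kap lam0 delta T ω ∧
      WellExplored M N tau sig0 n c ω} ⊆ {ω | N.coin (s + 1) ω = true} ∪
        {ω | servedRate M N π (s + 1 + 1) ω < N.unif (s + 1 + 1) ω ∧
          N.unif (s + 1 + 1) ω ≤ servedRate M N π (s + 1 + 1) ω + g} := by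
    rintro ω ⟨⟨h1, j, hj, k, h2⟩, hreg, hexp⟩
    by_cases hcoin : N.coin (s + 1) ω = true
    · exact Or.inl hcoin
    · refine Or.inr ⟨?_, h2.trans ?_⟩
      · rwa [servedRate_eq ⟨j, hj⟩]
      · exact serviceRate_le_of_wellExplored hA hkap hlam0 hπ htT hreg hexp hc hsmall hn htau
          hcoin hj k
  have hS : 0 ≤ S := (norm_nonneg _).trans (hA.theta_norm ⟨0, hK⟩)
  have hg0 : 0 ≤ g := by
    have := radius_nonneg (d := d) (K := K) (lam0 := lam0) (delta := delta) hA.kap_pos.le hS T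
    positivity
  rw [ENNReal.ofReal_add hp0 hg0]
  refine (measure_mono hsub).trans ((measure_union_le _ _).trans (add_le_add ?_ ?_))
  · exact hN.measure_coin_le hK hl0 hl1 hp0 hp1 s
  · exact hN.measure_unif_mem_Ioc_le hK hl0 hl1 hp0 hp1
      (measurable_servedRate hN hπ.adapted hπ.mem (s + 1)) g

end Probability

end GoodEvents

/-! ### From good events to expectations -/

/-- Integration of a bound by indicators of events, which need not be measurable; their measurable
hulls are integrated instead. -/
lemma integral_le_of_le_indicator {Ω ι : Type*} [MeasurableSpace Ω] {P : Measure Ω}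
    [IsProbabilityMeasure P] (s : Finset ι) {f : Ω → ℝ} (hf : Integrable f P) {x c : ℝ}
    (hc : 0 ≤ c) {A : ι → Set Ω} {B : Set Ω}
    (h : ∀ ω, f ω ≤ x + ∑ i ∈ s, (A i).indicator (fun _ => (1 : ℝ)) ω +
      c * B.indicator (fun _ => (1 : ℝ)) ω) :
    ∫ ω, f ω ∂P ≤ x + ∑ i ∈ s, P.real (A i) + c * P.real B := by
  have hint : ∀ C : Set Ω, Integrable ((toMeasurable P C).indicator fun _ => (1 : ℝ)) P := fun C =>
    (integrable_const _).indicator (measurableSet_toMeasurable _ _)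
  have hval : ∀ C : Set Ω, ∫ ω, (toMeasurable P C).indicator (fun _ => (1 : ℝ)) ω ∂P =
      P.real C := by
    intro C
    rw [integral_indicator_const _ (measurableSet_toMeasurable _ _), smul_eq_mul, mul_one,
      measureReal_def, measure_toMeasurable, measureReal_def]
  have hle : ∀ (C : Set Ω) (ω : Ω), C.indicator (fun _ => (1 : ℝ)) ω ≤
      (toMeasurable P C).indicator (fun _ => (1 : ℝ)) ω := fun C ω =>
    Set.indicator_le_indicator_of_subset (subset_toMeasurable P C) (fun _ => zero_le_one) ω
  have hsum : Integrable (fun ω => ∑ i ∈ s,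
      (toMeasurable P (A i)).indicator (fun _ => (1 : ℝ)) ω) P :=
    integrable_finsetSum _ fun i _ => hint _
  have hxs : Integrable (fun ω => x + ∑ i ∈ s,
      (toMeasurable P (A i)).indicator (fun _ => (1 : ℝ)) ω) P := (integrable_const _).add hsum
  calc ∫ ω, f ω ∂P ≤ ∫ ω, (x + ∑ i ∈ s, (toMeasurable P (A i)).indicator (fun _ => (1 : ℝ)) ω +
        c * (toMeasurable P B).indicator (fun _ => (1 : ℝ)) ω) ∂P := by
        refine integral_mono hf (hxs.add ((hint B).const_mul c))
          fun ω => (h ω).trans ?_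
        have h1 := hle B ω
        have h2 := Finset.sum_le_sum fun i (_ : i ∈ s) => hle (A i) ω
        gcongr
    _ = _ := by
        rw [integral_add hxs ((hint B).const_mul c),
          integral_add (integrable_const _) hsum, integral_const, integral_const_mul,
          integral_finsetSum _ fun i _ => hint _]
        simp only [hval, probReal_univ, smul_eq_mul, one_mul]

lemma measure_le_of_mul_le_lintegral {Ω : Type*} [MeasurableSpace Ω] {P : Measure Ω} {E : Set Ω}
    {f : Ω → ℝ} {y b : ℝ} (hy : 0 < y) (hf : ∀ ω ∈ E, y ≤ f ω) {E' : Set Ω} (hsub : E ⊆ E')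
    (h : ∫⁻ ω in E', ENNReal.ofReal (f ω) ∂P ≤ ENNReal.ofReal b) (hfm : Measurable f) :
    P E ≤ ENNReal.ofReal (b / y) := by
  have h1 := meas_ge_le_lintegral_div (μ := P.restrict E') hfm.ennreal_ofReal.aemeasurable
    (ε := ENNReal.ofReal y) (by simpa using hy) ENNReal.ofReal_ne_top
  have h2 : P E ≤ P.restrict E' {ω | ENNReal.ofReal y ≤ ENNReal.ofReal (f ω)} := by
    rw [Measure.restrict_apply (measurableSet_le measurable_const hfm.ennreal_ofReal)]
    exact measure_mono fun ω hω => ⟨ENNReal.ofReal_le_ofReal (hf ω hω), hsub hω⟩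
  refine h2.trans (h1.trans ((ENNReal.div_le_div_right h _).trans ?_))
  rw [ENNReal.ofReal_div_of_pos hy]

section Expectation

variable {Ω : Type*} {d K : ℕ} {M : Model d K} {N : Noise Ω d K} {π πopt : Schedule Ω K}
  {lam p kap R S sig0 eps lam0 delta tau : ℝ}
  [m : MeasurableSpace Ω] {P : Measure Ω} [IsProbabilityMeasure P] {ℱ : Filtration ℕ m}
  {est : ℕ → Fin K → Ω → Vec d}

lemma integrable_queueLength {ν : Measure (Vec d)} (hN : IsNoise P ℱ ν lam p N)
    (hπ : π.Adapted ℱ) (t : ℕ) : Integrable (queueLength M N π t) P := by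
  rcases Nat.eq_zero_or_pos t with h | h
  · subst h
    have : queueLength M N π 0 = fun _ => 0 := by ext ω; simp [queueLength]
    rw [this]
    exact integrable_zero _ _ _
  obtain ⟨s, rfl⟩ : ∃ s, t = s + 1 := ⟨t - 1, by omega⟩
  refine Integrable.of_bound
    ((measurable_queueLength hN hπ s).mono (ℱ.le _) le_rfl).aestronglyMeasurable
    ((s + 1 : ℕ) : ℝ) (Filter.Eventually.of_forall fun ω => ?_)
  rw [queueLength, Real.norm_of_nonneg (Nat.cast_nonneg _)]
  exact_mod_cast card_queue_le (s + 1) ω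

/-- The expected queue length after the pure-exploration phase of `a` rounds and `n` further rounds:
a level `x`, and the largest possible value `a + n + 1` in case the level is exceeded or a good event
fails. -/
lemma integral_queueLength_le (hA : Assumptions M lam kap R S sig0 eps) (hK : 0 < K)
    (hl0 : 0 ≤ lam) (hl1 : lam ≤ 1) (hp0 : 0 ≤ p) (hkap : 4 ≤ kap)
    (hlam0 : 0 < lam0) (he1 : eps ≤ 1) (hp : p ≤ eps / 64)
    (hN : IsNoise P ℱ M.dist lam p N)
    (hπ : IsCQB M N π ℱ kap S lam0 delta tau est) {a n n1 : ℕ} {c1 b x : ℝ}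
    (ha : 1 ≤ a) (htau : tau < a + 1) (hn1 : n1 + 1 ≤ a) (hc1 : 0 < c1)
    (hsmall : 4 * radius d K kap S lam0 delta (a + n + 1) < Real.sqrt (sig0 ^ 2 / 2 * c1))
    (hgap : 8 * radius d K kap S lam0 delta (a + n + 1) / Real.sqrt (sig0 ^ 2 / 2 * c1) ≤ eps / 2)
    (hx : 0 ≤ x) (hb : 0 ≤ b) (hbad : P {ω | ¬ (Regular M N π kap lam0 delta (a + n + 1) ω ∧
      WellExplored M N tau sig0 n1 c1 ω)} ≤ ENNReal.ofReal b) :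
    ∫ ω, queueLength M N π (a + n + 1) ω ∂P ≤ x + (a + n + 1 : ℕ) *
      (b + ((1 - eps ^ 2 / 64) ^ n * (2 * Real.exp (eps / 8 * (a + 1))) + 256 / eps ^ 2) /
        Real.exp (eps / 8 * x)) := by
  have := hA.dist_prob
  have he0 := hA.eps_pos
  have hρ : 0 ≤ 1 - eps ^ 2 / 64 := by nlinarith
  set E := {ω | ∀ i, a ≤ i → i ≤ a + n → Stable M N π lam eps (i + 1) ω} with hE
  set F := {ω | ω ∈ E ∧ x ≤ queueLength M N π (a + n + 1) ω} with hF
  set G := {ω | ¬ (Regular M N π kap lam0 delta (a + n + 1) ω ∧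
      WellExplored M N tau sig0 n1 c1 ω)} with hG
  have hFle : P F ≤ ENNReal.ofReal (((1 - eps ^ 2 / 64) ^ n * (2 * Real.exp (eps / 8 * (a + 1))) +
      256 / eps ^ 2) / Real.exp (eps / 8 * x)) := by
    refine measure_le_of_mul_le_lintegral (E' := E) (f := lyapunov M N π eps (a + n + 1))
      (Real.exp_pos _) (fun ω hω => ?_)
      (fun ω hω => hω.1)
      (setLIntegral_lyapunov_le hK hl0 hl1 hp0 hN hπ.adapted hπ.mem he0 he1 hp ha n)
      ((measurable_lyapunov hN hπ.adapted eps (by omega)).mono (ℱ.le _) le_rfl)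
    refine le_trans (Real.exp_le_exp.2 ?_) (exp_le_lyapunov he0.le _ _)
    exact mul_le_mul_of_nonneg_left hω.2 (by positivity)
  have hkey := integral_le_of_le_indicator (P := P) (∅ : Finset ℕ) (A := fun _ => ∅) (B := G ∪ F)
    (integrable_queueLength (M := M) hN hπ.adapted (a + n + 1)) (x := x)
    (c := ((a + n + 1 : ℕ) : ℝ)) (Nat.cast_nonneg _) ?_
  · refine hkey.trans ?_
    rw [Finset.sum_empty, add_zero]
    gcongr
    refine (measureReal_union_le _ _).trans (add_le_add ?_ ?_)
    · exact ENNReal.toReal_le_of_le_ofReal hb hbad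
    · exact ENNReal.toReal_le_of_le_ofReal (by positivity) hFle
  · intro ω
    rw [Finset.sum_empty, add_zero]
    have hQ : queueLength M N π (a + n + 1) ω ≤ ((a + n + 1 : ℕ) : ℝ) := by
      rw [queueLength]; exact_mod_cast card_queue_le (a + n + 1) ω
    by_cases hω : ω ∈ G ∪ F
    · rw [Set.indicator_of_mem hω]
      linarith
    · rw [Set.indicator_of_notMem hω]
      have h1 : Regular M N π kap lam0 delta (a + n + 1) ω ∧ WellExplored M N tau sig0 n1 c1 ω := by
        by_contra h; exact hω (Or.inl h)
      have h2 : ω ∈ E := fun i hi hi' => stable_of_wellExplored hA hkap hlam0 hπ (by omega) h1.1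
        h1.2 hc1 hsmall hgap (by omega) (htau.trans_le (by exact_mod_cast Nat.succ_le_succ hi))
      have h3 : ¬ x ≤ queueLength M N π (a + n + 1) ω := fun h => hω (Or.inr ⟨h2, h⟩)
      linarith [not_le.1 h3]

/-- The regret is caused by the losses of the last `l` rounds, each of probability at most `p` plus
the optimality gap, unless a good event fails or the queue stays nonempty in these rounds. -/
lemma integral_regret_le (hA : Assumptions M lam kap R S sig0 eps) (hK : 0 < K)
    (hl0 : 0 ≤ lam) (hl1 : lam ≤ 1) (hp0 : 0 ≤ p) (hkap : 4 ≤ kap)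
    (hlam0 : 0 < lam0) (he1 : eps ≤ 1) (hp : p ≤ eps / 64)
    (hN : IsNoise P ℱ M.dist lam p N)
    (hπ : IsCQB M N π ℱ kap S lam0 delta tau est) (hopt : IsOptimal M N πopt ℱ)
    {a n l n1 n2 : ℕ} {c1 c2 b : ℝ}
    (ha : 1 ≤ a) (htau : tau < a + 1) (hn1 : n1 + 1 ≤ a) (hn12 : n1 ≤ n2) (hn2 : n2 + 1 ≤ a + n)
    (hc1 : 0 < c1)
    (hsmall : 4 * radius d K kap S lam0 delta (a + n + l + 1) < Real.sqrt (sig0 ^ 2 / 2 * c1))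
    (hgap : 8 * radius d K kap S lam0 delta (a + n + l + 1) / Real.sqrt (sig0 ^ 2 / 2 * c1) ≤
      eps / 2)
    (hb : 0 ≤ b) (hbad : P {ω | ¬ (Regular M N π kap lam0 delta (a + n + l + 1) ω ∧
      WellExplored M N tau sig0 n1 c1 ω ∧ WellExplored M N tau sig0 n2 c2 ω)} ≤
      ENNReal.ofReal b) :
    ∫ ω, (queueLength M N π (a + n + l + 1) ω - queueLength M N πopt (a + n + l + 1) ω) ∂P ≤
      l * (p + 8 * radius d K kap S lam0 delta (a + n + l + 1) /
        Real.sqrt (sig0 ^ 2 / 2 * max c1 c2)) + (a + n + l + 1 : ℕ) *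
      (b + (1 - eps ^ 2 / 64) ^ l *
        ((1 - eps ^ 2 / 64) ^ n * (2 * Real.exp (eps / 8 * (a + 1))) + 256 / eps ^ 2)) := by
  classical
  have := hA.dist_prob
  have he0 := hA.eps_pos
  have hs0 := hA.sig0_pos
  have hρ : 0 ≤ 1 - eps ^ 2 / 64 := by nlinarith
  set T := a + n + l + 1 with hT
  set E := {ω | (∀ i, a ≤ i → i ≤ a + n + l → Stable M N π lam eps (i + 1) ω) ∧
        ∀ i, a + n ≤ i → i ≤ a + n + l → (queue M N π (i + 1) ω).Nonempty} with hE
  set G := {ω | ¬ (Regular M N π kap lam0 delta T ω ∧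
      WellExplored M N tau sig0 n1 c1 ω ∧ WellExplored M N tau sig0 n2 c2 ω)} with hG
  set g := 8 * radius d K kap S lam0 delta T / Real.sqrt (sig0 ^ 2 / 2 * max c1 c2) with hg
  let A : ℕ → Set Ω := fun t => {ω | Loss M N π t ω ∧ Regular M N π kap lam0 delta T ω ∧
    WellExplored M N tau sig0 n2 (max c1 c2) ω}
  have hsmall2 : 4 * radius d K kap S lam0 delta T < Real.sqrt (sig0 ^ 2 / 2 * max c1 c2) := by
    refine hsmall.trans_le (Real.sqrt_le_sqrt ?_)
    gcongr
    exact le_max_left _ _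
  have hS : 0 ≤ S := (norm_nonneg _).trans (hA.theta_norm ⟨0, hK⟩)
  have hg0 : 0 ≤ g := by
    have := radius_nonneg (d := d) (K := K) (lam0 := lam0) (delta := delta) hA.kap_pos.le hS T
    positivity
  have hEle : P E ≤ ENNReal.ofReal ((1 - eps ^ 2 / 64) ^ l *
        ((1 - eps ^ 2 / 64) ^ n * (2 * Real.exp (eps / 8 * (a + 1))) + 256 / eps ^ 2)) := by
    have h := setLIntegral_lyapunov_nonempty_le hK hl0 hl1 hp0 hN hπ.adapted hπ.mem he0 he1 hp ha
      n l
    refine le_trans ?_ h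
    rw [← setLIntegral_one]
    refine lintegral_mono fun ω => ?_
    rw [← ENNReal.ofReal_one]
    refine ENNReal.ofReal_le_ofReal ((Real.one_le_exp ?_).trans (exp_le_lyapunov he0.le _ _))
    have : 0 ≤ queueLength M N π (a + n + l + 1) ω := Nat.cast_nonneg _
    positivity
  have hkey := integral_le_of_le_indicator (P := P) (Finset.Ico (a + n + 1) T) (A := A)
    (B := G ∪ E) ((integrable_queueLength (M := M) hN hπ.adapted T).sub
      (integrable_queueLength (M := M) hN hopt.adapted T)) (x := 0)
    (c := (T : ℝ)) (Nat.cast_nonneg _) ?_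
  · refine hkey.trans ?_
    rw [zero_add]
    refine add_le_add ?_ ?_
    · calc _ ≤ ∑ _ ∈ Finset.Ico (a + n + 1) T, (p + g) := by
            refine Finset.sum_le_sum fun t ht => ?_
            rw [Finset.mem_Ico] at ht
            refine ENNReal.toReal_le_of_le_ofReal (by positivity) ?_
            refine measure_loss_le hA hK hl0 hl1 hp0 (by linarith) hkap hlam0 hN hπ ht.2.le
              (lt_max_of_lt_left hc1) hsmall2 (by omega) (htau.trans_le ?_)
            exact_mod_cast (by omega : a + 1 ≤ t)
        _ = _ := by
            rw [Finset.sum_const, Nat.card_Ico, nsmul_eq_mul]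
            congr 2
            omega
    · refine mul_le_mul_of_nonneg_left ?_ (Nat.cast_nonneg _)
      refine (measureReal_union_le _ _).trans (add_le_add ?_ ?_)
      · exact ENNReal.toReal_le_of_le_ofReal hb hbad
      · exact ENNReal.toReal_le_of_le_ofReal (by positivity) hEle
  · intro ω
    rw [zero_add, Pi.sub_apply]
    have hQ : queueLength M N π T ω ≤ T := by
      rw [queueLength]; exact_mod_cast card_queue_le T ω
    have hQ' : 0 ≤ queueLength M N πopt T ω := Nat.cast_nonneg _
    have hsum : 0 ≤ ∑ i ∈ Finset.Ico (a + n + 1) T, (A i).indicator (fun _ => (1 : ℝ)) ω :=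
      Finset.sum_nonneg fun i _ => Set.indicator_nonneg (fun _ _ => zero_le_one) _
    by_cases hω : ω ∈ G ∪ E
    · rw [Set.indicator_of_mem hω]
      linarith
    · rw [Set.indicator_of_notMem hω, mul_zero, add_zero]
      have h1 : Regular M N π kap lam0 delta T ω ∧ WellExplored M N tau sig0 n1 c1 ω ∧
          WellExplored M N tau sig0 n2 c2 ω := by
        by_contra h; exact hω (Or.inl h)
      have h2 : ∀ i, a ≤ i → i ≤ a + n + l → Stable M N π lam eps (i + 1) ω := fun i hi hi' =>
        stable_of_wellExplored hA hkap hlam0 hπ (by omega) h1.1 h1.2.1 hc1 hsmall hgap (by omega)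
          (htau.trans_le (by exact_mod_cast Nat.succ_le_succ hi))
      have h3 : ∃ s, a + n + 1 ≤ s ∧ s ≤ T ∧ queue M N π s ω = ∅ := by
        by_contra hno
        push Not at hno
        refine hω (Or.inr ⟨h2, fun i hi hi' => ?_⟩)
        exact hno (i + 1) (by omega) (by omega)
      obtain ⟨s, hs1, hsT, hs⟩ := h3
      have h4 := card_queue_le_add_losses hπ.mem hopt (by omega) hs hsT
      have h5 : (((Finset.Ico s T).filter fun t => Loss M N π t ω).card : ℝ) ≤
          ∑ i ∈ Finset.Ico (a + n + 1) T, (A i).indicator (fun _ => (1 : ℝ)) ω := by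
        rw [Finset.card_filter]
        push_cast
        refine (Finset.sum_le_sum_of_subset_of_nonneg (Finset.Ico_subset_Ico hs1 le_rfl)
          fun _ _ _ => by split_ifs <;> norm_num).trans (Finset.sum_le_sum fun t _ => ?_)
        split_ifs with hl
        · rw [Set.indicator_of_mem (show ω ∈ A t from ⟨hl, h1.1, h1.2.1.max h1.2.2 hn12⟩)]
        · exact Set.indicator_nonneg (fun _ _ => zero_le_one) _
      have h6 : queueLength M N π T ω ≤ queueLength M N πopt T ω +
          ((Finset.Ico s T).filter fun t => Loss M N π t ω).card := by
        rw [queueLength, queueLength]; exact_mod_cast h4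
      linarith

end Expectation

/-! ### Orders of magnitude -/

/-- The numerical conditions under which the regret is bounded. The factor `66` of the length of
pure exploration makes the exploration data of that phase sufficient for a positive service slack. -/
structure Admissible (d K T : ℕ) (lam kap S lam0 sig0 eps delta a : ℝ) : Prop where
  one_le_d : 1 ≤ d
  one_le_K : 1 ≤ K
  lam_pos : 0 < lam
  lam_lt_one : lam < 1
  four_le_kap : 4 ≤ kap
  S_nonneg : 0 ≤ S
  lam0_pos : 0 < lam0
  sig0_pos : 0 < sig0
  sig0_le_one : sig0 ≤ 1
  eps_pos : 0 < eps
  eps_le_one : eps ≤ 1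
  a_nonneg : 0 ≤ a
  delta_ge : (T : ℝ) ^ (-a) ≤ delta
  delta_pos : 0 < delta
  delta_le : delta ≤ (T : ℝ) ^ (-2 : ℝ)
  T_gt : 4 / eps ^ 2 < (T : ℝ)
  length_le : explorationLength 66 d K T lam kap S lam0 sig0 eps delta ≤ T

/-- The confidence radius at the horizon is at most this multiple of `√(d log T)`. -/
noncomputable def radiusConst (K : ℕ) (kap S lam0 a : ℝ) : ℝ :=
  kap / 2 * Real.sqrt (2 * (1 / (kap * lam0) + 1) + K + a) + kap * S * Real.sqrt lam0 / 2

/-- Pure exploration takes at most this multiple of `d log T / (σ₀⁴ ε²)` rounds. -/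
noncomputable def lengthConst (K : ℕ) (lam kap S lam0 a : ℝ) : ℝ :=
  2 * 66 * K / lam * (1 + K + a + 64 * radiusConst K kap S lam0 a ^ 2) + a / (2 * lam ^ 2)

lemma sub_two_mul_one_div_sqrt_le (x : ℝ) (T : ℕ) : x - 2 * (1 / Real.sqrt T) ≤ x := by
  have : 0 ≤ 1 / Real.sqrt T := by positivity
  linarith

namespace Admissible

variable {d K T : ℕ} {lam kap S lam0 sig0 eps delta a : ℝ}
  (h : Admissible d K T lam kap S lam0 sig0 eps delta a)

include h

lemma four_lt : (4 : ℝ) < T := by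
  have h1 := h.eps_pos
  refine lt_of_le_of_lt ?_ h.T_gt
  rw [le_div_iff₀ (by positivity)]
  nlinarith [h.eps_le_one]

lemma one_le_log : 1 ≤ Real.log T := by
  have h4 := h.four_lt
  rw [Real.le_log_iff_exp_le (by linarith)]
  have := Real.exp_one_lt_d9
  linarith

lemma cast_d : (1 : ℝ) ≤ d := by exact_mod_cast h.one_le_d

lemma cast_K : (1 : ℝ) ≤ K := by exact_mod_cast h.one_le_K

lemma log_delta_le : Real.log (1 / delta) ≤ a * Real.log T := by
  have h4 := h.four_lt
  have h1 := Real.log_le_log (Real.rpow_pos_of_pos (by linarith) _) h.delta_ge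
  rw [Real.log_rpow (by linarith)] at h1
  rw [one_div, Real.log_inv]
  linarith

lemma log_delta_ge : 2 * Real.log T ≤ Real.log (1 / delta) := by
  have h4 := h.four_lt
  have h1 := Real.log_le_log h.delta_pos h.delta_le
  rw [Real.log_rpow (by linarith)] at h1
  rw [one_div, Real.log_inv]
  linarith

lemma log_div_eq : Real.log (K / delta) = Real.log K + Real.log (1 / delta) := by
  have hK := h.cast_K
  have := h.delta_pos
  rw [← Real.log_mul (by linarith) (by positivity), mul_one_div]

lemma log_div_ge : 2 * Real.log T ≤ Real.log (K / delta) := by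
  rw [h.log_div_eq]
  have := Real.log_nonneg h.cast_K
  have := h.log_delta_ge
  linarith

lemma log_div_le : Real.log (K / delta) ≤ (K + a) * Real.log T := by
  rw [h.log_div_eq]
  have h1 := Real.log_le_self (zero_le_one.trans h.cast_K)
  have := h.log_delta_le
  nlinarith [h.one_le_log, h.cast_K]

lemma radius_sq_ge : 8 * Real.log T ≤ radius d K kap S lam0 delta T ^ 2 := by
  have hl := h.one_le_log
  have hk := h.four_le_kap
  have hS := h.S_nonneg
  have hl0 := h.lam0_pos
  have h0 : 0 ≤ Real.log (1 + 1 / (kap * lam0 * d) * T) := by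
    apply Real.log_nonneg
    have : 0 ≤ 1 / (kap * lam0 * d) * (T : ℝ) := by positivity
    linarith
  have h1 : Real.sqrt (2 * Real.log T) ≤ Real.sqrt (2 * d *
      Real.log (1 + 1 / (kap * lam0 * d) * T) + Real.log (K / delta)) := by
    apply Real.sqrt_le_sqrt
    have := h.log_div_ge
    have : 0 ≤ 2 * d * Real.log (1 + 1 / (kap * lam0 * d) * T) := by positivity
    linarith
  have h2 : 2 * Real.sqrt (2 * Real.log T) ≤ radius d K kap S lam0 delta T := by
    unfold radius
    have : 2 * Real.sqrt (2 * Real.log T) ≤ kap / 2 * Real.sqrt (2 * d *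
      Real.log (1 + 1 / (kap * lam0 * d) * T) + Real.log (K / delta)) := by
      apply mul_le_mul (by linarith) h1 (Real.sqrt_nonneg _) (by linarith)
    have : 0 ≤ kap * S * Real.sqrt lam0 / 2 := by positivity
    linarith
  calc 8 * Real.log T = (2 * Real.sqrt (2 * Real.log T)) ^ 2 := by
        rw [mul_pow, Real.sq_sqrt (by linarith)]; ring
    _ ≤ _ := by gcongr

lemma radius_pos : 0 < radius d K kap S lam0 delta T := by
  have h1 := h.radius_sq_ge
  have hk : 0 ≤ kap := by linarith [h.four_le_kap]
  have h2 := radius_nonneg (d := d) (K := K) (lam0 := lam0) (delta := delta) hk h.S_nonneg T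
  have := h.one_le_log
  rcases h2.eq_or_lt with h3 | h3
  · rw [← h3] at h1; nlinarith
  · exact h3

lemma radiusConst_nonneg : 0 ≤ radiusConst K kap S lam0 a := by
  have hk := h.four_le_kap
  have hS := h.S_nonneg
  unfold radiusConst
  positivity

lemma radius_le : radius d K kap S lam0 delta T ≤
    radiusConst K kap S lam0 a * Real.sqrt (d * Real.log T) := by
  have hl := h.one_le_log
  have hk := h.four_le_kap
  have hS := h.S_nonneg
  have hl0 := h.lam0_pos
  have hd := h.cast_d
  have h4 := h.four_lt
  have ha := h.a_nonneg
  have hkl : 0 < kap * lam0 := by positivity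
  have h1 : Real.log (1 + 1 / (kap * lam0 * d) * T) ≤ (1 / (kap * lam0) + 1) * Real.log T := by
    have e1 : 1 + 1 / (kap * lam0 * d) * T ≤ (1 / (kap * lam0) + 1) * T := by
      have : 1 / (kap * lam0 * d) ≤ 1 / (kap * lam0) := by
        apply one_div_le_one_div_of_le hkl
        nlinarith
      nlinarith
    have hpos : 0 ≤ 1 / (kap * lam0) := by positivity
    calc _ ≤ Real.log ((1 / (kap * lam0) + 1) * T) := by
          apply Real.log_le_log _ e1
          positivity
      _ = Real.log (1 / (kap * lam0) + 1) + Real.log T :=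
          Real.log_mul (by positivity) (by positivity)
      _ ≤ 1 / (kap * lam0) + Real.log T := by
          have := Real.log_le_sub_one_of_pos (show 0 < 1 / (kap * lam0) + 1 by positivity)
          linarith
      _ ≤ _ := by nlinarith
  have h2 : 2 * d * Real.log (1 + 1 / (kap * lam0 * d) * T) + Real.log (K / delta) ≤
      (2 * (1 / (kap * lam0) + 1) + K + a) * (d * Real.log T) := by
    have e2 := h.log_div_le
    have e3 : (K + a) * Real.log T ≤ (K + a) * (d * Real.log T) := by
      apply mul_le_mul_of_nonneg_left _ (by positivity)
      nlinarith
    have e4 := mul_le_mul_of_nonneg_left h1 (by positivity : (0 : ℝ) ≤ 2 * d)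
    nlinarith
  have h3 : 1 ≤ Real.sqrt (d * Real.log T) := by
    rw [Real.one_le_sqrt]; nlinarith
  unfold radius radiusConst
  rw [add_mul]
  refine add_le_add ?_ ?_
  · rw [mul_assoc (kap / 2), ← Real.sqrt_mul (by positivity)]
    gcongr
  · exact le_mul_of_one_le_right (by positivity) h3

lemma radius_sq_le : radius d K kap S lam0 delta T ^ 2 ≤
    radiusConst K kap S lam0 a ^ 2 * (d * Real.log T) := by
  have hl := h.one_le_log
  have h1 := h.radius_le
  have h2 := h.radius_pos.le
  calc _ ≤ (radiusConst K kap S lam0 a * Real.sqrt (d * Real.log T)) ^ 2 := by gcongr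
    _ = _ := by rw [mul_pow, Real.sq_sqrt (by positivity)]

lemma slack_pos : 0 < eps - 2 * (1 / Real.sqrt T) := by
  have h1 := h.eps_pos
  have h2 : 2 / eps < Real.sqrt T := by
    apply Real.lt_sqrt_of_sq_lt
    have := h.T_gt
    rw [div_pow]; norm_num; exact this
  have h3 : 0 < Real.sqrt T := by have := div_pos two_pos h1; linarith
  rw [mul_one_div, sub_pos, div_lt_iff₀ h3]
  rw [div_lt_iff₀ h1] at h2
  linarith

/-- The two requirements that determine the length of pure exploration. -/
lemma length_ge : 66 * ((d + Real.log (K / delta)) / sig0 ^ 4 +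
    16 * radius d K kap S lam0 delta T ^ 2 / (sig0 ^ 2 * (eps - 2 * (1 / Real.sqrt T)) ^ 2)) ≤
    lam * explorationLength 66 d K T lam kap S lam0 sig0 eps delta / (2 * K) := by
  have hl := h.lam_pos
  have hK := h.cast_K
  have h1 := h.log_delta_ge
  have h2 := h.one_le_log
  have h3 : 0 ≤ Real.log (1 / delta) / (2 * lam ^ 2) := div_nonneg (by linarith) (by positivity)
  rw [le_div_iff₀ (by positivity)]
  unfold explorationLength
  set Y := (d + Real.log (K / delta)) / sig0 ^ 4 +
    16 * radius d K kap S lam0 delta T ^ 2 / (sig0 ^ 2 * (eps - 2 * (1 / Real.sqrt T)) ^ 2)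
  have h4 : lam * (2 * 66 * K / lam * Y) = 66 * Y * (2 * K) := by field_simp
  nlinarith [mul_nonneg hl.le h3]

/-- The same requirements without the loss by rare arrivals and by the division among servers. -/
lemma length_ge' : 132 * ((d + Real.log (K / delta)) / sig0 ^ 4 +
    16 * radius d K kap S lam0 delta T ^ 2 / (sig0 ^ 2 * (eps - 2 * (1 / Real.sqrt T)) ^ 2)) ≤
    explorationLength 66 d K T lam kap S lam0 sig0 eps delta := by
  have hl := h.lam_pos
  have hl1 := h.lam_lt_one
  have hK := h.cast_K
  have h0 := h.length_ge
  have h1 := h.log_div_ge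
  have h2 := h.one_le_log
  set Y := (d + Real.log (K / delta)) / sig0 ^ 4 +
    16 * radius d K kap S lam0 delta T ^ 2 / (sig0 ^ 2 * (eps - 2 * (1 / Real.sqrt T)) ^ 2)
  have hY : 0 ≤ Y := by
    have : 0 ≤ Real.log (K / delta) := by linarith
    positivity
  set τ := explorationLength 66 d K T lam kap S lam0 sig0 eps delta
  rw [le_div_iff₀ (by positivity)] at h0
  have h3 : 132 * Y ≤ 66 * Y * (2 * K) := by nlinarith
  have h4 : 0 ≤ lam * τ := by nlinarith
  have h5 : 0 ≤ τ := by
    by_contra hneg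
    nlinarith [mul_neg_of_pos_of_neg hl (not_le.1 hneg)]
  nlinarith

lemma log_le_length : 16896 * Real.log T ≤
    explorationLength 66 d K T lam kap S lam0 sig0 eps delta *
      (eps - 2 * (1 / Real.sqrt T)) ^ 2 := by
  have hs := h.sig0_pos
  have hs1 := h.sig0_le_one
  have hη := h.slack_pos
  have h0 := h.length_ge'
  have h1 := h.log_div_ge
  have h2 := h.one_le_log
  have h3 := h.radius_sq_ge
  set η := eps - 2 * (1 / Real.sqrt T)
  have h4 : 0 ≤ (d + Real.log (K / delta)) / sig0 ^ 4 := by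
    have : 0 ≤ Real.log (K / delta) := by linarith
    positivity
  have h5 : 16 * (8 * Real.log T) / η ^ 2 ≤
      16 * radius d K kap S lam0 delta T ^ 2 / (sig0 ^ 2 * η ^ 2) := by
    apply div_le_div₀ (by positivity) (by linarith) (by positivity)
    exact mul_le_of_le_one_left (by positivity) (pow_le_one₀ hs.le hs1)
  have h6 : 132 * (16 * (8 * Real.log T) / η ^ 2) ≤
      explorationLength 66 d K T lam kap S lam0 sig0 eps delta := by linarith
  have h7 := mul_le_mul_of_nonneg_right h6 (sq_nonneg η)
  have h8 : 132 * (16 * (8 * Real.log T) / η ^ 2) * η ^ 2 = 16896 * Real.log T := by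
    field_simp; norm_num
  linarith

lemma one_div_sqrt_le : 1 / Real.sqrt T ≤ eps / 64 := by
  have h1 := h.log_le_length
  have h2 := h.one_le_log
  have h3 := h.length_le
  have hη := h.slack_pos
  have hηe := sub_two_mul_one_div_sqrt_le eps T
  set η := eps - 2 * (1 / Real.sqrt T)
  have h4 : (64 : ℝ) ^ 2 ≤ T * η ^ 2 := by
    have := mul_le_mul_of_nonneg_right h3 (sq_nonneg η)
    linarith
  have h5 : 64 ≤ Real.sqrt T * η := by
    have h6 := Real.sqrt_le_sqrt h4
    rw [Real.sqrt_sq (by norm_num), Real.sqrt_mul (Nat.cast_nonneg _), Real.sqrt_sq hη.le] at h6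
    exact h6
  have h7 : 0 < Real.sqrt T := Real.sqrt_pos.2 (by linarith [h.four_lt])
  rw [div_le_div_iff₀ h7 (by norm_num)]
  nlinarith

lemma half_le_slack : eps / 2 ≤ eps - 2 * (1 / Real.sqrt T) := by
  have := h.one_div_sqrt_le
  have := h.eps_pos
  linarith

lemma log_div_sq_le_length : 16896 * (Real.log T / eps ^ 2) ≤
    explorationLength 66 d K T lam kap S lam0 sig0 eps delta := by
  have h1 := h.log_le_length
  have h2 := h.one_le_log
  have he := h.eps_pos
  have hη := h.slack_pos
  have h3 := sub_two_mul_one_div_sqrt_le eps T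
  rw [← mul_div_assoc, div_le_iff₀ (by positivity)]
  refine h1.trans ?_
  have h4 : 0 ≤ explorationLength 66 d K T lam kap S lam0 sig0 eps delta := by
    by_contra hneg
    nlinarith [mul_nonpos_of_nonpos_of_nonneg (not_le.1 hneg).le
      (sq_nonneg (eps - 2 * (1 / Real.sqrt T)))]
  gcongr

lemma log_div_le_length : Real.log T / eps ≤
    explorationLength 66 d K T lam kap S lam0 sig0 eps delta := by
  refine le_trans ?_ h.log_div_sq_le_length
  have h2 := h.one_le_log
  have he := h.eps_pos
  have h1 := h.eps_le_one
  have h3 : Real.log T / eps ≤ Real.log T / eps ^ 2 := by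
    apply div_le_div_of_nonneg_left (by linarith) (by positivity)
    nlinarith
  have h4 : 0 ≤ Real.log T / eps ^ 2 := by positivity
  linarith

lemma one_le_log_div : 1 ≤ Real.log T / eps ^ 2 := by
  have h2 := h.one_le_log
  have he := h.eps_pos
  rw [le_div_iff₀ (by positivity)]
  nlinarith [h.eps_le_one]

lemma le_length : 16896 ≤ explorationLength 66 d K T lam kap S lam0 sig0 eps delta := by
  have := h.log_div_sq_le_length
  have := h.one_le_log_div
  linarith

lemma lengthConst_nonneg : 0 ≤ lengthConst K lam kap S lam0 a := by
  have := h.lam_pos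
  have := h.a_nonneg
  unfold lengthConst
  positivity

lemma length_le_const : explorationLength 66 d K T lam kap S lam0 sig0 eps delta ≤
    lengthConst K lam kap S lam0 a * (d * Real.log T / sig0 ^ 4 / eps ^ 2) := by
  have hl := h.lam_pos
  have hs := h.sig0_pos
  have he := h.eps_pos
  have hs1 := h.sig0_le_one
  have he1 := h.eps_le_one
  have hℓ := h.one_le_log
  have hd := h.cast_d
  have ha := h.a_nonneg
  have hη := h.half_le_slack
  have hdℓ : (1 : ℝ) ≤ d * Real.log T := by nlinarith
  set X := d * Real.log T / sig0 ^ 4 / eps ^ 2 with hX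
  set B := radiusConst K kap S lam0 a with hB
  have hs4 : sig0 ^ 4 ≤ 1 := pow_le_one₀ hs.le hs1
  have hs24 : sig0 ^ 4 ≤ sig0 ^ 2 := pow_le_pow_of_le_one hs.le hs1 (by norm_num)
  have he2 : eps ^ 2 ≤ 1 := pow_le_one₀ he.le he1
  have hXge : d * Real.log T / sig0 ^ 4 ≤ X := by
    rw [hX, le_div_iff₀ (by positivity)]
    exact mul_le_of_le_one_right (by positivity) he2
  have hXge2 : d * Real.log T ≤ X := by
    refine le_trans ?_ hXge
    rw [le_div_iff₀ (by positivity)]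
    exact mul_le_of_le_one_right (by positivity) hs4
  have h1 : (d + Real.log (K / delta)) / sig0 ^ 4 ≤ (1 + K + a) * X := by
    have e1 : d + Real.log (K / delta) ≤ (1 + K + a) * (d * Real.log T) := by
      have := h.log_div_le
      have e2 : (K + a) * Real.log T ≤ (K + a) * (d * Real.log T) := by
        apply mul_le_mul_of_nonneg_left _ (by positivity)
        nlinarith
      nlinarith
    calc _ ≤ (1 + K + a) * (d * Real.log T) / sig0 ^ 4 := by gcongr
      _ = (1 + K + a) * (d * Real.log T / sig0 ^ 4) := by ring
      _ ≤ _ := by gcongr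
  have h2 : 16 * radius d K kap S lam0 delta T ^ 2 /
      (sig0 ^ 2 * (eps - 2 * (1 / Real.sqrt T)) ^ 2) ≤ 64 * B ^ 2 * X := by
    have e1 := h.radius_sq_le
    calc _ ≤ 16 * (B ^ 2 * (d * Real.log T)) / (sig0 ^ 4 * (eps / 2) ^ 2) := by
          gcongr
      _ = _ := by rw [hX]; field_simp; ring
  have h3 : Real.log (1 / delta) / (2 * lam ^ 2) ≤ a / (2 * lam ^ 2) * X := by
    have e1 := h.log_delta_le
    calc _ ≤ a * Real.log T / (2 * lam ^ 2) := by gcongr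
      _ = a / (2 * lam ^ 2) * Real.log T := by ring
      _ ≤ _ := by
        gcongr
        nlinarith
  unfold explorationLength lengthConst
  rw [add_mul]
  refine add_le_add ?_ h3
  have h4 := add_le_add h1 h2
  rw [← add_mul] at h4
  exact (mul_le_mul_of_nonneg_left h4 (by positivity)).trans_eq (mul_assoc _ _ _).symm

end Admissible

/-! ### Sufficiency of the exploration data -/

namespace Admissible

variable {d K T : ℕ} {lam kap S lam0 sig0 eps delta a : ℝ}
  (h : Admissible d K T lam kap S lam0 sig0 eps delta a)

include h

lemma exp_neg_le {y : ℝ} (n : ℕ) (hy : n * Real.log T ≤ y) :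
    Real.exp (-y) ≤ 1 / (T : ℝ) ^ n := by
  have h4 := h.four_lt
  calc Real.exp (-y) ≤ Real.exp (-(n * Real.log T)) := by gcongr
    _ = _ := by
      rw [Real.exp_neg, Real.exp_nat_mul, Real.exp_log (by linarith), one_div]

lemma delta_le' : delta ≤ 1 / (T : ℝ) ^ 2 := by
  have h4 := h.four_lt
  refine h.delta_le.trans (le_of_eq ?_)
  rw [Real.rpow_neg (by linarith), one_div]
  norm_cast

lemma le_floor : 1 ≤ ⌊explorationLength 66 d K T lam kap S lam0 sig0 eps delta⌋₊ :=
  Nat.le_floor (by have := h.le_length; push_cast; linarith)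

/-- The expected number of pure-exploration data of a server, halved and lowered by the
imbalance of the round-robin order. -/
lemma pure_count_ge : 64 * ((d + Real.log (K / delta)) / sig0 ^ 4 +
    16 * radius d K kap S lam0 delta T ^ 2 / (sig0 ^ 2 * (eps - 2 * (1 / Real.sqrt T)) ^ 2)) ≤
    lam * (⌊explorationLength 66 d K T lam kap S lam0 sig0 eps delta⌋₊ - 1 : ℕ) / (2 * K) - 1 := by
  have hl := h.lam_pos
  have hl1 := h.lam_lt_one
  have hK := h.cast_K
  have h0 := h.length_ge
  have h1 := h.log_div_ge
  have h2 := h.one_le_log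
  have hs := h.sig0_pos
  have hf := h.le_floor
  have hs4 : sig0 ^ 4 ≤ 1 := pow_le_one₀ hs.le h.sig0_le_one
  set Y1 := (d + Real.log (K / delta)) / sig0 ^ 4 with hY1
  set Y2 := 16 * radius d K kap S lam0 delta T ^ 2 /
    (sig0 ^ 2 * (eps - 2 * (1 / Real.sqrt T)) ^ 2) with hY2
  have hY1' : 1 ≤ Y1 := by
    rw [hY1, le_div_iff₀ (by positivity)]
    linarith [h.cast_d]
  have hY2' : 0 ≤ Y2 := by positivity
  set τ := explorationLength 66 d K T lam kap S lam0 sig0 eps delta with hτ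
  have h3 : τ - 2 ≤ ((⌊τ⌋₊ - 1 : ℕ) : ℝ) := by
    rw [Nat.cast_sub hf]
    have := Nat.lt_floor_add_one τ
    push_cast
    linarith
  have h4 : lam * (τ - 2) / (2 * K) ≤ lam * ((⌊τ⌋₊ - 1 : ℕ) : ℝ) / (2 * K) := by gcongr
  have h5 : lam * (τ - 2) / (2 * K) = lam * τ / (2 * K) - lam / K := by field_simp
  have h6 : lam / K ≤ 1 := by rw [div_le_one (by linarith)]; linarith
  linarith

lemma pure_count_pos : 0 <
    lam * (⌊explorationLength 66 d K T lam kap S lam0 sig0 eps delta⌋₊ - 1 : ℕ) / (2 * K) - 1 := by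
  have h1 := h.log_div_ge
  have h2 := h.one_le_log
  have hs := h.sig0_pos
  have hd := h.cast_d
  refine lt_of_lt_of_le ?_ h.pure_count_ge
  have : 0 < d + Real.log (K / delta) := by linarith
  positivity

lemma sqrt_pure_count_ge : 16 * radius d K kap S lam0 delta T / (eps - 2 * (1 / Real.sqrt T)) ≤
    Real.sqrt (sig0 ^ 2 / 2 * (lam *
      (⌊explorationLength 66 d K T lam kap S lam0 sig0 eps delta⌋₊ - 1 : ℕ) / (2 * K) - 1)) := by
  have h0 := h.pure_count_ge
  have h1 := h.log_div_ge
  have h2 := h.one_le_log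
  have hs := h.sig0_pos
  have hη := h.slack_pos
  have hd := h.cast_d
  set η := eps - 2 * (1 / Real.sqrt T)
  apply Real.le_sqrt_of_sq_le
  have h3 : 0 ≤ (d + Real.log (K / delta)) / sig0 ^ 4 := div_nonneg (by linarith) (by positivity)
  calc _ = sig0 ^ 2 / 2 * (32 * (16 * radius d K kap S lam0 delta T ^ 2 /
        (sig0 ^ 2 * η ^ 2))) := by field_simp; ring
    _ ≤ _ := by
      have h4 : 0 ≤ 16 * radius d K kap S lam0 delta T ^ 2 / (sig0 ^ 2 * η ^ 2) := by positivity
      gcongr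
      linarith

lemma pure_small : 4 * radius d K kap S lam0 delta T <
    Real.sqrt (sig0 ^ 2 / 2 * (lam *
      (⌊explorationLength 66 d K T lam kap S lam0 sig0 eps delta⌋₊ - 1 : ℕ) / (2 * K) - 1)) := by
  refine lt_of_lt_of_le ?_ h.sqrt_pure_count_ge
  have hη := h.slack_pos
  have h1 := sub_two_mul_one_div_sqrt_le eps T
  have h2 := h.eps_le_one
  have hβ := h.radius_pos
  rw [lt_div_iff₀ hη]
  nlinarith

lemma pure_gap : 8 * radius d K kap S lam0 delta T /
    Real.sqrt (sig0 ^ 2 / 2 * (lam *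
      (⌊explorationLength 66 d K T lam kap S lam0 sig0 eps delta⌋₊ - 1 : ℕ) / (2 * K) - 1)) ≤
    eps / 2 := by
  have hη := h.slack_pos
  have h1 := sub_two_mul_one_div_sqrt_le eps T
  have hβ := h.radius_pos
  have h3 := h.sqrt_pure_count_ge
  have h4 := h.pure_small
  rw [div_le_iff₀ (by linarith)]
  rw [div_le_iff₀ hη] at h3
  have := mul_le_mul_of_nonneg_left h1 (by linarith : 0 ≤ Real.sqrt (sig0 ^ 2 / 2 * (lam *
      (⌊explorationLength 66 d K T lam kap S lam0 sig0 eps delta⌋₊ - 1 : ℕ) / (2 * K) - 1)))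
  linarith

lemma pure_fail_le : Real.exp (-(lam *
      (⌊explorationLength 66 d K T lam kap S lam0 sig0 eps delta⌋₊ - 1 : ℕ) / 8)) +
    K * (2 * Real.exp (-(sig0 ^ 4 * (lam *
      (⌊explorationLength 66 d K T lam kap S lam0 sig0 eps delta⌋₊ - 1 : ℕ) / (2 * K) - 1) / 32))) ≤
    (1 + 2 * K) / (T : ℝ) ^ 2 := by
  have h0 := h.pure_count_ge
  have h1 := h.log_div_ge
  have h2 := h.one_le_log
  have hs := h.sig0_pos
  have hs1 := h.sig0_le_one
  have hK := h.cast_K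
  have hd := h.cast_d
  have hl := h.lam_pos
  have hs4 : sig0 ^ 4 ≤ 1 := pow_le_one₀ hs.le hs1
  set n1 := (⌊explorationLength 66 d K T lam kap S lam0 sig0 eps delta⌋₊ - 1 : ℕ)
  set c1 := lam * n1 / (2 * K) - 1 with hc1
  have hY2 : 0 ≤ 16 * radius d K kap S lam0 delta T ^ 2 /
    (sig0 ^ 2 * (eps - 2 * (1 / Real.sqrt T)) ^ 2) := by positivity
  have h3 : 64 * (2 * Real.log T) ≤ sig0 ^ 4 * c1 := by
    have h4 : 64 * ((d + Real.log (K / delta)) / sig0 ^ 4) ≤ c1 := by linarith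
    have h5 := mul_le_mul_of_nonneg_left h4 (by positivity : 0 ≤ sig0 ^ 4)
    have h6 : sig0 ^ 4 * (64 * ((d + Real.log (K / delta)) / sig0 ^ 4)) =
        64 * (d + Real.log (K / delta)) := by field_simp
    linarith
  have hc1' : 128 * Real.log T ≤ c1 := by
    have : 0 ≤ c1 := by
      by_contra hneg
      nlinarith [mul_nonpos_of_nonneg_of_nonpos (by positivity : 0 ≤ sig0 ^ 4) (not_le.1 hneg).le]
    nlinarith
  have h7 : c1 ≤ lam * n1 := by
    have : lam * n1 / (2 * K) ≤ lam * n1 := div_le_self (by positivity) (by linarith)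
    linarith
  have e1 := h.exp_neg_le 2 (y := lam * n1 / 8) (by push_cast; linarith)
  have e2 := h.exp_neg_le 2 (y := sig0 ^ 4 * c1 / 32) (by push_cast; linarith)
  calc _ ≤ 1 / (T : ℝ) ^ 2 + K * (2 * (1 / (T : ℝ) ^ 2)) := by gcongr
    _ = _ := by ring

/-- The data of the `ε`-exploration rounds of a quarter of the horizon. -/
lemma eps_count_ge {n : ℕ} (hn : (T : ℝ) / 4 ≤ n) :
    lam * Real.sqrt T / (8 * K) ≤ lam * (1 / Real.sqrt T) / K * n / 2 := by
  have hK := h.cast_K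
  have hl := h.lam_pos
  have h4 := h.four_lt
  have h1 : 0 < Real.sqrt T := Real.sqrt_pos.2 (by linarith)
  have h2 : Real.sqrt T ^ 2 = T := Real.sq_sqrt (by linarith)
  calc lam * Real.sqrt T / (8 * K) = lam * (1 / Real.sqrt T) / K * (Real.sqrt T ^ 2 / 4) / 2 := by
        field_simp; norm_num
    _ ≤ _ := by rw [h2]; gcongr

lemma eps_fail_le {n : ℕ} (hn : (T : ℝ) / 4 ≤ n)
    (hT : 512 * K / lam * (Real.log T / sig0 ^ 4) ≤ Real.sqrt T) :
    K * (Real.exp (-(lam * (1 / Real.sqrt T) / K * n / 8)) +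
        2 * Real.exp (-(sig0 ^ 4 * (lam * (1 / Real.sqrt T) / K * n / 2) / 32))) ≤
      3 * K / (T : ℝ) ^ 2 := by
  have hK := h.cast_K
  have hl := h.lam_pos
  have h0 := h.eps_count_ge hn
  have hs := h.sig0_pos
  have h2 := h.one_le_log
  have hs4 : sig0 ^ 4 ≤ 1 := pow_le_one₀ hs.le h.sig0_le_one
  set c2 := lam * (1 / Real.sqrt T) / K * n / 2 with hc2
  have h3 : 64 * (Real.log T / sig0 ^ 4) ≤ c2 := by
    refine le_trans ?_ h0
    rw [le_div_iff₀ (by positivity)]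
    have h5 := mul_le_mul_of_nonneg_left hT hl.le
    have h6 : lam * (512 * K / lam * (Real.log T / sig0 ^ 4)) =
        64 * (Real.log T / sig0 ^ 4) * (8 * K) := by field_simp; norm_num
    linarith
  have h4 : 64 * Real.log T ≤ sig0 ^ 4 * c2 := by
    have h5 := mul_le_mul_of_nonneg_left h3 (by positivity : 0 ≤ sig0 ^ 4)
    have h6 : sig0 ^ 4 * (64 * (Real.log T / sig0 ^ 4)) = 64 * Real.log T := by field_simp
    linarith
  have h5 : 64 * Real.log T ≤ c2 := by
    refine le_trans ?_ h3
    have : Real.log T ≤ Real.log T / sig0 ^ 4 := le_div_self (by linarith) (by positivity) hs4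
    linarith
  have e1 := h.exp_neg_le 2 (y := lam * (1 / Real.sqrt T) / K * n / 8) (by
    have : lam * (1 / Real.sqrt T) / K * n / 8 = c2 / 4 := by rw [hc2]; ring
    rw [this]; push_cast; linarith)
  have e2 := h.exp_neg_le 2 (y := sig0 ^ 4 * c2 / 32) (by push_cast; linarith)
  calc _ ≤ K * (1 / (T : ℝ) ^ 2 + 2 * (1 / (T : ℝ) ^ 2)) := by gcongr
    _ = _ := by ring

lemma contraction_pow_le (n : ℕ) :
    (1 - eps ^ 2 / 64) ^ n ≤ Real.exp (-(eps ^ 2 / 64 * n)) := by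
  have h1 := h.eps_pos
  have h2 := h.eps_le_one
  calc _ ≤ (Real.exp (-(eps ^ 2 / 64))) ^ n := by
        apply pow_le_pow_left₀ (by nlinarith)
        exact Real.one_sub_le_exp_neg _
    _ = _ := by rw [← Real.exp_nat_mul]; ring_nf

/-- The backlog of the pure-exploration phase has been worked off after a quarter of the horizon. -/
lemma relaxation_le (hT : 64 * explorationLength 66 d K T lam kap S lam0 sig0 eps delta / eps ≤ T)
    {n : ℕ} (hn : (T : ℝ) / 4 ≤ n) :
    (1 - eps ^ 2 / 64) ^ n * (2 * Real.exp (eps / 8 *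
      (⌊explorationLength 66 d K T lam kap S lam0 sig0 eps delta⌋₊ + 1))) ≤ 2 := by
  have h1 := h.eps_pos
  have h3 := h.le_length
  set τ := explorationLength 66 d K T lam kap S lam0 sig0 eps delta
  have h4 := Nat.floor_le (show 0 ≤ τ by linarith)
  have h5 : eps / 8 * (⌊τ⌋₊ + 1) ≤ eps ^ 2 / 64 * n := by
    rw [div_le_iff₀ h1] at hT
    have h6 : 64 * τ ≤ 4 * n * eps := hT.trans (by gcongr; linarith)
    have h7 := mul_le_mul_of_nonneg_left h6 h1.le
    have h8 : (⌊τ⌋₊ : ℝ) + 1 ≤ 2 * τ := by linarith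
    have h9 := mul_le_mul_of_nonneg_left h8 h1.le
    nlinarith
  calc _ ≤ Real.exp (-(eps ^ 2 / 64 * n)) * (2 * Real.exp (eps ^ 2 / 64 * n)) := by
        gcongr
        exact h.contraction_pow_le n
    _ = 2 := by
        rw [mul_left_comm, ← Real.exp_add]; simp

end Admissible

/-! ### The regret in the three regimes -/

lemma Assumptions.admissible {d K T : ℕ} {M : Model d K} {lam kap R S sig0 eps lam0 delta a : ℝ}
    (hA : Assumptions M lam kap R S sig0 eps) (hlam : 0 < lam) (hlam0 : 0 < lam0)
    (hd1 : (T : ℝ) ^ (-a) ≤ delta) (hd0 : 0 < delta) (hd2 : delta ≤ (T : ℝ) ^ (-2 : ℝ))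
    (hT : 4 / eps ^ 2 < (T : ℝ))
    (hlen : explorationLength 66 d K T lam kap S lam0 sig0 eps delta ≤ T) :
    Admissible d K T lam kap S lam0 sig0 eps delta a := by
  have := hA.dist_prob
  have he := hA.eps_pos
  obtain ⟨x, hx⟩ := hA.dist_contexts.exists
  obtain ⟨k, hk⟩ := hA.slack x hx
  have h1 := Real.sigmoid_lt_one (inner ℝ x (M.theta k))
  have hkap : 4 ≤ kap := by
    have h2 := (hA.deriv_bounds x hx (M.theta k) (hA.theta_norm k)).1.trans (deriv_sigmoid_le _)
    rwa [div_le_div_iff₀ hA.kap_pos (by norm_num), one_mul, one_mul] at h2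
  have h4 : (1 : ℝ) < T := by
    refine lt_of_le_of_lt ?_ hT
    rw [le_div_iff₀ (by positivity)]
    nlinarith
  have ha : -a ≤ -2 := (Real.rpow_le_rpow_left_iff h4).1 (hd1.trans hd2)
  exact
    { one_le_d := hA.dim_pos
      one_le_K := Fin.pos k
      lam_pos := hlam
      lam_lt_one := by linarith
      four_le_kap := hkap
      S_nonneg := (norm_nonneg _).trans (hA.theta_norm k)
      lam0_pos := hlam0
      sig0_pos := hA.sig0_pos
      sig0_le_one := hA.sig0_le_one
      eps_pos := he
      eps_le_one := by linarith
      a_nonneg := by linarith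
      delta_ge := hd1
      delta_pos := hd0
      delta_le := hd2
      T_gt := hT
      length_le := hlen }

section Regret

variable {Ω : Type*} {d K T : ℕ} {M : Model d K} {N : Noise Ω d K} {π πopt : Schedule Ω K}
  {lam kap R S sig0 eps lam0 delta a : ℝ}
  [m : MeasurableSpace Ω] {P : Measure Ω} [IsProbabilityMeasure P] {ℱ : Filtration ℕ m}
  {est : ℕ → Fin K → Ω → Vec d}

lemma measure_not_good_le (hA : Assumptions M lam kap R S sig0 eps)
    (h : Admissible d K T lam kap S lam0 sig0 eps delta a)
    (hN : IsNoise P ℱ M.dist lam (1 / Real.sqrt T) N)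
    (hπ : IsCQB M N π ℱ kap S lam0 delta
      (explorationLength 66 d K T lam kap S lam0 sig0 eps delta) est) :
    P {ω | ¬ (Regular M N π kap lam0 delta T ω ∧
      WellExplored M N (explorationLength 66 d K T lam kap S lam0 sig0 eps delta) sig0
        (⌊explorationLength 66 d K T lam kap S lam0 sig0 eps delta⌋₊ - 1)
        (lam * (⌊explorationLength 66 d K T lam kap S lam0 sig0 eps delta⌋₊ - 1 : ℕ) / (2 * K) - 1)
        ω)} ≤ ENNReal.ofReal ((2 + 2 * K) / (T : ℝ) ^ 2) := by
  have hp1 : 1 / Real.sqrt T ≤ 1 := by linarith [h.one_div_sqrt_le, h.eps_le_one]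
  have hp0 : 0 ≤ 1 / Real.sqrt T := by positivity
  have h1 := measure_not_regular_le hA h.one_le_K h.lam_pos.le h.lam_lt_one.le hp0 hp1 h.lam0_pos
    h.delta_pos hN hπ.adapted hπ.mem T
  set τ := explorationLength 66 d K T lam kap S lam0 sig0 eps delta
  have hf := h.le_floor
  have hn : ((⌊τ⌋₊ - 1 + 1 : ℕ) : ℝ) ≤ τ := by
    rw [Nat.sub_add_cancel hf]
    exact Nat.floor_le (by linarith [h.le_length])
  have h2 := measure_not_wellExplored_pure_le hA h.one_le_K h.lam_pos.le h.lam_lt_one.le hp0 hp1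
    hN hn
  have h3 := h.pure_fail_le
  have h4 := h.delta_le'
  have hsub : {ω | ¬ (Regular M N π kap lam0 delta T ω ∧ WellExplored M N τ sig0 (⌊τ⌋₊ - 1)
      (lam * (⌊τ⌋₊ - 1 : ℕ) / (2 * K) - 1) ω)} ⊆ {ω | ¬ Regular M N π kap lam0 delta T ω} ∪
      {ω | ¬ WellExplored M N τ sig0 (⌊τ⌋₊ - 1) (lam * (⌊τ⌋₊ - 1 : ℕ) / (2 * K) - 1) ω} := by
    intro ω hω
    rcases not_and_or.1 hω with h' | h'
    · exact Or.inl h'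
    · exact Or.inr h'
  refine (measure_mono hsub).trans ((measure_union_le _ _).trans ((add_le_add h1 h2).trans ?_))
  rw [← ENNReal.ofReal_add h.delta_pos.le (by positivity)]
  apply ENNReal.ofReal_le_ofReal
  calc _ ≤ 1 / (T : ℝ) ^ 2 + (1 + 2 * K) / (T : ℝ) ^ 2 := add_le_add h4 h3
    _ = _ := by ring

lemma integral_queueLength_le_of_admissible (hA : Assumptions M lam kap R S sig0 eps)
    (h : Admissible d K T lam kap S lam0 sig0 eps delta a)
    (hN : IsNoise P ℱ M.dist lam (1 / Real.sqrt T) N)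
    (hπ : IsCQB M N π ℱ kap S lam0 delta
      (explorationLength 66 d K T lam kap S lam0 sig0 eps delta) est) {n : ℕ}
    (hn : ⌊explorationLength 66 d K T lam kap S lam0 sig0 eps delta⌋₊ + n + 1 = T) {x : ℝ}
    (hx : 0 ≤ x) :
    ∫ ω, queueLength M N π T ω ∂P ≤ x + T * ((2 + 2 * K) / (T : ℝ) ^ 2 +
      ((1 - eps ^ 2 / 64) ^ n * (2 * Real.exp (eps / 8 *
        (⌊explorationLength 66 d K T lam kap S lam0 sig0 eps delta⌋₊ + 1))) + 256 / eps ^ 2) /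
        Real.exp (eps / 8 * x)) := by
  have hf := h.le_floor
  have hbad := measure_not_good_le hA h hN hπ
  have h1 := h.pure_small
  have h2 := h.pure_gap
  have key := integral_queueLength_le hA h.one_le_K h.lam_pos.le h.lam_lt_one.le (by positivity)
    h.four_le_kap h.lam0_pos h.eps_le_one h.one_div_sqrt_le hN hπ (n := n) (x := x)
    (n1 := ⌊explorationLength 66 d K T lam kap S lam0 sig0 eps delta⌋₊ - 1)
    (b := (2 + 2 * K) / (T : ℝ) ^ 2) hf
    (Nat.lt_floor_add_one _) (by omega) h.pure_count_pos (by rw [hn]; exact h1)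
    (by rw [hn]; exact h2) hx (by positivity) (by rw [hn]; exact hbad)
  rwa [hn] at key

lemma Admissible.inv_sq_le (h : Admissible d K T lam kap S lam0 sig0 eps delta a) :
    256 / eps ^ 2 ≤ 64 * T := by
  have h1 := h.T_gt
  calc 256 / eps ^ 2 = 64 * (4 / eps ^ 2) := by ring
    _ ≤ _ := by gcongr

/-- Short horizons: the backlog of the pure-exploration phase dominates. -/
lemma integral_queueLength_le_of_short (hA : Assumptions M lam kap R S sig0 eps)
    (h : Admissible d K T lam kap S lam0 sig0 eps delta a)
    (hN : IsNoise P ℱ M.dist lam (1 / Real.sqrt T) N)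
    (hπ : IsCQB M N π ℱ kap S lam0 delta
      (explorationLength 66 d K T lam kap S lam0 sig0 eps delta) est)
    (hT : (T : ℝ) < 64 * explorationLength 66 d K T lam kap S lam0 sig0 eps delta / eps) :
    ∫ ω, queueLength M N π T ω ∂P ≤ (93 + 2 * K) * 64 * lengthConst K lam kap S lam0 a ^ 2 *
      ((d : ℝ) ^ 2 * (T : ℝ) ^ (-1 : ℝ) * Real.log T ^ 2 / (sig0 ^ 8 * eps ^ 5)) := by
  have h4 := h.four_lt
  have he := h.eps_pos
  have he1 := h.eps_le_one
  have hs := h.sig0_pos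
  have hℓ := h.one_le_log
  have hlen := h.le_length
  have hlog := h.log_div_le_length
  have hconst := h.length_le_const
  have hle := h.length_le
  have hL := h.lengthConst_nonneg
  have hinv := h.inv_sq_le
  have hmain := fun n hn x hx => integral_queueLength_le_of_admissible hA h hN hπ (n := n) hn
    (x := x) hx
  set τ := explorationLength 66 d K T lam kap S lam0 sig0 eps delta with hτ
  have hτ0 : 0 ≤ τ := by linarith
  have hfloor := Nat.floor_le hτ0
  -- the expected queue length is of the order of the length of pure exploration
  have hQ : ∫ ω, queueLength M N π T ω ∂P ≤ (93 + 2 * K) * τ := by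
    rcases Nat.lt_or_ge ⌊τ⌋₊ T with hlt | hge
    · obtain ⟨n, hn⟩ : ∃ n, ⌊τ⌋₊ + n + 1 = T := ⟨T - ⌊τ⌋₊ - 1, by omega⟩
      -- the level `⌊τ⌋ + 1` absorbs the initial backlog, and `24 log T / ε` yields a tail `T⁻³`
      have hx : 0 ≤ (⌊τ⌋₊ : ℝ) + 1 + 24 * (Real.log T / eps) := by positivity
      refine (hmain n hn _ hx).trans ?_
      have e1 : Real.exp (eps / 8 * ((⌊τ⌋₊ : ℝ) + 1 + 24 * (Real.log T / eps))) =
          Real.exp (eps / 8 * (⌊τ⌋₊ + 1)) * (T : ℝ) ^ 3 := by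
        rw [mul_add, Real.exp_add]
        congr 1
        rw [show eps / 8 * (24 * (Real.log T / eps)) = (3 : ℕ) * Real.log T by
          push_cast; field_simp; norm_num, Real.exp_nat_mul, Real.exp_log (by linarith)]
      rw [e1]
      set Z := Real.exp (eps / 8 * ((⌊τ⌋₊ : ℝ) + 1)) with hZ
      have hZ1 : 1 ≤ Z := Real.one_le_exp (by positivity)
      have hρ : (1 - eps ^ 2 / 64) ^ n ≤ 1 := pow_le_one₀ (by nlinarith) (by nlinarith)
      have e2 : ((1 - eps ^ 2 / 64) ^ n * (2 * Z) + 256 / eps ^ 2) / (Z * (T : ℝ) ^ 3) ≤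
          65 / (T : ℝ) ^ 2 := by
        rw [div_le_div_iff₀ (by positivity) (by positivity)]
        have e3 : (1 - eps ^ 2 / 64) ^ n * (2 * Z) + 256 / eps ^ 2 ≤ 65 * Z * T := by
          have e4 := mul_le_mul_of_nonneg_right hρ (by positivity : 0 ≤ 2 * Z)
          have e5 : 64 * (T : ℝ) ≤ 64 * T * Z := le_mul_of_one_le_right (by positivity) hZ1
          nlinarith
        calc _ ≤ 65 * Z * T * (T : ℝ) ^ 2 := by gcongr
          _ = _ := by ring
      have e6 : (T : ℝ) * ((2 + 2 * K) / (T : ℝ) ^ 2 + 65 / (T : ℝ) ^ 2) ≤ 67 + 2 * K := by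
        rw [← add_div, mul_div_assoc', div_le_iff₀ (by positivity)]
        have : (0 : ℝ) ≤ K := Nat.cast_nonneg _
        have e7 : (T : ℝ) ≤ (T : ℝ) ^ 2 := by nlinarith
        nlinarith
      have e8 := mul_le_mul_of_nonneg_left (add_le_add_right e2 ((2 + 2 * K) / (T : ℝ) ^ 2))
        (by linarith : (0 : ℝ) ≤ T)
      have e9 : (67 + 2 * K : ℝ) ≤ (67 + 2 * K) * τ :=
        le_mul_of_one_le_right (by positivity) (by linarith)
      linarith
    · have e1 : ∫ ω, queueLength M N π T ω ∂P ≤ T := by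
        have := integral_mono (μ := P) (integrable_queueLength (M := M) hN hπ.adapted T)
          (integrable_const (T : ℝ)) fun ω => by
            change queueLength M N π T ω ≤ T
            rw [queueLength]; exact_mod_cast card_queue_le T ω
        simpa using this
      have e2 : (T : ℝ) ≤ τ := le_trans (by exact_mod_cast hge) hfloor
      have e3 : τ ≤ (93 + 2 * K) * τ := le_mul_of_one_le_left hτ0 (by
        have : (0 : ℝ) ≤ K := Nat.cast_nonneg _
        linarith)
      linarith
  -- on short horizons that length is at most of the order of the first term of the bound
  set D := d * Real.log T / sig0 ^ 4 with hD
  set C := lengthConst K lam kap S lam0 a with hC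
  have hD0 : 0 ≤ D := by positivity
  have e1 : (d : ℝ) ^ 2 * (T : ℝ) ^ (-1 : ℝ) * Real.log T ^ 2 / (sig0 ^ 8 * eps ^ 5) =
      D ^ 2 / (T * eps ^ 5) := by
    rw [Real.rpow_neg_one, hD]; field_simp
  rw [e1]
  have e2 : τ ≤ 64 * C ^ 2 * (D ^ 2 / (T * eps ^ 5)) := by
    rw [← mul_div_assoc, le_div_iff₀ (by positivity)]
    have e3 : τ * eps ^ 2 ≤ C * D := by
      have := mul_le_mul_of_nonneg_right hconst (sq_nonneg eps)
      rwa [mul_assoc, div_mul_cancel₀ _ (by positivity)] at this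
    rw [lt_div_iff₀ he] at hT
    calc τ * (T * eps ^ 5) = τ * eps ^ 4 * (T * eps) := by ring
      _ ≤ τ * eps ^ 4 * (64 * τ) := by gcongr
      _ = 64 * (τ * eps ^ 2) ^ 2 := by ring
      _ ≤ 64 * (C * D) ^ 2 := by gcongr
      _ = _ := by ring
  calc _ ≤ (93 + 2 * K) * τ := hQ
    _ ≤ (93 + 2 * K) * (64 * C ^ 2 * (D ^ 2 / (T * eps ^ 5))) := by gcongr
    _ = _ := by ring

lemma Admissible.log_le_rpow (h : Admissible d K T lam kap S lam0 sig0 eps delta a) :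
    Real.log T ≤ 4 * (T : ℝ) ^ (1 / 4 : ℝ) := by
  have h4 := h.four_lt
  have := Real.log_le_rpow_div (x := (T : ℝ)) (by linarith) (show (0 : ℝ) < 1 / 4 by norm_num)
  linarith

lemma Admissible.one_le_rpow (h : Admissible d K T lam kap S lam0 sig0 eps delta a) :
    1 ≤ (T : ℝ) ^ (1 / 4 : ℝ) :=
  Real.one_le_rpow (by linarith [h.four_lt]) (by norm_num)

lemma Admissible.sqrt_eq (h : Admissible d K T lam kap S lam0 sig0 eps delta a) :
    Real.sqrt T = ((T : ℝ) ^ (1 / 4 : ℝ)) ^ 2 := by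
  have h4 := h.four_lt
  rw [Real.sqrt_eq_rpow, ← Real.rpow_natCast, ← Real.rpow_mul (by linarith)]
  norm_num

/-- Medium horizons: the queue is stationary, but `ε`-exploration has not gathered enough data to
be of use. -/
lemma integral_queueLength_le_of_medium (hA : Assumptions M lam kap R S sig0 eps)
    (h : Admissible d K T lam kap S lam0 sig0 eps delta a)
    (hN : IsNoise P ℱ M.dist lam (1 / Real.sqrt T) N)
    (hπ : IsCQB M N π ℱ kap S lam0 delta
      (explorationLength 66 d K T lam kap S lam0 sig0 eps delta) est)
    (hT : 64 * explorationLength 66 d K T lam kap S lam0 sig0 eps delta / eps ≤ T)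
    (hT' : Real.sqrt T < 512 * K / lam * (Real.log T / sig0 ^ 4)) :
    ∫ ω, queueLength M N π T ω ∂P ≤ (92 + 2 * K) * 4 * (512 * K / lam) *
      ((d : ℝ) * (T : ℝ) ^ (-(1 / 4) : ℝ) * Real.log T / (sig0 ^ 4 * eps ^ 3)) := by
  have h4 := h.four_lt
  have he := h.eps_pos
  have he1 := h.eps_le_one
  have hs := h.sig0_pos
  have hℓ := h.one_le_log
  have hlen := h.le_length
  have hl := h.lam_pos
  have hd := h.cast_d
  have hinv := h.inv_sq_le
  have hrel := fun n => h.relaxation_le hT (n := n)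
  have hmain := fun n hn x hx => integral_queueLength_le_of_admissible hA h hN hπ (n := n) hn
    (x := x) hx
  set τ := explorationLength 66 d K T lam kap S lam0 sig0 eps delta with hτ
  have hfloor := Nat.floor_le (show 0 ≤ τ by linarith)
  have hτT : 64 * τ ≤ T := by
    refine le_trans ?_ hT
    exact le_div_self (by linarith) he he1
  have hQ : ∫ ω, queueLength M N π T ω ∂P ≤ (92 + 2 * K) * (Real.log T / eps) := by
    have hlt : ⌊τ⌋₊ < T := by
      have : (⌊τ⌋₊ : ℝ) < T := by linarith
      exact_mod_cast this
    obtain ⟨n, hn⟩ : ∃ n, ⌊τ⌋₊ + n + 1 = T := ⟨T - ⌊τ⌋₊ - 1, by omega⟩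
    have hn' : (⌊τ⌋₊ : ℝ) + n + 1 = T := by exact_mod_cast hn
    have hn4 : (T : ℝ) / 4 ≤ n := by linarith
    refine (hmain n hn (24 * (Real.log T / eps)) (by positivity)).trans ?_
    have e1 : Real.exp (eps / 8 * (24 * (Real.log T / eps))) = (T : ℝ) ^ 3 := by
      rw [show eps / 8 * (24 * (Real.log T / eps)) = (3 : ℕ) * Real.log T by
          push_cast; field_simp; norm_num, Real.exp_nat_mul, Real.exp_log (by linarith)]
    rw [e1]
    have e2 : ((1 - eps ^ 2 / 64) ^ n * (2 * Real.exp (eps / 8 * (⌊τ⌋₊ + 1))) + 256 / eps ^ 2) /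
        (T : ℝ) ^ 3 ≤ 66 / (T : ℝ) ^ 2 := by
      rw [div_le_div_iff₀ (by positivity) (by positivity)]
      have e3 := hrel n hn4
      calc _ ≤ (66 * T) * (T : ℝ) ^ 2 := by gcongr; linarith
        _ = _ := by ring
    have e6 : (T : ℝ) * ((2 + 2 * K) / (T : ℝ) ^ 2 + 66 / (T : ℝ) ^ 2) ≤ 68 + 2 * K := by
      rw [← add_div, mul_div_assoc', div_le_iff₀ (by positivity)]
      have : (0 : ℝ) ≤ K := Nat.cast_nonneg _
      have e7 : (T : ℝ) ≤ (T : ℝ) ^ 2 := by nlinarith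
      nlinarith
    have e8 := mul_le_mul_of_nonneg_left (add_le_add_right e2 ((2 + 2 * K) / (T : ℝ) ^ 2))
      (by linarith : (0 : ℝ) ≤ T)
    have e9 : 1 ≤ Real.log T / eps := by rw [le_div_iff₀ he]; linarith
    have e10 : (68 + 2 * K : ℝ) ≤ (68 + 2 * K) * (Real.log T / eps) :=
      le_mul_of_one_le_right (by positivity) e9
    linarith
  have hq1 := h.one_le_rpow
  have hq2 := h.log_le_rpow
  rw [h.sqrt_eq] at hT'
  rw [Real.rpow_neg (by linarith)]
  set q := (T : ℝ) ^ (1 / 4 : ℝ) with hq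
  have hq0 : 0 < q := by linarith
  have e1 : Real.log T / eps ≤ 4 * (512 * K / lam) *
      ((d : ℝ) * q⁻¹ * Real.log T / (sig0 ^ 4 * eps ^ 3)) := by
    have e2 : q ≤ 512 * K / lam * ((d : ℝ) * q⁻¹ * Real.log T / sig0 ^ 4) := by
      have e3 : 512 * K / lam * (Real.log T / sig0 ^ 4) ≤
          512 * K / lam * (d * Real.log T / sig0 ^ 4) := by
        gcongr
        exact le_mul_of_one_le_left (by linarith) hd
      have e4 : 512 * K / lam * ((d : ℝ) * q⁻¹ * Real.log T / sig0 ^ 4) =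
          512 * K / lam * (d * Real.log T / sig0 ^ 4) / q := by field_simp
      rw [e4, le_div_iff₀ hq0]
      nlinarith
    have e5 : eps ^ 3 ≤ eps := by
      calc eps ^ 3 ≤ eps ^ 1 := pow_le_pow_of_le_one he.le he1 (by norm_num)
        _ = eps := pow_one _
    calc Real.log T / eps ≤ 4 * (512 * K / lam * ((d : ℝ) * q⁻¹ * Real.log T / sig0 ^ 4)) /
          eps ^ 3 := by
          apply div_le_div₀ (by positivity) (by linarith) (by positivity) e5
      _ = _ := by field_simp
  calc _ ≤ (92 + 2 * K) * (Real.log T / eps) := hQ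
    _ ≤ (92 + 2 * K) * (4 * (512 * K / lam) *
      ((d : ℝ) * q⁻¹ * Real.log T / (sig0 ^ 4 * eps ^ 3))) := by gcongr
    _ = _ := by ring

/-- Long horizons: the data of the `ε`-exploration rounds make the losses of the last rounds, since
the queue was empty for the last time, rare. -/
lemma integral_regret_le_of_long (hA : Assumptions M lam kap R S sig0 eps)
    (h : Admissible d K T lam kap S lam0 sig0 eps delta a)
    (hN : IsNoise P ℱ M.dist lam (1 / Real.sqrt T) N)
    (hπ : IsCQB M N π ℱ kap S lam0 delta
      (explorationLength 66 d K T lam kap S lam0 sig0 eps delta) est)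
    (hopt : IsOptimal M N πopt ℱ)
    (hT : 64 * explorationLength 66 d K T lam kap S lam0 sig0 eps delta / eps ≤ T)
    (hT' : 512 * K / lam * (Real.log T / sig0 ^ 4) ≤ Real.sqrt T) :
    ∫ ω, (queueLength M N π T ω - queueLength M N πopt T ω) ∂P ≤
      193 * (Real.log T / eps ^ 2) * (1 / Real.sqrt T + 8 * radiusConst K kap S lam0 a *
        Real.sqrt (d * Real.log T) / (sig0 * Real.sqrt (lam / (16 * K)) * (T : ℝ) ^ (1 / 4 : ℝ))) +
        (68 + 5 * K) / T := by
  have h4 := h.four_lt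
  have he := h.eps_pos
  have he1 := h.eps_le_one
  have hs := h.sig0_pos
  have hℓ := h.one_le_log
  have hlen := h.le_length
  have hl := h.lam_pos
  have hK := h.cast_K
  have hinv := h.inv_sq_le
  have hone := h.one_le_log_div
  have hf := h.le_floor
  have hlogT := h.log_div_sq_le_length
  have hrel := fun n => h.relaxation_le hT (n := n)
  have hbad := measure_not_good_le hA h hN hπ
  have hβ := h.radius_le
  have hβ0 := h.radius_pos
  have hp1 : 1 / Real.sqrt T ≤ 1 := by linarith [h.one_div_sqrt_le]
  have hp0 : 0 ≤ 1 / Real.sqrt T := by positivity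
  have hsmall := h.pure_small
  have hgap := h.pure_gap
  have hc1 := h.pure_count_pos
  have hq1 := h.one_le_rpow
  have hsq := h.sqrt_eq
  set τ := explorationLength 66 d K T lam kap S lam0 sig0 eps delta with hτ
  have hfloor := Nat.floor_le (show 0 ≤ τ by linarith)
  have hτT : 64 * τ ≤ T := by
    refine le_trans ?_ hT
    exact le_div_self (by linarith) he he1
  -- the window of the last rounds, in which the queue becomes empty with high probability
  set l := ⌈192 * (Real.log T / eps ^ 2)⌉₊ with hldef
  have hl1 : 192 * (Real.log T / eps ^ 2) ≤ l := Nat.le_ceil _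
  have hl2 : (l : ℝ) ≤ 193 * (Real.log T / eps ^ 2) := by
    have := Nat.ceil_lt_add_one (show 0 ≤ 192 * (Real.log T / eps ^ 2) by positivity)
    linarith
  obtain ⟨n, hn⟩ : ∃ n, ⌊τ⌋₊ + n + l + 1 = T := by
    have : ((⌊τ⌋₊ + l + 1 : ℕ) : ℝ) ≤ T := by push_cast; linarith
    have : ⌊τ⌋₊ + l + 1 ≤ T := by exact_mod_cast this
    exact ⟨T - ⌊τ⌋₊ - l - 1, by omega⟩
  have hn' : (⌊τ⌋₊ : ℝ) + n + l + 1 = T := by exact_mod_cast hn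
  have hn2 : (T : ℝ) / 4 + 1 ≤ n := by linarith
  have hn1 : 1 ≤ n := by
    have : (1 : ℝ) ≤ n := by linarith
    exact_mod_cast this
  have hn3 : (T : ℝ) / 4 ≤ ((n - 1 : ℕ) : ℝ) := by
    rw [Nat.cast_sub hn1]; push_cast; linarith
  have hcount := h.eps_count_ge hn3
  have hfail := h.eps_fail_le hn3 hT'
  have hwe := measure_not_wellExplored_eps_le hA h.one_le_K h.lam_pos.le h.lam_lt_one.le hp0 hp1 hN
    (tau := τ) (a := ⌊τ⌋₊) (by
      have := Nat.lt_floor_add_one τ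
      push_cast; linarith) (n - 1)
  set c1 := lam * (⌊τ⌋₊ - 1 : ℕ) / (2 * K) - 1 with hc1def
  set c2 := lam * (1 / Real.sqrt T) / K * ((n - 1 : ℕ) : ℝ) / 2 with hc2def
  have hbad' : P {ω | ¬ (Regular M N π kap lam0 delta T ω ∧
      WellExplored M N τ sig0 (⌊τ⌋₊ - 1) c1 ω ∧ WellExplored M N τ sig0 (⌊τ⌋₊ + (n - 1)) c2 ω)} ≤
      ENNReal.ofReal ((2 + 5 * K) / (T : ℝ) ^ 2) := by
    have hsub : {ω | ¬ (Regular M N π kap lam0 delta T ω ∧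
        WellExplored M N τ sig0 (⌊τ⌋₊ - 1) c1 ω ∧
        WellExplored M N τ sig0 (⌊τ⌋₊ + (n - 1)) c2 ω)} ⊆
        {ω | ¬ (Regular M N π kap lam0 delta T ω ∧ WellExplored M N τ sig0 (⌊τ⌋₊ - 1) c1 ω)} ∪
        {ω | ¬ WellExplored M N τ sig0 (⌊τ⌋₊ + (n - 1)) c2 ω} := by
      intro ω hω
      by_cases h' : Regular M N π kap lam0 delta T ω ∧ WellExplored M N τ sig0 (⌊τ⌋₊ - 1) c1 ω
      · exact Or.inr fun h'' => hω ⟨h'.1, h'.2, h''⟩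
      · exact Or.inl h'
    refine (measure_mono hsub).trans ((measure_union_le _ _).trans
      ((add_le_add hbad (hwe.trans (ENNReal.ofReal_le_ofReal hfail))).trans ?_))
    rw [← ENNReal.ofReal_add (by positivity) (by positivity)]
    apply le_of_eq
    congr 1
    ring
  have key := integral_regret_le hA h.one_le_K h.lam_pos.le h.lam_lt_one.le hp0 h.four_le_kap
    h.lam0_pos h.eps_le_one h.one_div_sqrt_le hN hπ hopt (n := n) (l := l) (n1 := ⌊τ⌋₊ - 1)
    (n2 := ⌊τ⌋₊ + (n - 1)) (c1 := c1) (c2 := c2) (b := (2 + 5 * K) / (T : ℝ) ^ 2) hf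
    (Nat.lt_floor_add_one _) (by omega) (by omega) (by omega) hc1 (by rw [hn]; exact hsmall)
    (by rw [hn]; exact hgap) (by positivity) (by rw [hn]; exact hbad')
  rw [hn] at key
  refine key.trans (add_le_add ?_ ?_)
  · set q := (T : ℝ) ^ (1 / 4 : ℝ)
    have hq0 : 0 < q := by linarith
    have hlK : 0 < Real.sqrt (lam / (16 * K)) := Real.sqrt_pos.2 (by positivity)
    have e1 : sig0 * Real.sqrt (lam / (16 * K)) * q ≤ Real.sqrt (sig0 ^ 2 / 2 * max c1 c2) := by
      apply Real.le_sqrt_of_sq_le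
      rw [mul_pow, mul_pow, Real.sq_sqrt (by positivity), ← hsq]
      calc sig0 ^ 2 * (lam / (16 * K)) * Real.sqrt T
          = sig0 ^ 2 / 2 * (lam * Real.sqrt T / (8 * K)) := by field_simp; norm_num
        _ ≤ _ := by
          gcongr
          exact hcount.trans (le_max_right _ _)
    have hX : 0 ≤ Real.log T / eps ^ 2 := by positivity
    have hβ' : 8 * radius d K kap S lam0 delta T ≤
        8 * radiusConst K kap S lam0 a * Real.sqrt (d * Real.log T) := by linarith
    refine mul_le_mul hl2 (add_le_add le_rfl (div_le_div₀ (by linarith) hβ' (by positivity) e1))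
      (add_nonneg hp0 (by positivity)) (by positivity)
  · have e1 : (1 - eps ^ 2 / 64) ^ l ≤ 1 / (T : ℝ) ^ 3 := by
      refine (h.contraction_pow_le l).trans (h.exp_neg_le 3 ?_)
      have := mul_le_mul_of_nonneg_left hl1 (by positivity : 0 ≤ eps ^ 2 / 64)
      refine le_trans (le_of_eq ?_) this
      push_cast
      field_simp
      norm_num
    have e2 := hrel n (by linarith)
    have e3 : (1 - eps ^ 2 / 64) ^ n * (2 * Real.exp (eps / 8 * (⌊τ⌋₊ + 1))) + 256 / eps ^ 2 ≤
        66 * T := by linarith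
    have hρ : 0 ≤ 1 - eps ^ 2 / 64 := by
      have : eps ^ 2 ≤ 1 := pow_le_one₀ he.le he1
      linarith
    calc _ ≤ (T : ℝ) * ((2 + 5 * K) / (T : ℝ) ^ 2 + 1 / (T : ℝ) ^ 3 * (66 * T)) := by
          gcongr
      _ = _ := by
          have : (T : ℝ) ≠ 0 := by positivity
          field_simp
          ring

/-- The constant of the regret bound, in terms of the parameters that it may depend on. -/
noncomputable def regretConst (K : ℕ) (lam kap S lam0 a : ℝ) : ℝ :=
  (93 + 2 * K) * 64 * lengthConst K lam kap S lam0 a ^ 2 + (92 + 2 * K) * 4 * (512 * K / lam) +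
    193 + 193 * (8 * radiusConst K kap S lam0 a / Real.sqrt (lam / (16 * K))) + (68 + 5 * K)

lemma integral_regret_le_regretConst (hA : Assumptions M lam kap R S sig0 eps)
    (h : Admissible d K T lam kap S lam0 sig0 eps delta a)
    (hN : IsNoise P ℱ M.dist lam (1 / Real.sqrt T) N)
    (hπ : IsCQB M N π ℱ kap S lam0 delta
      (explorationLength 66 d K T lam kap S lam0 sig0 eps delta) est)
    (hopt : IsOptimal M N πopt ℱ) :
    ∫ ω, (queueLength M N π T ω - queueLength M N πopt T ω) ∂P ≤
      regretConst K lam kap S lam0 a *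
        ((d : ℝ) ^ 2 * (T : ℝ) ^ (-1 : ℝ) * Real.log T ^ 2 / (sig0 ^ 8 * eps ^ 5)
          + (d : ℝ) * (T : ℝ) ^ (-(1 / 4) : ℝ) * Real.log T / (sig0 ^ 4 * eps ^ 3)
          + (d : ℝ) ^ (3 / 2 : ℝ) * (T : ℝ) ^ (-(1 / 4) : ℝ) * Real.log T ^ (3 / 2 : ℝ)
              / (sig0 ^ 5 * eps ^ 3)) := by
  have h4 := h.four_lt
  have he := h.eps_pos
  have he1 := h.eps_le_one
  have hs := h.sig0_pos
  have hs1 := h.sig0_le_one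
  have hℓ := h.one_le_log
  have hl := h.lam_pos
  have hK := h.cast_K
  have hd := h.cast_d
  have hB := h.radiusConst_nonneg
  set A1 := (d : ℝ) ^ 2 * (T : ℝ) ^ (-1 : ℝ) * Real.log T ^ 2 / (sig0 ^ 8 * eps ^ 5) with hA1
  set A2 := (d : ℝ) * (T : ℝ) ^ (-(1 / 4) : ℝ) * Real.log T / (sig0 ^ 4 * eps ^ 3) with hA2
  set A3 := (d : ℝ) ^ (3 / 2 : ℝ) * (T : ℝ) ^ (-(1 / 4) : ℝ) * Real.log T ^ (3 / 2 : ℝ)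
    / (sig0 ^ 5 * eps ^ 3) with hA3
  have hA10 : 0 ≤ A1 := by positivity
  have hA20 : 0 ≤ A2 := by positivity
  have hA30 : 0 ≤ A3 := by positivity
  have hG0 : 0 ≤ 8 * radiusConst K kap S lam0 a / Real.sqrt (lam / (16 * K)) := by positivity
  set G := 8 * radiusConst K kap S lam0 a / Real.sqrt (lam / (16 * K)) with hG
  have hQ : ∫ ω, (queueLength M N π T ω - queueLength M N πopt T ω) ∂P ≤
      ∫ ω, queueLength M N π T ω ∂P := by
    refine integral_mono ((integrable_queueLength hN hπ.adapted T).sub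
      (integrable_queueLength hN hopt.adapted T)) (integrable_queueLength hN hπ.adapted T)
      fun ω => ?_
    have : 0 ≤ queueLength M N πopt T ω := Nat.cast_nonneg _
    change _ - _ ≤ _
    linarith
  have hc1 : 0 ≤ (93 + 2 * K) * 64 * lengthConst K lam kap S lam0 a ^ 2 := by positivity
  have hc2 : 0 ≤ (92 + 2 * K) * 4 * (512 * K / lam) := by positivity
  unfold regretConst
  rw [← hG]
  set X1 := (93 + 2 * K) * 64 * lengthConst K lam kap S lam0 a ^ 2
  set X2 := (92 + 2 * K) * 4 * (512 * K / lam)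
  have hK0 : (0 : ℝ) ≤ K := by linarith
  by_cases hshort : (T : ℝ) < 64 * explorationLength 66 d K T lam kap S lam0 sig0 eps delta / eps
  · have h1 := integral_queueLength_le_of_short hA h hN hπ hshort
    refine hQ.trans (h1.trans ?_)
    have e1 : X1 ≤ X1 + X2 + 193 + 193 * G + (68 + 5 * K) := by linarith
    calc X1 * A1 ≤ (X1 + X2 + 193 + 193 * G + (68 + 5 * K)) * A1 := by gcongr
      _ ≤ _ := by gcongr; linarith
  rw [not_lt] at hshort
  by_cases hmed : Real.sqrt T < 512 * K / lam * (Real.log T / sig0 ^ 4)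
  · have h1 := integral_queueLength_le_of_medium hA h hN hπ hshort hmed
    refine hQ.trans (h1.trans ?_)
    have e1 : X2 ≤ X1 + X2 + 193 + 193 * G + (68 + 5 * K) := by linarith
    calc X2 * A2 ≤ (X1 + X2 + 193 + 193 * G + (68 + 5 * K)) * A2 := by gcongr
      _ ≤ _ := by gcongr; linarith
  rw [not_lt] at hmed
  have h1 := integral_regret_le_of_long hA h hN hπ hopt hshort hmed
  refine h1.trans ?_
  have hq1 := h.one_le_rpow
  have hsq := h.sqrt_eq
  have hqn : (T : ℝ) ^ (-(1 / 4) : ℝ) = ((T : ℝ) ^ (1 / 4 : ℝ))⁻¹ := Real.rpow_neg (by linarith) _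
  rw [hqn] at hA2 hA3
  rw [hsq]
  set q := (T : ℝ) ^ (1 / 4 : ℝ)
  have hq0 : 0 < q := by linarith
  have hs4 : sig0 ^ 4 ≤ 1 := pow_le_one₀ hs.le hs1
  have hs5 : sig0 ^ 5 ≤ sig0 := pow_le_of_le_one hs.le hs1 (by norm_num)
  have hs8 : sig0 ^ 8 ≤ 1 := pow_le_one₀ hs.le hs1
  have he2 : eps ^ 3 ≤ eps ^ 2 := pow_le_pow_of_le_one he.le he1 (by norm_num)
  have he5 : eps ^ 5 ≤ 1 := pow_le_one₀ he.le he1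
  have e1 : Real.log T / eps ^ 2 * (1 / q ^ 2) ≤ A2 := by
    rw [hA2, div_mul_div_comm, mul_one]
    have : (d : ℝ) * q⁻¹ * Real.log T / (sig0 ^ 4 * eps ^ 3) =
        d * Real.log T / (sig0 ^ 4 * eps ^ 3 * q) := by field_simp
    rw [this]
    apply div_le_div₀ (by positivity) (le_mul_of_one_le_left (by linarith) hd) (by positivity)
    calc sig0 ^ 4 * eps ^ 3 * q ≤ 1 * eps ^ 2 * q ^ 2 := by
          gcongr
          nlinarith
      _ = _ := by ring
  have hpow : ∀ x : ℝ, 0 ≤ x → x ^ (3 / 2 : ℝ) = x * Real.sqrt x := by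
    intro x hx
    rw [show (3 / 2 : ℝ) = 1 + 1 / 2 by norm_num, Real.rpow_add_of_nonneg hx (by norm_num)
      (by norm_num), Real.rpow_one, Real.sqrt_eq_rpow]
  have e2 : Real.log T / eps ^ 2 * (Real.sqrt (d * Real.log T) / (sig0 * q)) ≤ A3 := by
    rw [hA3, hpow _ (by linarith), hpow _ (by linarith), Real.sqrt_mul (by linarith)]
    have : (d : ℝ) * Real.sqrt d * q⁻¹ * (Real.log T * Real.sqrt (Real.log T)) /
        (sig0 ^ 5 * eps ^ 3) = d * (Real.log T * (Real.sqrt d * Real.sqrt (Real.log T))) /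
        (sig0 ^ 5 * eps ^ 3 * q) := by field_simp
    rw [this, div_mul_div_comm]
    apply div_le_div₀ (by positivity) (le_mul_of_one_le_left (by positivity) hd) (by positivity)
    calc sig0 ^ 5 * eps ^ 3 * q ≤ sig0 * eps ^ 2 * q := by gcongr
      _ = _ := by ring
  have e3 : 1 / (T : ℝ) ≤ A1 := by
    rw [hA1, Real.rpow_neg_one]
    have : (d : ℝ) ^ 2 * (T : ℝ)⁻¹ * Real.log T ^ 2 / (sig0 ^ 8 * eps ^ 5) =
        (d : ℝ) ^ 2 * Real.log T ^ 2 / (sig0 ^ 8 * eps ^ 5 * T) := by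
      have : (T : ℝ) ≠ 0 := by positivity
      field_simp
    rw [this]
    apply div_le_div₀ (by positivity) _ (by positivity)
    · exact mul_le_of_le_one_left (by linarith) (mul_le_one₀ hs8 (by positivity) he5)
    · exact one_le_mul_of_one_le_of_one_le (one_le_pow₀ hd) (one_le_pow₀ hℓ)
  have e4 : 193 * (Real.log T / eps ^ 2) * (1 / q ^ 2 + 8 * radiusConst K kap S lam0 a *
      Real.sqrt (d * Real.log T) / (sig0 * Real.sqrt (lam / (16 * K)) * q)) +
        (68 + 5 * K) / T = 193 * (Real.log T / eps ^ 2 * (1 / q ^ 2)) +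
      193 * G * (Real.log T / eps ^ 2 * (Real.sqrt (d * Real.log T) / (sig0 * q))) +
      (68 + 5 * K) * (1 / T) := by
    rw [hG]
    have : Real.sqrt (lam / (16 * K)) ≠ 0 := (Real.sqrt_pos.2 (by positivity)).ne'
    field_simp
  rw [e4]
  have f1 := mul_le_mul_of_nonneg_left e1 (by norm_num : (0 : ℝ) ≤ 193)
  have f2 := mul_le_mul_of_nonneg_left e2 (by positivity : 0 ≤ 193 * G)
  have f3 := mul_le_mul_of_nonneg_left e3 (by positivity : (0 : ℝ) ≤ 68 + 5 * K)
  have g1 : 193 * A2 + 193 * G * A3 + (68 + 5 * K) * A1 ≤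
      (193 + 193 * G + (68 + 5 * K)) * (A1 + A2 + A3) := by
    have : 0 ≤ 193 * (A1 + A3) + 193 * G * (A1 + A2) + (68 + 5 * K) * (A2 + A3) := by positivity
    linarith
  have g2 : (193 + 193 * G + (68 + 5 * K)) * (A1 + A2 + A3) ≤
      (X1 + X2 + 193 + 193 * G + (68 + 5 * K)) * (A1 + A2 + A3) := by
    gcongr
    linarith
  linarith

/-- Each of the four terms of the bound is at most `d² σ₀⁻⁸ ε⁻⁵ T^{-1/4} log² T`. -/
lemma Admissible.rate_le (h : Admissible d K T lam kap S lam0 sig0 eps delta a) :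
    (d : ℝ) ^ 2 * (T : ℝ) ^ (-1 : ℝ) * Real.log T ^ 2 / (sig0 ^ 8 * eps ^ 5)
      + (d : ℝ) * (T : ℝ) ^ (-(1 / 4) : ℝ) * Real.log T / (sig0 ^ 4 * eps ^ 3)
      + (d : ℝ) ^ (3 / 2 : ℝ) * (T : ℝ) ^ (-(1 / 4) : ℝ) * Real.log T ^ (3 / 2 : ℝ)
          / (sig0 ^ 5 * eps ^ 3)
      + (d : ℝ) ^ 2 * (T : ℝ) ^ (-(1 / 2) : ℝ) * Real.log T ^ (3 / 2 : ℝ)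
          / (sig0 ^ 6 * eps ^ 3) ≤
      4 * ((d : ℝ) ^ 2 / (sig0 ^ 8 * eps ^ 5) * (T : ℝ) ^ (-(1 / 4) : ℝ) * Real.log T ^ 2) := by
  have h4 := h.four_lt
  have he := h.eps_pos
  have he1 := h.eps_le_one
  have hs := h.sig0_pos
  have hs1 := h.sig0_le_one
  have hℓ := h.one_le_log
  have hd := h.cast_d
  have key : ∀ D t ℓ s e : ℝ, 0 ≤ D → D ≤ (d : ℝ) ^ 2 → 0 ≤ t → t ≤ (T : ℝ) ^ (-(1 / 4) : ℝ) →
      0 ≤ ℓ → ℓ ≤ Real.log T ^ 2 → sig0 ^ 8 ≤ s → eps ^ 5 ≤ e → D * t * ℓ / (s * e) ≤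
        (d : ℝ) ^ 2 / (sig0 ^ 8 * eps ^ 5) * (T : ℝ) ^ (-(1 / 4) : ℝ) * Real.log T ^ 2 := by
    intro D t ℓ s e hD0 hD ht0 ht hℓ0 hℓ hs' he'
    have hs0 : 0 ≤ s := le_trans (by positivity) hs'
    calc D * t * ℓ / (s * e) ≤ (d : ℝ) ^ 2 * (T : ℝ) ^ (-(1 / 4) : ℝ) * Real.log T ^ 2 /
          (sig0 ^ 8 * eps ^ 5) := by gcongr
      _ = _ := by ring
  have hT : ∀ x : ℝ, x ≤ -(1 / 4) → (T : ℝ) ^ x ≤ (T : ℝ) ^ (-(1 / 4) : ℝ) := fun x hx =>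
    Real.rpow_le_rpow_of_exponent_le (by linarith) hx
  have hlog : Real.log T ^ (3 / 2 : ℝ) ≤ Real.log T ^ 2 := by
    rw [← Real.rpow_natCast]
    exact Real.rpow_le_rpow_of_exponent_le hℓ (by norm_num)
  have hd2 : (d : ℝ) ^ (3 / 2 : ℝ) ≤ (d : ℝ) ^ 2 := by
    rw [← Real.rpow_natCast]
    exact Real.rpow_le_rpow_of_exponent_le hd (by norm_num)
  have hsp : ∀ n ≤ 8, sig0 ^ 8 ≤ sig0 ^ n := fun n hn => pow_le_pow_of_le_one hs.le hs1 hn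
  have hep : ∀ n ≤ 5, eps ^ 5 ≤ eps ^ n := fun n hn => pow_le_pow_of_le_one he.le he1 hn
  have hTn : ∀ x : ℝ, 0 ≤ (T : ℝ) ^ x := fun x => Real.rpow_nonneg (by linarith) x
  have k1 := key ((d : ℝ) ^ 2) _ (Real.log T ^ 2) _ _ (by positivity) le_rfl (hTn (-1))
    (hT _ (by norm_num)) (by positivity) le_rfl (hsp 8 le_rfl) (hep 5 le_rfl)
  have k2 := key d _ (Real.log T) _ _ (by positivity) (by nlinarith) (hTn (-(1 / 4)))
    (hT _ le_rfl) (by linarith) (by nlinarith) (hsp 4 (by norm_num)) (hep 3 (by norm_num))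
  have k3 := key ((d : ℝ) ^ (3 / 2 : ℝ)) _ (Real.log T ^ (3 / 2 : ℝ)) _ _ (by positivity) hd2
    (hTn (-(1 / 4))) (hT _ le_rfl) (by positivity) hlog (hsp 5 (by norm_num)) (hep 3 (by norm_num))
  have k4 := key ((d : ℝ) ^ 2) _ (Real.log T ^ (3 / 2 : ℝ)) _ _ (by positivity) le_rfl
    (hTn (-(1 / 2))) (hT _ (by norm_num)) (by positivity) hlog (hsp 6 (by norm_num))
    (hep 3 (by norm_num))
  linarith

end Regret

end CQB

theorem theorem1 :
    ∃ C3 : ℝ, 0 < C3 ∧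
      ∀ (K : ℕ) (lam kap S lam0 a : ℝ), 0 < lam → 0 < lam0 →
        ∃ C : ℝ, 0 < C ∧
          ∀ (d T : ℕ) (R sig0 eps delta : ℝ) (M : CQB.Model d K),
            CQB.Assumptions M lam kap R S sig0 eps →
            (T : ℝ) ^ (-a) ≤ delta → 0 < delta → delta ≤ (T : ℝ) ^ (-2 : ℝ) →
            4 / eps ^ 2 < (T : ℝ) →
            CQB.explorationLength C3 d K T lam kap S lam0 sig0 eps delta ≤ (T : ℝ) →
            ∀ (Ω : Type*) [m : MeasurableSpace Ω] (P : MeasureTheory.Measure Ω)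
              [MeasureTheory.IsProbabilityMeasure P] (ℱ : MeasureTheory.Filtration ℕ m)
              (N : CQB.Noise Ω d K) (π πopt : CQB.Schedule Ω K)
              (est : ℕ → Fin K → Ω → CQB.Vec d),
              CQB.IsNoise P ℱ M.dist lam (1 / Real.sqrt T) N →
              CQB.IsCQB M N π ℱ kap S lam0 delta
                (CQB.explorationLength C3 d K T lam kap S lam0 sig0 eps delta) est →
              CQB.IsOptimal M N πopt ℱ →
              MeasureTheory.Integrable (CQB.queueLength M N π T) P ∧
              MeasureTheory.Integrable (CQB.queueLength M N πopt T) P ∧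
              ∫ ω, (CQB.queueLength M N π T ω - CQB.queueLength M N πopt T ω) ∂P ≤
                C * ((d : ℝ) ^ 2 * (T : ℝ) ^ (-1 : ℝ) * Real.log T ^ 2 / (sig0 ^ 8 * eps ^ 5)
                  + (d : ℝ) * (T : ℝ) ^ (-(1 / 4) : ℝ) * Real.log T / (sig0 ^ 4 * eps ^ 3)
                  + (d : ℝ) ^ (3 / 2 : ℝ) * (T : ℝ) ^ (-(1 / 4) : ℝ) * Real.log T ^ (3 / 2 : ℝ)
                      / (sig0 ^ 5 * eps ^ 3)
                  + (d : ℝ) ^ 2 * (T : ℝ) ^ (-(1 / 2) : ℝ) * Real.log T ^ (3 / 2 : ℝ)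
                      / (sig0 ^ 6 * eps ^ 3)) ∧
              ∫ ω, (CQB.queueLength M N π T ω - CQB.queueLength M N πopt T ω) ∂P ≤
                C * ((d : ℝ) ^ 2 / (sig0 ^ 8 * eps ^ 5))
                  * (T : ℝ) ^ (-(1 / 4) : ℝ) * Real.log T ^ 2 := by
  refine ⟨66, by norm_num, fun K lam kap S lam0 a hlam hlam0 =>
    ⟨4 * max 1 (CQB.regretConst K lam kap S lam0 a), by positivity, ?_⟩⟩
  intro d T R sig0 eps delta M hA hd1 hd0 hd2 hT hlen Ω m P _ ℱ N π πopt est hN hπ hopt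
  have h := hA.admissible hlam hlam0 hd1 hd0 hd2 hT hlen
  have h4 := h.four_lt
  have hℓ := h.one_le_log
  have he := h.eps_pos
  have hs := h.sig0_pos
  have hmain := CQB.integral_regret_le_regretConst hA h hN hπ hopt
  have hrate := h.rate_le
  set A1 := (d : ℝ) ^ 2 * (T : ℝ) ^ (-1 : ℝ) * Real.log T ^ 2 / (sig0 ^ 8 * eps ^ 5)
  set A2 := (d : ℝ) * (T : ℝ) ^ (-(1 / 4) : ℝ) * Real.log T / (sig0 ^ 4 * eps ^ 3)
  set A3 := (d : ℝ) ^ (3 / 2 : ℝ) * (T : ℝ) ^ (-(1 / 4) : ℝ) * Real.log T ^ (3 / 2 : ℝ)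
    / (sig0 ^ 5 * eps ^ 3)
  set A4 := (d : ℝ) ^ 2 * (T : ℝ) ^ (-(1 / 2) : ℝ) * Real.log T ^ (3 / 2 : ℝ)
    / (sig0 ^ 6 * eps ^ 3)
  have hA1 : 0 ≤ A1 := by positivity
  have hA2 : 0 ≤ A2 := by positivity
  have hA3 : 0 ≤ A3 := by positivity
  have hA4 : 0 ≤ A4 := by positivity
  set C := max 1 (CQB.regretConst K lam kap S lam0 a)
  have hC : 0 < C := by positivity
  have hbound : ∫ ω, (CQB.queueLength M N π T ω - CQB.queueLength M N πopt T ω) ∂P ≤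
      C * (A1 + A2 + A3 + A4) := by
    refine hmain.trans ((mul_le_mul_of_nonneg_right (le_max_right 1 _) (by positivity)).trans ?_)
    exact mul_le_mul_of_nonneg_left (by linarith) hC.le
  refine ⟨CQB.integrable_queueLength hN hπ.adapted T, CQB.integrable_queueLength hN hopt.adapted T,
    hbound.trans ?_, hbound.trans ?_⟩
  · exact mul_le_mul_of_nonneg_right (by linarith) (by positivity)
  · refine (mul_le_mul_of_nonneg_left hrate hC.le).trans (le_of_eq ?_)
    ring
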